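/- Work in units with $[Q_j,P_j]=i$, and write $R=(Q_1,P_1,\dots,Q_n,P_n)$ for the quadratures of $n$ bosonic modes. A state $\rho_f$ of the modes is Gaussian with mean vector $\mu\in\mathbb R^{2n}$ and covariance matrix $\Sigma\in\mathbb R^{2n\times 2n}$ if $\mu_a=\mathrm{tr}(\rho_f R_a)$ and $\Sigma_{ab}=\tfrac12\mathrm{tr}(\rho_f\{R_a-\mu_a,R_b-\mu_b\})$ (all these moments being finite) and $\mathrm{tr}(\rho_f e^{i\xi\cdot R})=\exp(i\,\xi\cdot\mu-\tfrac12\,\xi\cdot\Sigma\xi)$ for all $\xi\in\mathbb R^{2n}$. Let $g_1,\dots,g_n,t\in\mathbb R$ and let $$H_{JC}=\sum_{i=1}^n g_i\,(a_i\sigma_i^{+}+a_i^{\dagger}\sigma_i^{-}),\qquad U_{JC}(t)=e^{-itH_{JC}},$$ act on $n$ modes and $n$ qubits, mode $i$ being coupled to qubit $i$. **Lemma.** Let $\rho_f$ be an $n$-mode Gaussian state with mean vector $\mu$ and covariance matrix $\Sigma$, let $\rho_q$ be any $n$-qubit density matrix, and let $j\ne k$ be in $\{1,\dots,n\}$. (i)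 The partial trace $\rho_f^{jk}$ of $\rho_f$ over all modes other than $j,k$ is a two-mode Gaussian state whose mean vector and covariance matrix consist of the entries of $\mu$ and $\Sigma$ that belong to the modes $j,k$; and the partial trace $\rho_q^{jk}$ of $\rho_q$ over all qubits other than $j,k$ is a two-qubit density matrix. (ii) Let $O_{jk}=\bigotimes_{i=1}^n P_i$ with $P_i\in\{\mathbb 1,X,Y,Z\}$ for all $i$ and $P_i=\mathbb 1$ for $i\notin\{j,k\}$. Then for every two-mode Gaussian state $\sigma$ with the mean vector and covariance matrix described in (i), $$\mathrm{tr}\big(O_{jk}\,U_{JC}(t)\,(\rho_f\otimes\rho_q)\,U_{JC}(t)^{\dagger}\big)=\mathrm{tr}\big((P_j\otimes P_k)\,V(t)\,(\sigma\otimes\rho_q^{jk})\,V(t)^{\dagger}\big),$$ where $V(t)=e^{-itH'}$ is the Jaynes–Cummings evolution of two modes and two qubits with couplings $g_j,g_k$. Both traces converge. -/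

import Mathlib

open scoped InnerProductSpace ComplexConjugate ComplexOrder

noncomputable section

namespace JCGauss

/-- The Hilbert space `ℓ²(S)` with orthonormal basis indexed by `S`. The Hilbert space of the
modes `ι` is `L2 (ι → ℕ)` (Fock basis), that of modes and qubits together is
`L2 ((ι → ℕ) × (ι → Fin 2))`, which is the Hilbert space tensor product. -/
abbrev L2 (S : Type) : Type := lp (fun _ : S => ℂ) 2

open Classical in
/-- The basis vector `|x⟩`. -/
def ket {S : Type} (x : S) : L2 S := lp.single 2 x (1 : ℂ)

/-- The dense domain of finite linear combinations of basis vectors, on which the unbounded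
operators (ladder operators, quadratures, Hamiltonians) act. -/
abbrev Core (S : Type) : Type := S →₀ ℂ

/-- The inclusion of the finite linear combinations of basis vectors into the Hilbert space. -/
def toL2 {S : Type} : Core S →ₗ[ℂ] L2 S := Finsupp.linearCombination ℂ ket

/-- `U` is the bounded operator `e^A`: on every finite linear combination `ψ` of basis vectors,
`U ψ = ∑ₖ Aᵏ ψ / k!`, with convergence in norm. As these vectors are dense, there is at most one
such `U`. -/
def IsExpOf {S : Type} (A : Module.End ℂ (Core S)) (U : L2 S →L[ℂ] L2 S) : Prop :=
  ∀ ψ : Core S, HasSum (fun k : ℕ => ((k.factorial : ℂ)⁻¹) • toL2 ((A ^ k) ψ)) (U (toL2 ψ))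

/-! ### Existence of exponentials of skew-symmetric operators with entire vectors -/

lemma orthonormal_ket {S : Type} : Orthonormal ℂ (ket : S → L2 S) := by
  classical
  rw [orthonormal_iff_ite]
  intro x y
  simp only [ket]
  rw [lp.inner_single_left, lp.single_apply]
  by_cases h : x = y
  · subst h; simp
  · simp [h]

lemma toL2_apply {S : Type} (φ : Core S) (x : S) : toL2 φ x = φ x := by
  classical
  induction φ using Finsupp.induction_linear with
  | zero => simp [toL2]
  | add f g hf hg => simp [map_add, hf, hg]
  | single y c =>
    simp only [toL2, Finsupp.linearCombination_single, ket, lp.coeFn_smul, Pi.smul_apply,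
      lp.single_apply, smul_eq_mul, Finsupp.single_apply, Pi.single_apply, eq_comm]
    split_ifs <;> simp

lemma denseRange_toL2 {S : Type} : DenseRange (toL2 : Core S → L2 S) := by
  classical
  intro f
  have h := lp.hasSum_single (p := 2) (by simp) f
  refine mem_closure_of_tendsto h (Filter.Eventually.of_forall fun s => ?_)
  refine ⟨∑ i ∈ s, Finsupp.single i (f i), ?_⟩
  ext x
  rw [toL2_apply]
  simp only [Finsupp.finsetSum_apply, lp.coeFn_sum, Finset.sum_apply, Finsupp.single_apply,
    lp.single_apply, Pi.single_apply, eq_comm]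

lemma inner_series {E : Type*} [NormedAddCommGroup E] [InnerProductSpace ℂ E] [CompleteSpace E]
    (u v : ℕ → E) (hu : Summable fun k => ‖u k‖) (hv : Summable fun k => ‖v k‖)
    (h : ∀ N : ℕ, 0 < N → ∑ p ∈ Finset.HasAntidiagonal.antidiagonal N, ⟪u p.1, v p.2⟫_ℂ = 0) :
    ⟪∑' k, u k, ∑' k, v k⟫_ℂ = ⟪u 0, v 0⟫_ℂ := by
  have hs : Summable fun p : ℕ × ℕ => ⟪u p.1, v p.2⟫_ℂ := by
    refine Summable.of_norm_bounded (hu.mul_of_nonneg hv (fun _ => norm_nonneg _)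
      (fun _ => norm_nonneg _)) fun p => norm_inner_le_norm _ _
  have h1 : ∑' p : ℕ × ℕ, ⟪u p.1, v p.2⟫_ℂ = ⟪∑' k, u k, ∑' k, v k⟫_ℂ := by
    rw [hs.tsum_prod]
    have e1 : ∀ j, ∑' k, ⟪u j, v k⟫_ℂ = ⟪u j, ∑' k, v k⟫_ℂ := fun j =>
      ((innerSL ℂ (u j)).map_tsum hv.of_norm).symm
    simp_rw [e1]
    have e2 := (innerSL ℂ (∑' k, v k)).map_tsum hu.of_norm
    simp only [innerSL_apply_apply] at e2
    rw [← inner_conj_symm, e2, Complex.conj_tsum]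
    exact tsum_congr fun j => (inner_conj_symm _ _).symm
  rw [← h1, ← Finset.HasAntidiagonal.sigmaAntidiagonalEquivProd.tsum_eq]
  have hs' := Finset.HasAntidiagonal.sigmaAntidiagonalEquivProd.summable_iff.mpr hs
  refine (Summable.tsum_sigma' (fun _ => (hasSum_fintype _).summable) hs').trans ?_
  rw [tsum_eq_single 0]
  · simp [Finset.HasAntidiagonal.sigmaAntidiagonalEquivProd]
  · intro N hN
    rw [tsum_fintype]
    have := h N (Nat.pos_of_ne_zero hN)
    rw [← Finset.sum_coe_sort] at this
    exact this

/-- Every vector of the dense domain is an entire vector of `A`. -/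
def Entire {S : Type} (A : Module.End ℂ (Core S)) : Prop :=
  ∀ ψ : Core S, Summable fun k : ℕ => ‖((k.factorial : ℂ)⁻¹) • toL2 ((A ^ k) ψ)‖

/-- Skew-symmetric operators. -/
def Skew {S : Type} (A : Module.End ℂ (Core S)) : Prop :=
  ∀ φ ψ : Core S, ⟪toL2 (A φ), toL2 ψ⟫_ℂ = - ⟪toL2 φ, toL2 (A ψ)⟫_ℂ

lemma Skew.pow {S : Type} {A : Module.End ℂ (Core S)} (hA : Skew A) (j : ℕ) :
    ∀ φ ψ : Core S, ⟪toL2 ((A ^ j) φ), toL2 ψ⟫_ℂ = (-1) ^ j * ⟪toL2 φ, toL2 ((A ^ j) ψ)⟫_ℂ := by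
  induction j with
  | zero => simp
  | succ j ih =>
    intro φ ψ
    rw [pow_succ', Module.End.mul_apply, hA, ih, ← Module.End.mul_apply, ← pow_succ, ← pow_succ']
    ring

theorem exists_isExpOf {S : Type} {A : Module.End ℂ (Core S)} (hA : Skew A) (hE : Entire A) :
    ∃ U : L2 S →L[ℂ] L2 S, IsExpOf A U := by
  let T : Core S →ₗ[ℂ] L2 S :=
    { toFun := fun ψ => ∑' k : ℕ, ((k.factorial : ℂ)⁻¹) • toL2 ((A ^ k) ψ)
      map_add' := fun φ ψ => by
        simp only [map_add, smul_add]
        exact (hE φ).of_norm.tsum_add (hE ψ).of_norm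
      map_smul' := fun c φ => by
        simp only [map_smul, RingHom.id_apply]
        rw [← (hE φ).of_norm.tsum_const_smul]
        simp only [smul_comm c] }
  have hT : ∀ ψ, ‖T ψ‖ = ‖toL2 ψ‖ := by
    intro ψ
    have := inner_series _ _ (hE ψ) (hE ψ) (by
      intro N hN
      have : ∀ p ∈ Finset.HasAntidiagonal.antidiagonal N,
          ⟪((p.1.factorial : ℂ)⁻¹) • toL2 ((A ^ p.1) ψ), ((p.2.factorial : ℂ)⁻¹) • toL2 ((A ^ p.2) ψ)⟫_ℂ
          = (((N.factorial : ℂ)⁻¹) * ⟪toL2 ψ, toL2 ((A ^ N) ψ)⟫_ℂ) * ((N.choose p.1) * (-1) ^ p.1) := by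
        intro p hp
        rw [Finset.HasAntidiagonal.mem_antidiagonal] at hp
        rw [inner_smul_left, inner_smul_right, hA.pow, ← Module.End.mul_apply, ← pow_add, hp]
        have h1 : (N.choose p.1 : ℂ) * (p.1.factorial * p.2.factorial) = N.factorial := by
          rw [← hp]; exact_mod_cast (by rw [← mul_assoc, Nat.choose_symm_add]; exact Nat.add_choose_mul_factorial_mul_factorial _ _)
        have a1 : (p.1.factorial : ℂ) ≠ 0 := by exact_mod_cast p.1.factorial_ne_zero
        have a2 : (p.2.factorial : ℂ) ≠ 0 := by exact_mod_cast p.2.factorial_ne_zero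
        have a3 : (N.factorial : ℂ) ≠ 0 := by exact_mod_cast N.factorial_ne_zero
        simp only [map_inv₀, map_natCast]
        field_simp
        rw [← h1]; ring
      rw [Finset.sum_congr rfl this, ← Finset.mul_sum,
        Finset.Nat.sum_antidiagonal_eq_sum_range_succ (fun i _ => (N.choose i : ℂ) * (-1) ^ i) N]
      have := Int.alternating_sum_range_choose_of_ne hN.ne'
      have h2 : (∑ i ∈ Finset.range (N + 1), (N.choose i : ℂ) * (-1) ^ i) = 0 := by
        have := congrArg (Int.cast : ℤ → ℂ) this
        push_cast at this
        rw [← this]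
        exact Finset.sum_congr rfl fun i _ => mul_comm _ _
      rw [Nat.succ_eq_add_one, h2, mul_zero])
    have h0 : ⟪T ψ, T ψ⟫_ℂ = ⟪toL2 ψ, toL2 ψ⟫_ℂ := by simpa using! this
    rw [inner_self_eq_norm_sq_to_K, inner_self_eq_norm_sq_to_K] at h0
    have h1 : ‖T ψ‖ ^ 2 = ‖toL2 ψ‖ ^ 2 := by exact_mod_cast h0
    exact (pow_left_inj₀ (norm_nonneg _) (norm_nonneg _) two_ne_zero).mp h1
  refine ⟨T.extendOfNorm toL2, fun ψ => ?_⟩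
  rw [LinearMap.extendOfNorm_eq denseRange_toL2 ⟨1, fun x => by rw [hT, one_mul]⟩]
  exact (hE ψ).of_norm.hasSum


/-- The `ℓ¹`-norm. -/
def l1 {S : Type} (φ : Core S) : ℝ := ∑ x ∈ φ.support, ‖φ x‖

lemma l1_eq {S : Type} (φ : Core S) (s : Finset S) (h : φ.support ⊆ s) : l1 φ = ∑ x ∈ s, ‖φ x‖ :=
  Finset.sum_subset h fun x _ hx => by simp [Finsupp.notMem_support_iff.mp hx]

lemma l1_nonneg {S : Type} (φ : Core S) : 0 ≤ l1 φ := Finset.sum_nonneg fun _ _ => norm_nonneg _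

lemma l1_add {S : Type} (φ ψ : Core S) : l1 (φ + ψ) ≤ l1 φ + l1 ψ := by
  classical
  rw [l1_eq (φ + ψ) (φ.support ∪ ψ.support) Finsupp.support_add,
    l1_eq φ _ Finset.subset_union_left, l1_eq ψ _ Finset.subset_union_right,
    ← Finset.sum_add_distrib]
  exact Finset.sum_le_sum fun x _ => norm_add_le _ _

lemma l1_smul {S : Type} (c : ℂ) (φ : Core S) : l1 (c • φ) = ‖c‖ * l1 φ := by
  rw [l1_eq (c • φ) φ.support Finsupp.support_smul, l1, Finset.mul_sum]
  simp

lemma l1_single {S : Type} (x : S) (c : ℂ) : l1 (Finsupp.single x c) = ‖c‖ := by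
  rw [l1_eq _ {x} Finsupp.support_single_subset]; simp

lemma norm_toL2_le {S : Type} (φ : Core S) : ‖toL2 φ‖ ≤ l1 φ := by
  rw [toL2, Finsupp.linearCombination_apply, Finsupp.sum]
  refine (norm_sum_le _ _).trans (Finset.sum_le_sum fun x _ => ?_)
  rw [norm_smul, orthonormal_ket.1, mul_one]

/-- Vectors with grading at most `M` and `ℓ¹`-norm at most `c`. -/
def Bdd {S : Type} (N : S → ℕ) (M : ℕ) (c : ℝ) (φ : Core S) : Prop :=
  (∀ x, φ x ≠ 0 → N x ≤ M) ∧ l1 φ ≤ c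

lemma Bdd.add {S : Type} {N : S → ℕ} {M : ℕ} {c d : ℝ} {φ ψ : Core S} (h : Bdd N M c φ)
    (h' : Bdd N M d ψ) : Bdd N M (c + d) (φ + ψ) := by
  refine ⟨fun x hx => ?_, (l1_add _ _).trans (add_le_add h.2 h'.2)⟩
  by_cases h0 : φ x = 0
  · exact h'.1 x fun h1 => hx (by simp [h0, h1])
  · exact h.1 x h0

lemma Bdd.smul {S : Type} {N : S → ℕ} {M : ℕ} {c : ℝ} {φ : Core S} (h : Bdd N M c φ) (a : ℂ) :
    Bdd N M (‖a‖ * c) (a • φ) := by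
  refine ⟨fun x hx => h.1 x fun h0 => hx (by simp [h0]), ?_⟩
  rw [l1_smul]; exact mul_le_mul_of_nonneg_left h.2 (norm_nonneg _)

lemma Bdd.zero {S : Type} {N : S → ℕ} {M : ℕ} : Bdd N M 0 (0 : Core S) :=
  ⟨fun x hx => absurd rfl hx, by simp [l1]⟩

lemma Bdd.sum {S κ : Type} {N : S → ℕ} {M : ℕ} (s : Finset κ) {c : κ → ℝ} {φ : κ → Core S}
    (h : ∀ i ∈ s, Bdd N M (c i) (φ i)) : Bdd N M (∑ i ∈ s, c i) (∑ i ∈ s, φ i) := by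
  classical
  induction s using Finset.induction_on with
  | empty => simpa using Bdd.zero
  | insert a s ha ih =>
    rw [Finset.sum_insert ha, Finset.sum_insert ha]
    exact (h a (by simp)).add (ih fun i hi => h i (by simp [hi]))

/-- Operators raising the grading by at most one, with matrix elements growing at most like the
square root of the grading. -/
def LinearGrowth {S : Type} (N : S → ℕ) (A : Module.End ℂ (Core S)) : Prop :=
  ∃ C : ℝ, 0 ≤ C ∧ ∀ x, Bdd N (N x + 1) (C * √(N x + 1)) (A (Finsupp.single x 1))

lemma LinearGrowth.add {S : Type} {N : S → ℕ} {A B : Module.End ℂ (Core S)} (hA : LinearGrowth N A)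
    (hB : LinearGrowth N B) : LinearGrowth N (A + B) := by
  obtain ⟨C, hC, h⟩ := hA
  obtain ⟨D, hD, h'⟩ := hB
  refine ⟨C + D, add_nonneg hC hD, fun x => ?_⟩
  rw [add_mul]; exact (h x).add (h' x)

lemma LinearGrowth.smul {S : Type} {N : S → ℕ} {A : Module.End ℂ (Core S)} (hA : LinearGrowth N A)
    (a : ℂ) : LinearGrowth N (a • A) := by
  obtain ⟨C, hC, h⟩ := hA
  refine ⟨‖a‖ * C, mul_nonneg (norm_nonneg _) hC, fun x => ?_⟩
  rw [mul_assoc]; exact (h x).smul a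

lemma LinearGrowth.sum {S κ : Type} {N : S → ℕ} (s : Finset κ) {A : κ → Module.End ℂ (Core S)}
    (hA : ∀ i, LinearGrowth N (A i)) : LinearGrowth N (∑ i ∈ s, A i) := by
  classical
  induction s using Finset.induction_on with
  | empty =>
    refine ⟨0, le_rfl, fun x => ?_⟩
    simpa using Bdd.zero
  | insert a s ha ih => rw [Finset.sum_insert ha]; exact (hA a).add ih

lemma LinearGrowth.entire {S : Type} {N : S → ℕ} {A : Module.End ℂ (Core S)}
    (hA : LinearGrowth N A) : Entire A := by
  obtain ⟨C, hC, h⟩ := hA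
  have step : ∀ M c φ, Bdd N M c φ → Bdd N (M + 1) ((C + 1) * √(M + 1) * c) (A φ) := by
    intro M c φ hφ
    have e : A φ = ∑ x ∈ φ.support, φ x • A (Finsupp.single x 1) := by
      conv_lhs => rw [← Finsupp.sum_single φ, Finsupp.sum, map_sum]
      refine Finset.sum_congr rfl fun x _ => ?_
      rw [← map_smul, Finsupp.smul_single, smul_eq_mul, mul_one]
    have b : ∀ x ∈ φ.support, Bdd N (M + 1) (‖φ x‖ * ((C + 1) * √(M + 1)))
        (φ x • A (Finsupp.single x 1)) := by
      intro x hx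
      have hx' : N x ≤ M := hφ.1 x (Finsupp.mem_support_iff.mp hx)
      refine Bdd.smul ⟨fun y hy => ((h x).1 y hy).trans (by omega), (h x).2.trans ?_⟩ _
      have : (N x : ℝ) ≤ M := by exact_mod_cast hx'
      gcongr
      linarith
    have := Bdd.sum _ b
    rw [← e, ← Finset.sum_mul] at this
    refine ⟨this.1, this.2.trans ?_⟩
    rw [mul_comm]
    exact mul_le_mul_of_nonneg_left hφ.2 (by positivity)
  intro ψ
  obtain ⟨M, hM⟩ : ∃ M, ∀ x, ψ x ≠ 0 → N x ≤ M :=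
    ⟨ψ.support.sup N, fun x hx => Finset.le_sup (f := N) (Finsupp.mem_support_iff.mpr hx)⟩
  let b : ℕ → ℝ := fun k => Nat.rec (l1 ψ + 1) (fun i r => (C + 1) * √(M + i + 1) * r) k
  have hb : ∀ k, b (k + 1) = (C + 1) * √(M + k + 1) * b k := fun k => rfl
  have hbpos : ∀ k, 0 < b k := by
    intro k
    induction k with
    | zero => have := l1_nonneg ψ; change 0 < l1 ψ + 1; linarith
    | succ k ih => rw [hb]; positivity
  have hpow : ∀ k, Bdd N (M + k) (b k) ((A ^ k) ψ) := by
    intro k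
    induction k with
    | zero => exact ⟨hM, by change l1 ψ ≤ l1 ψ + 1; linarith⟩
    | succ k ih =>
      rw [pow_succ', Module.End.mul_apply, hb]
      have := step _ _ _ ih
      push_cast at this
      exact this
  have hsum : Summable fun k : ℕ => b k / k.factorial := by
    refine summable_of_ratio_test_tendsto_lt_one (l := 0) one_pos
      (Filter.Eventually.of_forall fun k => by have := hbpos k; positivity) ?_
    have e : ∀ k : ℕ, ‖b (k + 1) / (k + 1).factorial‖ / ‖b k / k.factorial‖
        = (C + 1) * √((M + k + 1) / (k + 1) ^ 2) := by
      intro k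
      have h1 := hbpos k
      have h2 := hbpos (k + 1)
      rw [Real.norm_of_nonneg (by positivity), Real.norm_of_nonneg (by positivity), hb,
        Nat.factorial_succ, Real.sqrt_div (by positivity), Real.sqrt_sq (by positivity)]
      push_cast
      field_simp
    simp_rw [e]
    rw [show (0 : ℝ) = (C + 1) * √0 by simp]
    refine (Filter.Tendsto.sqrt ?_).const_mul _
    have l1' : Filter.Tendsto (fun k : ℕ => 1 / ((k : ℝ) + 1)) Filter.atTop (nhds 0) :=
      tendsto_one_div_add_atTop_nhds_zero_nat
    have l2' := l1'.add ((l1'.mul l1').const_mul (M : ℝ))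
    simp only [mul_zero, add_zero] at l2'
    refine l2'.congr fun k => ?_
    have : (k : ℝ) + 1 ≠ 0 := by positivity
    field_simp
    ring
  refine hsum.of_nonneg_of_le (fun _ => norm_nonneg _) fun k => ?_
  rw [norm_smul, norm_inv, Complex.norm_natCast, div_eq_inv_mul]
  exact mul_le_mul_of_nonneg_left ((norm_toL2_le _).trans (hpow k).2) (by positivity)

/-- Formal adjoints on the dense domain. -/
def Adj {S : Type} (A B : Module.End ℂ (Core S)) : Prop :=
  ∀ x y, conj (A (Finsupp.single x 1) y) = B (Finsupp.single y 1) x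

lemma inner_toL2_ket {S : Type} (φ : Core S) (x : S) : ⟪toL2 φ, ket x⟫_ℂ = conj (φ x) := by
  classical
  rw [ket, lp.inner_single_right, toL2_apply]; simp

lemma Adj.inner {S : Type} {A B : Module.End ℂ (Core S)} (h : Adj A B) (φ ψ : Core S) :
    ⟪toL2 (A φ), toL2 ψ⟫_ℂ = ⟪toL2 φ, toL2 (B ψ)⟫_ℂ := by
  induction φ using Finsupp.induction_linear with
  | zero => simp
  | add f g hf hg => simp only [map_add, inner_add_left, hf, hg]
  | single x a =>
  induction ψ using Finsupp.induction_linear with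
  | zero => simp
  | add f g hf hg => simp only [map_add, inner_add_right, hf, hg]
  | single y b =>
    have e : ∀ (z : S) (c : ℂ), Finsupp.single z c = c • Finsupp.single z (1 : ℂ) := by simp
    have t : ∀ z : S, toL2 (Finsupp.single z (1 : ℂ)) = ket z := by simp [toL2]
    rw [e x a, e y b]
    simp only [map_smul, inner_smul_left, inner_smul_right, t]
    rw [inner_toL2_ket, h, ← inner_conj_symm, inner_toL2_ket]
    simp

lemma Adj.symm {S : Type} {A B : Module.End ℂ (Core S)} (h : Adj A B) : Adj B A :=
  fun x y => by rw [← h, Complex.conj_conj]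

lemma Adj.add {S : Type} {A B A' B' : Module.End ℂ (Core S)} (h : Adj A B) (h' : Adj A' B') :
    Adj (A + A') (B + B') := fun x y => by simp [h x y, h' x y]

lemma Adj.smul {S : Type} {A B : Module.End ℂ (Core S)} (h : Adj A B) (c : ℂ) :
    Adj (c • A) (conj c • B) := fun x y => by simp [h x y]

lemma Adj.sum {S κ : Type} {A B : κ → Module.End ℂ (Core S)} (h : ∀ i, Adj (A i) (B i))
    (s : Finset κ) : Adj (∑ i ∈ s, A i) (∑ i ∈ s, B i) := fun x y => by
  simp [LinearMap.sum_apply, Finsupp.finsetSum_apply, h _ x y]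

lemma Adj.skew {S : Type} {A : Module.End ℂ (Core S)} (h : Adj A A) (t : ℝ) :
    Skew ((Complex.I * t) • A) := fun φ ψ => by
  have h' := (h.smul (Complex.I * t)).inner φ ψ
  rw [h']
  simp [inner_smul_right]


open Matrix

/-! ### Ladder operators, quadratures, the Jaynes-Cummings Hamiltonian -/

/-- The annihilation operator `a_j |x⟩ = √(x_j) |x - 1_j⟩`. -/
def annihilation {ι : Type} [DecidableEq ι] (j : ι) : Module.End ℂ (Core (ι → ℕ)) :=
  Finsupp.linearCombination ℂ fun x =>
    Finsupp.single (Function.update x j (x j - 1)) ((√(x j : ℝ) : ℝ) : ℂ)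

/-- The creation operator `a_j† |x⟩ = √(x_j + 1) |x + 1_j⟩`. -/
def creation {ι : Type} [DecidableEq ι] (j : ι) : Module.End ℂ (Core (ι → ℕ)) :=
  Finsupp.linearCombination ℂ fun x =>
    Finsupp.single (Function.update x j (x j + 1)) ((√((x j : ℝ) + 1) : ℝ) : ℂ)

/-- The quadratures `Q_j = (a_j + a_j†) / √2`, with index `(j, 0)`, and
`P_j = -i (a_j - a_j†) / √2`, with index `(j, 1)`. -/
def quadrature {ι : Type} [DecidableEq ι] (k : ι × Fin 2) : Module.End ℂ (Core (ι → ℕ)) :=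
  if k.2 = 0 then ((1 / √2 : ℝ) : ℂ) • (annihilation k.1 + creation k.1)
  else (-Complex.I * ((1 / √2 : ℝ) : ℂ)) • (annihilation k.1 - creation k.1)

/-- The tensor product `A ⊗ B` of operators on the dense domains. -/
def coreTensor {S T : Type} (A : Module.End ℂ (Core S)) (B : Module.End ℂ (Core T)) :
    Module.End ℂ (Core (S × T)) :=
  (finsuppTensorFinsupp' ℂ S T).conj (TensorProduct.map A B)

/-- The operator on the dense domain given by a finite matrix. -/
def matrixOp {T : Type} [Fintype T] (M : Matrix T T ℂ) : Module.End ℂ (Core T) :=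
  Finsupp.linearCombination ℂ fun y => ∑ x, Finsupp.single x (M x y)

/-- The operator on the qubits `ι` that acts as `m` on qubit `j` and trivially elsewhere. -/
def atQubit {ι : Type} [Fintype ι] [DecidableEq ι] (j : ι) (m : Matrix (Fin 2) (Fin 2) ℂ) :
    Matrix (ι → Fin 2) (ι → Fin 2) ℂ :=
  Matrix.of fun x y => if ∀ i, i ≠ j → x i = y i then m (x j) (y j) else 0

/-- `H_JC = ∑ⱼ gⱼ (aⱼ σⱼ⁺ + aⱼ† σⱼ⁻)`. The qubit basis is `0 ↔ |e⟩`, `1 ↔ |g⟩`, so that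
`σ⁺ = |e⟩⟨g|` and `|g⟩` is the `-1` eigenvector of `Z`. -/
def jcHamiltonian {ι : Type} [Fintype ι] [DecidableEq ι] (g : ι → ℝ) :
    Module.End ℂ (Core ((ι → ℕ) × (ι → Fin 2))) :=
  ∑ j, (g j : ℂ) • (coreTensor (annihilation j) (matrixOp (atQubit j !![0, 1; 0, 0]))
    + coreTensor (creation j) (matrixOp (atQubit j !![0, 0; 1, 0])))

/-! ### Existence of the Weyl operators and of the evolution -/

lemma annihilation_single {ι : Type} [DecidableEq ι] (j : ι) (x : ι → ℕ) :
    annihilation j (Finsupp.single x 1) =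
      Finsupp.single (Function.update x j (x j - 1)) ((√(x j : ℝ) : ℝ) : ℂ) := by
  simp [annihilation]

lemma creation_single {ι : Type} [DecidableEq ι] (j : ι) (x : ι → ℕ) :
    creation j (Finsupp.single x 1) =
      Finsupp.single (Function.update x j (x j + 1)) ((√((x j : ℝ) + 1) : ℝ) : ℂ) := by
  simp [creation]

lemma adj_annihilation {ι : Type} [DecidableEq ι] (j : ι) :
    Adj (annihilation j) (creation j) := by
  classical
  intro x y
  rw [annihilation_single, creation_single, Finsupp.single_apply, Finsupp.single_apply]
  by_cases h : Function.update y j (y j + 1) = x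
  · subst h
    simp
  · rw [if_neg h]
    split_ifs with h'
    · rcases Nat.eq_zero_or_pos (x j) with h0 | h0
      · simp [h0]
      · refine absurd ?_ h
        subst h'
        ext i
        by_cases hi : i = j
        · subst hi; simp; omega
        · simp [hi]
    · simp

/-- The total photon number of a Fock basis vector. -/
def photonNumber {ι : Type} [Fintype ι] (x : ι → ℕ) : ℕ := ∑ i, x i

lemma photonNumber_update {ι : Type} [Fintype ι] [DecidableEq ι] (x : ι → ℕ) (j : ι) (m : ℕ)
    (h : m ≤ x j + 1) : photonNumber (Function.update x j m) ≤ photonNumber x + 1 := by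
  rw [photonNumber, photonNumber, Finset.sum_update_of_mem (Finset.mem_univ j),
    ← Finset.add_sum_erase _ x (Finset.mem_univ j), Finset.sdiff_singleton_eq_erase]
  omega

lemma le_photonNumber {ι : Type} [Fintype ι] (x : ι → ℕ) (j : ι) : x j ≤ photonNumber x :=
  Finset.single_le_sum (f := x) (fun _ _ => Nat.zero_le _) (Finset.mem_univ j)

lemma bdd_single {S : Type} {N : S → ℕ} {M : ℕ} {c : ℝ} (x : S) (a : ℂ) (h : N x ≤ M)
    (ha : ‖a‖ ≤ c) : Bdd N M c (Finsupp.single x a) := by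
  classical
  refine ⟨fun y hy => ?_, by rwa [l1_single]⟩
  rw [Finsupp.single_apply] at hy
  split_ifs at hy with e
  · exact e ▸ h
  · exact absurd rfl hy

lemma bdd_annihilation {ι : Type} [Fintype ι] [DecidableEq ι] (j : ι) (x : ι → ℕ) :
    Bdd photonNumber (photonNumber x + 1) √(photonNumber x + 1)
      (annihilation j (Finsupp.single x 1)) := by
  rw [annihilation_single]
  refine bdd_single _ _ (photonNumber_update _ _ _ (by omega)) ?_
  rw [Complex.norm_real, Real.norm_of_nonneg (Real.sqrt_nonneg _)]
  have : (x j : ℝ) ≤ photonNumber x := by exact_mod_cast le_photonNumber x j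
  exact Real.sqrt_le_sqrt (by linarith)

lemma bdd_creation {ι : Type} [Fintype ι] [DecidableEq ι] (j : ι) (x : ι → ℕ) :
    Bdd photonNumber (photonNumber x + 1) √(photonNumber x + 1)
      (creation j (Finsupp.single x 1)) := by
  rw [creation_single]
  refine bdd_single _ _ (photonNumber_update _ _ _ (by omega)) ?_
  rw [Complex.norm_real, Real.norm_of_nonneg (Real.sqrt_nonneg _)]
  have : (x j : ℝ) ≤ photonNumber x := by exact_mod_cast le_photonNumber x j
  exact Real.sqrt_le_sqrt (by linarith)

lemma linearGrowth_quadrature {ι : Type} [Fintype ι] [DecidableEq ι] (k : ι × Fin 2) :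
    LinearGrowth photonNumber (quadrature k) := by
  have h1 : LinearGrowth photonNumber (annihilation k.1) :=
    ⟨1, zero_le_one, fun x => by simpa using bdd_annihilation k.1 x⟩
  have h2 : LinearGrowth photonNumber (creation k.1) :=
    ⟨1, zero_le_one, fun x => by simpa using bdd_creation k.1 x⟩
  unfold quadrature
  split_ifs
  · exact (h1.add h2).smul _
  · have e : annihilation k.1 - creation k.1 = annihilation k.1 + (-1 : ℂ) • creation k.1 := by
      module
    rw [e]
    exact (h1.add (h2.smul _)).smul _

lemma adj_quadrature {ι : Type} [DecidableEq ι] (k : ι × Fin 2) :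
    Adj (quadrature k) (quadrature k) := by
  have h := adj_annihilation k.1
  unfold quadrature
  split_ifs
  · have := (h.add h.symm).smul ((1 / √2 : ℝ) : ℂ)
    rwa [Complex.conj_ofReal, add_comm (creation k.1)] at this
  · intro x y
    simp only [LinearMap.smul_apply, LinearMap.sub_apply, Finsupp.smul_apply, Finsupp.sub_apply,
      smul_eq_mul, map_mul, map_sub, map_neg, Complex.conj_I, Complex.conj_ofReal, h x y,
      h.symm x y]
    ring

theorem exists_weyl {ι : Type} [Fintype ι] [DecidableEq ι] (ξ : ι × Fin 2 → ℝ) :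
    ∃ W : L2 (ι → ℕ) →L[ℂ] L2 (ι → ℕ), IsExpOf (Complex.I • ∑ k, (ξ k : ℂ) • quadrature k) W := by
  have hA : Adj (∑ k, (ξ k : ℂ) • quadrature (ι := ι) k) (∑ k, (ξ k : ℂ) • quadrature k) :=
    Adj.sum (fun k => by simpa using (adj_quadrature k).smul (ξ k : ℂ)) _
  have hs := hA.skew 1
  rw [Complex.ofReal_one, mul_one] at hs
  exact exists_isExpOf hs
    (((LinearGrowth.sum _ fun k => (linearGrowth_quadrature k).smul _).smul _).entire)

lemma coreTensor_single {S T : Type} (A : Module.End ℂ (Core S)) (B : Module.End ℂ (Core T))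
    (p : S × T) : coreTensor A B (Finsupp.single p 1) =
      finsuppTensorFinsupp' ℂ S T (A (Finsupp.single p.1 1) ⊗ₜ B (Finsupp.single p.2 1)) := by
  rw [coreTensor, LinearEquiv.conj_apply_apply, ← Prod.mk.eta (p := p),
    finsuppTensorFinsupp'_symm_single_eq_single_one_tmul, TensorProduct.map_tmul]

lemma adj_coreTensor {S T : Type} {A A' : Module.End ℂ (Core S)} {B B' : Module.End ℂ (Core T)}
    (hA : Adj A A') (hB : Adj B B') : Adj (coreTensor A B) (coreTensor A' B') := by
  intro x y
  rw [coreTensor_single, coreTensor_single, finsuppTensorFinsupp'_apply_apply,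
    finsuppTensorFinsupp'_apply_apply, map_mul, hA, hB]

lemma matrixOp_single {T : Type} [Fintype T] (M : Matrix T T ℂ) (y x : T) :
    matrixOp M (Finsupp.single y 1) x = M x y := by
  classical
  simp [matrixOp, Finsupp.finsetSum_apply, Finsupp.single_apply]

lemma adj_matrixOp {T : Type} [Fintype T] (M : Matrix T T ℂ) :
    Adj (matrixOp M) (matrixOp Mᴴ) := by
  intro x y
  rw [matrixOp_single, matrixOp_single]; rfl

lemma l1_tensor {S T : Type} (φ : Core S) (ψ : Core T) :
    l1 (finsuppTensorFinsupp' ℂ S T (φ ⊗ₜ ψ)) ≤ l1 φ * l1 ψ := by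
  classical
  rw [l1_eq _ (φ.support ×ˢ ψ.support) (by
    intro p hp
    rw [Finsupp.mem_support_iff, finsuppTensorFinsupp'_apply_apply] at hp
    simp only [Finset.mem_product, Finsupp.mem_support_iff]
    exact ⟨left_ne_zero_of_mul hp, right_ne_zero_of_mul hp⟩), l1, l1, Finset.sum_mul_sum,
    Finset.sum_product]
  simp [finsuppTensorFinsupp'_apply_apply]

lemma linearGrowth_tensor {ι T : Type} [Fintype ι] [Fintype T]
    (A : Module.End ℂ (Core (ι → ℕ))) (M : Matrix T T ℂ)
    (hA : ∀ x, Bdd photonNumber (photonNumber x + 1) √(photonNumber x + 1)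
      (A (Finsupp.single x 1))) :
    LinearGrowth (fun p : (ι → ℕ) × T => photonNumber p.1) (coreTensor A (matrixOp M)) := by
  have hnn : ∀ y, 0 ≤ l1 (matrixOp M (Finsupp.single y 1)) := fun y => l1_nonneg _
  refine ⟨∑ y, l1 (matrixOp M (Finsupp.single y 1)), Finset.sum_nonneg fun y _ => hnn y,
    fun p => ⟨fun q hq => ?_, ?_⟩⟩
  · rw [coreTensor_single, finsuppTensorFinsupp'_apply_apply] at hq
    exact (hA p.1).1 _ (left_ne_zero_of_mul hq)
  · rw [coreTensor_single, mul_comm]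
    refine (l1_tensor _ _).trans (mul_le_mul (hA p.1).2 ?_ (hnn _) (Real.sqrt_nonneg _))
    exact Finset.single_le_sum (f := fun y => l1 (matrixOp M (Finsupp.single y 1)))
      (fun y _ => hnn y) (Finset.mem_univ p.2)

lemma atQubit_conjTranspose {ι : Type} [Fintype ι] [DecidableEq ι] (j : ι) :
    (atQubit j !![0, 1; 0, 0])ᴴ = atQubit (ι := ι) j !![0, 0; 1, 0] := by
  ext x y
  have : (∀ i, i ≠ j → y i = x i) ↔ (∀ i, i ≠ j → x i = y i) := by simp only [eq_comm]
  simp only [atQubit, conjTranspose_apply, of_apply, this]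
  split_ifs
  · generalize x j = a
    generalize y j = b
    fin_cases a <;> fin_cases b <;> simp
  · simp

theorem exists_jcUnitary {ι : Type} [Fintype ι] [DecidableEq ι] (g : ι → ℝ) (t : ℝ) :
    ∃ U : L2 ((ι → ℕ) × (ι → Fin 2)) →L[ℂ] L2 ((ι → ℕ) × (ι → Fin 2)),
      IsExpOf ((-Complex.I * t) • jcHamiltonian g) U := by
  have hA : Adj (jcHamiltonian g) (jcHamiltonian g) := by
    refine Adj.sum (fun j => ?_) _
    have h1 := adj_coreTensor (adj_annihilation j) (adj_matrixOp (atQubit j !![0, 1; 0, 0]))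
    rw [atQubit_conjTranspose] at h1
    have h2 := (h1.add h1.symm).smul (g j : ℂ)
    rw [Complex.conj_ofReal] at h2
    rw [add_comm (coreTensor (creation j) _)] at h2
    exact h2
  have hs := hA.skew (-t)
  rw [Complex.ofReal_neg, mul_neg, ← neg_mul] at hs
  refine exists_isExpOf hs (LinearGrowth.entire (N := fun p => photonNumber p.1) ?_)
  exact (LinearGrowth.sum _ fun j => ((linearGrowth_tensor _ _ (bdd_annihilation j)).add
    (linearGrowth_tensor _ _ (bdd_creation j))).smul _).smul _

/-- The Weyl (displacement) operator `e^{i ξ·R}`, where `R` is the vector of quadratures. -/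
def weyl {ι : Type} [Fintype ι] [DecidableEq ι] (ξ : ι × Fin 2 → ℝ) :
    L2 (ι → ℕ) →L[ℂ] L2 (ι → ℕ) := (exists_weyl ξ).choose

/-- The Jaynes-Cummings evolution `U_JC(t) = e^{-i t H_JC}`. -/
def jcUnitary {ι : Type} [Fintype ι] [DecidableEq ι] (g : ι → ℝ) (t : ℝ) :
    L2 ((ι → ℕ) × (ι → Fin 2)) →L[ℂ] L2 ((ι → ℕ) × (ι → Fin 2)) := (exists_jcUnitary g t).choose

/-- The isometry `|s⟩ ↦ |f s⟩`. -/
def relabel {S S' : Type} (f : S ↪ S') : L2 S →L[ℂ] L2 S' :=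
  ((orthonormal_ket.comp f f.injective).orthogonalFamily.linearIsometry).toContinuousLinearMap

/-! ### States and expectation values -/

/-- The trace `∑ₓ ⟨x|T|x⟩` converges (unconditionally) to `c`. -/
def HasTrace {S : Type} (T : L2 S →L[ℂ] L2 S) (c : ℂ) : Prop :=
  HasSum (fun x => ⟪ket x, T (ket x)⟫_ℂ) c

/-- `A ⊗ M`, for a bounded operator `A` and a finite matrix `M`:
`A ⊗ M = ∑_{a,b} M_{ab} (1 ⊗ |a⟩) A (1 ⊗ ⟨b|)`. -/
def tensorOp {S T : Type} [Fintype T] (A : L2 S →L[ℂ] L2 S) (M : Matrix T T ℂ) :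
    L2 (S × T) →L[ℂ] L2 (S × T) :=
  ∑ a, ∑ b, M a b • (relabel (Function.Embedding.sectL S a) ∘L A ∘L
    ContinuousLinearMap.adjoint (relabel (Function.Embedding.sectL S b)))

/-- A state of the modes: a positive operator of trace one. -/
def IsDensityOperator {S : Type} (ρ : L2 S →L[ℂ] L2 S) : Prop := ρ.IsPositive ∧ HasTrace ρ 1

/-- A state of the qubits: a positive semidefinite matrix of trace one. -/
def IsDensityMatrix {T : Type} [Fintype T] (M : Matrix T T ℂ) : Prop :=
  M.PosSemidef ∧ M.trace = 1

/-- The moment `tr(ρ A)` of an unbounded operator `A`, computed in the Fock basis, converges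
to `c`. -/
def HasMoment {S : Type} (ρ : L2 S →L[ℂ] L2 S) (A : Module.End ℂ (Core S)) (c : ℂ) : Prop :=
  HasSum (fun x => ⟪ket x, ρ (toL2 (A (Finsupp.single x 1)))⟫_ℂ) c

/-- `ρ` is a Gaussian state with mean vector `μ_k = tr(ρ R_k)` and covariance matrix
`Γ_kl = tr(ρ {R_k - μ_k, R_l - μ_l}) / 2`: its characteristic function `ξ ↦ tr(ρ e^{i ξ·R})` is the
Gaussian function `exp(i ξ·μ - ξ·Γξ / 2)`. -/
structure IsGaussianState {ι : Type} [Fintype ι] [DecidableEq ι]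
    (ρ : L2 (ι → ℕ) →L[ℂ] L2 (ι → ℕ)) (μ : ι × Fin 2 → ℝ)
    (Γ : Matrix (ι × Fin 2) (ι × Fin 2) ℝ) : Prop where
  state : IsDensityOperator ρ
  mean : ∀ k, HasMoment ρ (quadrature k) (μ k)
  covariance : ∀ k l, HasMoment ρ
    ((1 / 2 : ℂ) •
      ((quadrature k - (μ k : ℂ) • 1) * (quadrature l - (μ l : ℂ) • 1) +
        (quadrature l - (μ l : ℂ) • 1) * (quadrature k - (μ k : ℂ) • 1))) (Γ k l)
  charFun : ∀ ξ : ι × Fin 2 → ℝ, HasTrace (ρ ∘L weyl ξ)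
    (Complex.exp (Complex.I * ((ξ ⬝ᵥ μ : ℝ) : ℂ) - ((ξ ⬝ᵥ (Γ *ᵥ ξ) : ℝ) : ℂ) / 2))

/-- The single-qubit Pauli operators. -/
inductive Pauli
  | I | X | Y | Z

/-- The Pauli matrices. -/
def Pauli.matrix : Pauli → Matrix (Fin 2) (Fin 2) ℂ
  | .I => 1
  | .X => !![0, 1; 1, 0]
  | .Y => !![0, -Complex.I; Complex.I, 0]
  | .Z => !![1, 0; 0, -1]

/-- The Pauli observable `⊗ᵢ Pᵢ`. -/
def pauliString {ι : Type} [Fintype ι] (P : ι → Pauli) : Matrix (ι → Fin 2) (ι → Fin 2) ℂ :=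
  Matrix.of fun x y => ∏ i, (P i).matrix (x i) (y i)

/-- `ρ(t) = U_JC(t) (ρ_f ⊗ ρ_q) U_JC(t)†`. -/
def evolvedState {ι : Type} [Fintype ι] [DecidableEq ι] (g : ι → ℝ) (t : ℝ)
    (ρf : L2 (ι → ℕ) →L[ℂ] L2 (ι → ℕ)) (ρq : Matrix (ι → Fin 2) (ι → Fin 2) ℂ) :
    L2 ((ι → ℕ) × (ι → Fin 2)) →L[ℂ] L2 ((ι → ℕ) × (ι → Fin 2)) :=
  jcUnitary g t ∘L tensorOp ρf ρq ∘L ContinuousLinearMap.adjoint (jcUnitary g t)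

/-- The expectation value `tr((1 ⊗ O) ρ(t))` of the Pauli observable `O = ⊗ᵢ Pᵢ` is `c`. -/
def HasPauliExpectation {ι : Type} [Fintype ι] [DecidableEq ι] (g : ι → ℝ) (t : ℝ)
    (ρf : L2 (ι → ℕ) →L[ℂ] L2 (ι → ℕ)) (ρq : Matrix (ι → Fin 2) (ι → Fin 2) ℂ)
    (P : ι → Pauli) (c : ℂ) : Prop :=
  HasTrace (tensorOp 1 (pauliString P) ∘L evolvedState g t ρf ρq) c

/-! ### Reduction to a pair of modes and qubits -/

/-- The configuration with entries `x 0` at `j`, `x 1` at `k` and `z` elsewhere. -/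
def merge {n : ℕ} {β : Type} (j k : Fin n) (x : Fin 2 → β) (z : {i : Fin n // i ≠ j ∧ i ≠ k} → β) :
    Fin n → β :=
  fun i => if hj : i = j then x 0 else if hk : i = k then x 1 else z ⟨i, hj, hk⟩

lemma merge_injective {n : ℕ} {β : Type} {j k : Fin n} (hjk : j ≠ k)
    (z : {i : Fin n // i ≠ j ∧ i ≠ k} → β) : Function.Injective fun x => merge j k x z := by
  intro x y h
  have h0 := congrFun h j
  have h1 := congrFun h k
  simp only [merge, dif_pos, hjk.symm, dif_neg, not_false_eq_true] at h0 h1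
  ext i
  fin_cases i
  · exact h0
  · exact h1

/-- The partial trace `∑_z (1 ⊗ ⟨z|) ρ (1 ⊗ |z⟩)` of a state of `n` modes over all modes other than
`j` and `k`; mode `0` of the result is mode `j`, mode `1` is mode `k`. -/
def reducedModes {n : ℕ} {j k : Fin n} (hjk : j ≠ k)
    (ρ : L2 (Fin n → ℕ) →L[ℂ] L2 (Fin n → ℕ)) : L2 (Fin 2 → ℕ) →L[ℂ] L2 (Fin 2 → ℕ) :=
  ∑' z : {i : Fin n // i ≠ j ∧ i ≠ k} → ℕ,
    ContinuousLinearMap.adjoint (relabel ⟨_, merge_injective hjk z⟩) ∘L ρ ∘L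
      relabel ⟨_, merge_injective hjk z⟩

/-- The partial trace of a state of `n` qubits over all qubits other than `j` and `k`. -/
def reducedQubits {n : ℕ} (j k : Fin n) (M : Matrix (Fin n → Fin 2) (Fin n → Fin 2) ℂ) :
    Matrix (Fin 2 → Fin 2) (Fin 2 → Fin 2) ℂ :=
  Matrix.of fun x y => ∑ z, M (merge j k x z) (merge j k y z)

/-- The entries of a mean vector that belong to the modes `j` and `k`. -/
def pairMean {n : ℕ} (j k : Fin n) (μ : Fin n × Fin 2 → ℝ) : Fin 2 × Fin 2 → ℝ :=
  fun a => μ (![j, k] a.1, a.2)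

/-- The entries of a covariance matrix that belong to the modes `j` and `k`. -/
def pairCovariance {n : ℕ} (j k : Fin n) (Γ : Matrix (Fin n × Fin 2) (Fin n × Fin 2) ℝ) :
    Matrix (Fin 2 × Fin 2) (Fin 2 × Fin 2) ℝ :=
  Matrix.of fun a b => Γ (![j, k] a.1, a.2) (![j, k] b.1, b.2)

end JCGauss

end

open JCGauss

noncomputable section

namespace JCGauss

open Matrix

/-! ### Exponentials of operators on the dense domain -/

/-! The proof has three ingredients: locality of the Heisenberg evolution, compatibility of local
operators with partial traces, and the fact that a state is determined by its characteristic
function.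

Locality. Let h be g cut off to zero outside {j, k}. The Hamiltonians with couplings g - h and h
commute, so the evolution factors as U_g = U_{g-h} U_h. The factor U_{g-h} involves only sites where
the Pauli string is the identity, hence commutes with it, and U_g† O U_g = U_h† O U_h
(`heisenberg_pauliString`).

Partial traces. Fixing the configuration z of the traced-out modes and qubits embeds the two-site
space isometrically as a slice. If B acts on every slice as the same B', then tr(ρ B) = tr(ρ' B')
for the partial trace ρ' (`IsPartialTrace.hasTrace_comp`). The operator U_h† O U_h has this
property, which gives the expectation value in the reduced state
(`exists_hasPauliExpectation_reduced`). Quadratures and Weyl operators of the modes j, k have it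
too, so every clause of Gaussianity passes to the reduced state (`IsGaussianState.reducedModes`).

Uniqueness. The statement concerns every Gaussian σ with the right moments, so σ must be shown equal
to the reduced state (`IsGaussianState.ext`). The characteristic function fixes expectations on the
algebra spanned by Weyl operators. Powers of averages of small displacements converge strongly to
exp(-τ ∑ R²), and as τ → ∞ these, renormalized, converge to the vacuum projection. Hence the matrix
elements of the state between coherent vectors W|0⟩ are determined, and these vectors are total
because the vacuum is cyclic (`IsEnsemble.ext_weyl`).

Unbounded operators enter only through exponential series on finite combinations of basis vectors:
intertwining, adjoints and the Baker–Campbell–Hausdorff formula are checked on generators there and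
extended by density. A positive operator with a trace is handled as an ensemble ∑ |vₖ⟩⟨vₖ|, which
makes traces of products absolutely convergent and cyclic. -/

lemma toL2_single {S : Type} (x : S) (c : ℂ) : toL2 (Finsupp.single x c) = c • ket x := by
  simp [toL2]

lemma toL2_single_one {S : Type} (x : S) : toL2 (Finsupp.single x 1) = ket x := by
  simp [toL2_single]

lemma clm_ext_ket {S : Type} {E : Type*} [NormedAddCommGroup E] [NormedSpace ℂ E]
    {A B : L2 S →L[ℂ] E} (h : ∀ x, A (ket x) = B (ket x)) : A = B := by
  refine ContinuousLinearMap.coeFn_injective (denseRange_toL2.equalizer A.continuous B.continuous ?_)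
  funext φ
  simp only [Function.comp_apply, toL2, Finsupp.linearCombination_apply, Finsupp.sum, map_sum,
    map_smul, h]

lemma clm_ext_toL2 {S : Type} {E : Type*} [NormedAddCommGroup E] [NormedSpace ℂ E]
    {A B : L2 S →L[ℂ] E} (h : ∀ φ, A (toL2 φ) = B (toL2 φ)) : A = B :=
  clm_ext_ket fun x => by rw [← toL2_single_one]; exact h _

/-- The relation passes to all powers of the generators and then termwise through the two series.
Every later commutation of an evolution or Weyl operator with a slice or an observable reduces to
its generator this way. -/
lemma IsExpOf.comp_eq {S S' : Type} {A : Module.End ℂ (Core S)} {A' : Module.End ℂ (Core S')}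
    {U : L2 S →L[ℂ] L2 S} {U' : L2 S' →L[ℂ] L2 S'} (hU : IsExpOf A U) (hU' : IsExpOf A' U')
    {L : Core S →ₗ[ℂ] Core S'} {T : L2 S →L[ℂ] L2 S'} (hT : ∀ φ, T (toL2 φ) = toL2 (L φ))
    (h : L ∘ₗ A = A' ∘ₗ L) : T ∘L U = U' ∘L T := by
  have hpow : ∀ (k : ℕ) φ, L ((A ^ k) φ) = (A' ^ k) (L φ) := by
    intro k
    induction k with
    | zero => simp
    | succ k ih =>
      intro φ
      rw [pow_succ', pow_succ', Module.End.mul_apply, Module.End.mul_apply, ← ih]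
      exact LinearMap.congr_fun h _
  refine clm_ext_toL2 fun φ => ?_
  have h1 := (hU φ).mapL T
  have h2 := hU' (L φ)
  rw [ContinuousLinearMap.comp_apply, ContinuousLinearMap.comp_apply, hT]
  refine h1.unique ?_
  simpa only [map_smul, hT, hpow] using h2

lemma neg_pow_apply {S : Type} (A : Module.End ℂ (Core S)) (k : ℕ) (φ : Core S) :
    ((-A) ^ k) φ = (-1 : ℂ) ^ k • (A ^ k) φ := by
  rw [← neg_one_smul ℂ A, smul_pow, LinearMap.smul_apply]

lemma Entire.neg {S : Type} {A : Module.End ℂ (Core S)} (hA : Entire A) : Entire (-A) := by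
  intro ψ
  refine (hA ψ).congr fun k => ?_
  rw [neg_pow_apply, map_smul, smul_comm, norm_smul ((-1 : ℂ) ^ k)]
  simp

lemma Skew.neg {S : Type} {A : Module.End ℂ (Core S)} (hA : Skew A) : Skew (-A) := by
  intro φ ψ
  simp [hA φ ψ]

lemma Skew.inner_neg_pow {S : Type} {A : Module.End ℂ (Core S)} (hA : Skew A) (k : ℕ)
    (φ ψ : Core S) : ⟪toL2 (((-A) ^ k) φ), toL2 ψ⟫_ℂ = ⟪toL2 φ, toL2 ((A ^ k) ψ)⟫_ℂ := by
  rw [neg_pow_apply, map_smul, inner_smul_left, hA.pow, ← mul_assoc, map_pow, map_neg, map_one,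
    ← mul_pow]
  simp

/-- Matrix elements on the dense domain are compared term by term: skewness moves `A ^ k` across the
inner product as `(-A) ^ k`. -/
lemma IsExpOf.adjoint_eq {S : Type} {A : Module.End ℂ (Core S)} {U U' : L2 S →L[ℂ] L2 S}
    (hA : Skew A) (hU : IsExpOf A U) (hU' : IsExpOf (-A) U') :
    ContinuousLinearMap.adjoint U = U' := by
  refine clm_ext_toL2 fun φ => ?_
  have : innerSL ℂ (ContinuousLinearMap.adjoint U (toL2 φ)) = innerSL ℂ (U' (toL2 φ)) := by
    refine clm_ext_toL2 fun ψ => ?_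
    rw [innerSL_apply_apply, innerSL_apply_apply, ContinuousLinearMap.adjoint_inner_left]
    have h1 := (hU ψ).mapL (innerSL ℂ (toL2 φ))
    have h2 := (((hU' φ).mapL (innerSL ℂ (toL2 ψ))).map (starRingEnd ℂ) Complex.continuous_conj)
    rw [innerSL_apply_apply] at h1 h2
    rw [inner_conj_symm] at h2
    refine h1.unique (h2.congr_fun fun k => ?_)
    rw [Function.comp_apply, innerSL_apply_apply, innerSL_apply_apply, inner_conj_symm,
      inner_smul_left, inner_smul_right, hA.inner_neg_pow, map_inv₀, map_natCast]
  exact innerSL_inj.mp this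

/-! ### Baker–Campbell–Hausdorff through formal power series. -/

section BakerCampbellHausdorff

open PowerSeries

/-- The Euler operator `s d/ds`. -/
def euler {R : Type*} [Ring R] (f : PowerSeries R) : PowerSeries R :=
  PowerSeries.mk fun k => (k : R) * coeff k f

lemma euler_mul {R : Type*} [Ring R] (f g : PowerSeries R) :
    euler (f * g) = euler f * g + f * euler g := by
  ext n
  simp only [euler, coeff_mk, coeff_mul, map_add, Finset.mul_sum, ← Finset.sum_add_distrib]
  refine Finset.sum_congr rfl fun p hp => ?_
  rw [← Finset.HasAntidiagonal.mem_antidiagonal.mp hp, Nat.cast_add, add_mul, mul_assoc, ← mul_assoc _ (p.2 : R),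
    ← (Nat.cast_commute p.2 _).eq]
  simp only [mul_assoc]

variable {R : Type*} [Ring R] [Algebra ℂ R]

/-- The formal power series `e^{sa}`. -/
def formalExp (a : R) : PowerSeries R := PowerSeries.mk fun k => (k.factorial : ℂ)⁻¹ • a ^ k

/-- The Taylor coefficients of `e^{d s²}`. -/
def gaussCoeff (d : ℂ) (k : ℕ) : ℂ :=
  if Even k then d ^ (k / 2) * ((k / 2).factorial : ℂ)⁻¹ else 0

/-- The formal power series `e^{d s²}`. -/
def formalGauss (R : Type*) [Ring R] [Algebra ℂ R] (d : ℂ) : PowerSeries R :=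
  PowerSeries.mk fun k => gaussCoeff d k • (1 : R)

lemma factorial_succ_smul (k : ℕ) (x : R) :
    ((k + 1 : ℕ) : R) * (((k + 1).factorial : ℂ)⁻¹ • x) = (k.factorial : ℂ)⁻¹ • x := by
  rw [← nsmul_eq_mul, ← Nat.cast_smul_eq_nsmul ℂ, smul_smul, Nat.factorial_succ]
  congr 1
  have : (k.factorial : ℂ) ≠ 0 := by exact_mod_cast k.factorial_ne_zero
  have : ((k + 1 : ℕ) : ℂ) ≠ 0 := by exact_mod_cast k.succ_ne_zero
  push_cast at *
  field_simp

lemma euler_formalExp (a : R) : euler (formalExp a) = X * (C a * formalExp a) := by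
  ext n
  cases n with
  | zero => simp [euler]
  | succ k =>
    rw [coeff_succ_X_mul, coeff_C_mul, euler, formalExp, coeff_mk, coeff_mk, coeff_mk,
      factorial_succ_smul, pow_succ', mul_smul_comm]

lemma gaussCoeff_add_two (d : ℂ) (k : ℕ) :
    ((k + 2 : ℕ) : ℂ) * gaussCoeff d (k + 2) = 2 * d * gaussCoeff d k := by
  unfold gaussCoeff
  by_cases h : Even k
  · obtain ⟨m, rfl⟩ := h
    have e1 : (m + m + 2) / 2 = m + 1 := by omega
    have e2 : (m + m) / 2 = m := by omega
    rw [if_pos (show Even (m + m) from ⟨m, rfl⟩), if_pos ⟨m + 1, by ring⟩, e1, e2, Nat.factorial_succ]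
    have : (m.factorial : ℂ) ≠ 0 := by exact_mod_cast m.factorial_ne_zero
    have : (m : ℂ) + 1 ≠ 0 := by exact_mod_cast m.succ_ne_zero
    push_cast
    field_simp
    ring
  · rw [if_neg h, if_neg (by rwa [Nat.even_add, iff_true_right even_two])]
    simp

lemma euler_formalGauss (d : ℂ) :
    euler (formalGauss R d) = X * (X * (C ((2 * d) • (1 : R)) * formalGauss R d)) := by
  ext n
  match n with
  | 0 => simp [euler]
  | 1 => simp [euler, formalGauss, gaussCoeff]
  | k + 2 =>
    rw [coeff_succ_X_mul, coeff_succ_X_mul, coeff_C_mul, euler, formalGauss, coeff_mk, coeff_mk,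
      coeff_mk, smul_one_mul, smul_smul, ← gaussCoeff_add_two, mul_smul, Nat.cast_smul_eq_nsmul,
      nsmul_eq_mul]

/-- The commutator with `b` is a derivation sending `a` to a scalar. The exponent `k + 1` avoids a
truncated `k - 1`. -/
lemma pow_mul_eq_of_commutator {a b : R} {c : ℂ} (h : a * b - b * a = c • 1) (k : ℕ) :
    a ^ (k + 1) * b = b * a ^ (k + 1) + ((k + 1 : ℕ) : R) * (c • a ^ k) := by
  have h' : a * b = b * a + c • 1 := by rw [← h]; abel
  induction k with
  | zero => simp [h']
  | succ k ih =>
    rw [pow_succ', mul_assoc, ih, mul_add, ← mul_assoc a b, h', ← mul_assoc a (Nat.cast _),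
      (Nat.cast_commute (k + 1) a).symm.eq, mul_assoc, mul_smul_comm, ← pow_succ', add_mul,
      smul_one_mul, mul_assoc, ← pow_succ' a (k + 1), add_assoc]
    congr 1
    rw [Nat.cast_succ (k + 1), add_mul, one_mul, add_comm]

lemma formalExp_mul_C {a b : R} {c : ℂ} (h : a * b - b * a = c • 1) :
    formalExp a * C b = C b * formalExp a + X * (C (c • (1 : R)) * formalExp a) := by
  ext n
  rw [map_add, coeff_mul_C, coeff_C_mul]
  cases n with
  | zero => simp [formalExp]
  | succ k =>
    rw [coeff_succ_X_mul, coeff_C_mul, formalExp, coeff_mk, coeff_mk, smul_mul_assoc,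
      pow_mul_eq_of_commutator h, smul_add, ← mul_smul_comm _ b,
      ← mul_smul_comm _ ((k + 1 : ℕ) : R), factorial_succ_smul, smul_one_mul, smul_comm]

/-- Both sides have constant term 1 and solve s F' = s (a + b) F, which determines the coefficients
recursively through (k + 1) F_{k+1} = (a + b) F_k. Moving `b` to the left of e^{sa} costs an extra s
c e^{sa}; the resulting term c s² G is cancelled by the Euler derivative -c s² of the exponent of
the Gaussian factor. -/
theorem formalExp_mul_formalExp {a b : R} {c : ℂ} (h : a * b - b * a = c • 1) :
    formalExp a * formalExp b * formalGauss R (-c / 2) = formalExp (a + b) := by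
  set G := formalExp a * formalExp b * formalGauss R (-c / 2) with hG
  have hcomm : ∀ (z : ℂ) (f : PowerSeries R), C (z • (1 : R)) * f = f * C (z • (1 : R)) := by
    intro z f
    ext n
    rw [coeff_mul_C, coeff_C_mul, smul_one_mul, mul_smul_one]
  have hE : euler G = X * (C (a + b) * G) := by
    have h2 : (2 * (-c / 2)) = -c := by ring
    rw [hG, euler_mul, euler_mul, euler_formalExp, euler_formalExp, euler_formalGauss, h2,
      map_add]
    have hX : ∀ f g : PowerSeries R, f * (X * g) = X * (f * g) := fun f g => by
      rw [← mul_assoc, ← X_mul, mul_assoc]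
    have e1 : formalExp a * (X * (C b * formalExp b)) =
        X * (C b * (formalExp a * formalExp b) +
          X * (C (c • (1 : R)) * (formalExp a * formalExp b))) := by
      rw [hX, ← mul_assoc (formalExp a), formalExp_mul_C h]
      simp only [add_mul, mul_assoc]
    rw [e1, hX, hX, neg_smul, map_neg, neg_mul, mul_neg, mul_neg, mul_neg,
      ← mul_assoc (formalExp a * formalExp b), ← hcomm]
    simp only [mul_add, add_mul, mul_assoc]
    abel
  ext n
  induction n with
  | zero => simp [hG, formalExp, formalGauss, gaussCoeff]
  | succ k ih =>
    have := congrArg (coeff (k + 1)) hE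
    rw [coeff_succ_X_mul, coeff_C_mul, ih, euler, coeff_mk, formalExp, coeff_mk, mul_smul_comm,
      ← pow_succ', ← factorial_succ_smul, ← nsmul_eq_mul, ← nsmul_eq_mul,
      ← Nat.cast_smul_eq_nsmul ℂ, ← Nat.cast_smul_eq_nsmul ℂ] at this
    rw [formalExp, coeff_mk]
    exact smul_right_injective R (by exact_mod_cast k.succ_ne_zero : ((k + 1 : ℕ) : ℂ) ≠ 0) this

lemma hasSum_gaussCoeff (d : ℂ) : HasSum (gaussCoeff d) (Complex.exp d) := by
  have h := NormedSpace.expSeries_div_hasSum_exp (𝔸 := ℂ) d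
  rw [← Complex.exp_eq_exp_ℂ] at h
  have hi : Function.Injective fun m : ℕ => 2 * m := fun m n h => by simpa using h
  rw [← hi.hasSum_iff]
  · refine h.congr_fun fun m => ?_
    simp [gaussCoeff, div_eq_mul_inv]
  · intro k hk
    rw [gaussCoeff, if_neg]
    rintro ⟨m, rfl⟩
    exact hk ⟨m, by simp [two_mul]⟩

end BakerCampbellHausdorff

/-- The Cauchy product for a sesquilinear pairing. Absolute convergence is recorded because the
outcome is itself multiplied by the Gaussian series. -/
lemma hasSum_inner_antidiagonal {E : Type*} [NormedAddCommGroup E] [InnerProductSpace ℂ E]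
    [CompleteSpace E] {u v : ℕ → E} {x y : E} (hu : Summable fun k => ‖u k‖)
    (hv : Summable fun k => ‖v k‖) (hx : HasSum u x) (hy : HasSum v y) :
    (Summable fun N => ‖∑ p ∈ Finset.HasAntidiagonal.antidiagonal N, ⟪u p.1, v p.2⟫_ℂ‖) ∧
    HasSum (fun N => ∑ p ∈ Finset.HasAntidiagonal.antidiagonal N, ⟪u p.1, v p.2⟫_ℂ) ⟪x, y⟫_ℂ := by
  have hs' : Summable fun p : ℕ × ℕ => ‖⟪u p.1, v p.2⟫_ℂ‖ :=
    (hu.mul_of_nonneg hv (fun _ => norm_nonneg _) (fun _ => norm_nonneg _)).of_nonneg_of_le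
      (fun _ => norm_nonneg _) fun p => norm_inner_le_norm _ _
  have hs : Summable fun p : ℕ × ℕ => ⟪u p.1, v p.2⟫_ℂ := hs'.of_norm
  have h1 : ∑' p : ℕ × ℕ, ⟪u p.1, v p.2⟫_ℂ = ⟪x, y⟫_ℂ := by
    rw [hs.tsum_prod]
    have e1 : ∀ j, ∑' k, ⟪u j, v k⟫_ℂ = ⟪u j, y⟫_ℂ := fun j =>
      (hy.mapL (innerSL ℂ (u j))).tsum_eq
    simp_rw [e1]
    have e2 := (hx.mapL (innerSL ℂ y)).map (starRingEnd ℂ) Complex.continuous_conj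
    rw [innerSL_apply_apply, inner_conj_symm] at e2
    rw [← e2.tsum_eq]
    exact tsum_congr fun j => (inner_conj_symm _ _).symm
  have h2 : HasSum (fun p : ℕ × ℕ => ⟪u p.1, v p.2⟫_ℂ) ⟪x, y⟫_ℂ := h1 ▸ hs.hasSum
  rw [← Finset.HasAntidiagonal.sigmaAntidiagonalEquivProd.hasSum_iff] at h2
  rw [← Finset.HasAntidiagonal.sigmaAntidiagonalEquivProd.summable_iff] at hs'
  have e : ∀ N, ∑ p ∈ Finset.HasAntidiagonal.antidiagonal N, ⟪u p.1, v p.2⟫_ℂ =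
      ∑ p : Finset.HasAntidiagonal.antidiagonal N, ⟪u p.1.1, v p.1.2⟫_ℂ := fun N => by
    rw [← Finset.sum_coe_sort]
  constructor
  · refine hs'.sigma.of_nonneg_of_le (fun _ => norm_nonneg _) fun N => ?_
    rw [e, tsum_fintype]
    exact norm_sum_le _ _
  · simp_rw [e]
    exact h2.sigma fun N => hasSum_fintype _

/-- The Baker-Campbell-Hausdorff formula `e^A e^B = e^{c/2} e^{A+B}` for `[A, B] = c`. -/
theorem IsExpOf.comp_eq_smul {S : Type} {A B : Module.End ℂ (Core S)} {U V W : L2 S →L[ℂ] L2 S}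
    {c : ℂ} (hA : Skew A) (hEA : Entire A) (hEB : Entire B) (hU : IsExpOf A U) (hV : IsExpOf B V)
    (hW : IsExpOf (A + B) W) (h : A * B - B * A = c • 1) : U ∘L V = Complex.exp (c / 2) • W := by
  -- The vector V ψ need not be a finite combination of basis vectors, so the series of U is not
  -- available on it. In ⟨φ, U V ψ⟩ the factor U is therefore moved to the left as e^{-A}, where its
  -- series applies to φ.
  obtain ⟨U', hU'⟩ := exists_isExpOf hA.neg hEA.neg
  have hadj := hU.adjoint_eq hA hU'
  have key : Complex.exp (-c / 2) • (U ∘L V) = W := by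
    refine clm_ext_toL2 fun ψ => ?_
    rw [← innerSL_inj (𝕜 := ℂ)]
    refine clm_ext_toL2 fun φ => ?_
    rw [innerSL_apply_apply, innerSL_apply_apply, ← inner_conj_symm,
      ← inner_conj_symm (W (toL2 ψ))]
    congr 1
    have h1 := hasSum_inner_antidiagonal (hEA.neg φ) (hEB ψ) (hU' φ) (hV ψ)
    have h2 := hasSum_gaussCoeff (-c / 2)
    have h3 := tsum_mul_tsum_eq_tsum_sum_antidiagonal_of_summable_norm h1.1 h2.summable.norm
    have h4 := summable_norm_sum_mul_antidiagonal_of_summable_norm h1.1 h2.summable.norm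
    rw [h1.2.tsum_eq, h2.tsum_eq] at h3
    have h5 := h4.of_norm.hasSum
    rw [← h3] at h5
    rw [_root_.smul_apply, inner_smul_right, ContinuousLinearMap.comp_apply,
      ← ContinuousLinearMap.adjoint_inner_left, hadj, mul_comm]
    have h6 := (hW ψ).mapL (innerSL ℂ (toL2 φ))
    rw [innerSL_apply_apply] at h6
    refine h5.unique (h6.congr_fun fun N => ?_)
    -- The N-th term of the double Cauchy product is the coefficient of s^N in the formal identity,
    -- paired with φ and ψ.
    have h7 := congrArg (PowerSeries.coeff N) (formalExp_mul_formalExp (R := Module.End ℂ (Core S)) h)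
    simp only [PowerSeries.coeff_mul, formalExp, formalGauss, PowerSeries.coeff_mk] at h7
    rw [innerSL_apply_apply, ← map_smul, ← LinearMap.smul_apply, ← h7, LinearMap.sum_apply, map_sum,
      inner_sum]
    refine Finset.sum_congr rfl fun p hp => ?_
    rw [mul_smul_one, LinearMap.smul_apply, LinearMap.sum_apply, map_smul, map_sum,
      inner_smul_right, inner_sum, mul_comm]
    congr 1
    refine Finset.sum_congr rfl fun q hq => ?_
    rw [inner_smul_left, inner_smul_right, hA.inner_neg_pow, smul_mul_smul_comm, LinearMap.smul_apply,
      map_smul, inner_smul_right, Module.End.mul_apply, map_inv₀, map_natCast, mul_assoc]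
  rw [← key, smul_smul, ← Complex.exp_add]
  simp [neg_div]

lemma isExpOf_zero {S : Type} : IsExpOf (0 : Module.End ℂ (Core S)) 1 := by
  intro ψ
  convert hasSum_single (f := fun k : ℕ => ((k.factorial : ℂ)⁻¹) •
    toL2 (((0 : Module.End ℂ (Core S)) ^ k) ψ)) 0 fun k hk => ?_ using 1
  · simp
  · simp [zero_pow hk]

lemma IsExpOf.comp_neg {S : Type} {A : Module.End ℂ (Core S)} {U V : L2 S →L[ℂ] L2 S}
    (hA : Skew A) (hEA : Entire A) (hU : IsExpOf A U) (hV : IsExpOf (-A) V) : U ∘L V = 1 := by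
  have h0 : A + -A = 0 := add_neg_cancel A
  have h1 : A * -A - -A * A = (0 : ℂ) • 1 := by
    refine LinearMap.ext fun φ => ?_
    simp [Module.End.mul_apply]
  have := hU.comp_eq_smul (c := 0) hA hEA hEA.neg hV (W := 1) (h0 ▸ isExpOf_zero) h1
  simpa using this

lemma IsExpOf.adjoint_comp_self {S : Type} {A : Module.End ℂ (Core S)} {U : L2 S →L[ℂ] L2 S}
    (hA : Skew A) (hEA : Entire A) (hU : IsExpOf A U) :
    ContinuousLinearMap.adjoint U ∘L U = 1 := by
  obtain ⟨V, hV⟩ := exists_isExpOf hA.neg hEA.neg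
  rw [hU.adjoint_eq hA hV]
  exact hV.comp_neg hA.neg hEA.neg ((neg_neg A).symm ▸ hU)

lemma IsExpOf.norm_apply {S : Type} {A : Module.End ℂ (Core S)} {U : L2 S →L[ℂ] L2 S}
    (hA : Skew A) (hEA : Entire A) (hU : IsExpOf A U) (f : L2 S) : ‖U f‖ = ‖f‖ := by
  have h : ⟪U f, U f⟫_ℂ = ⟪f, f⟫_ℂ := by
    rw [← ContinuousLinearMap.adjoint_inner_left, ← ContinuousLinearMap.comp_apply,
      hU.adjoint_comp_self hA hEA, one_apply_eq_self]
  rw [inner_self_eq_norm_sq_to_K, inner_self_eq_norm_sq_to_K] at h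
  have h1 : ‖U f‖ ^ 2 = ‖f‖ ^ 2 := by exact_mod_cast h
  exact (pow_left_inj₀ (norm_nonneg _) (norm_nonneg _) two_ne_zero).mp h1

/-! ### Positive operators with a trace as ensembles of vectors -/

lemma norm_ket {S : Type} (x : S) : ‖(ket x : L2 S)‖ = 1 := orthonormal_ket.1 x

lemma inner_ket_left {S : Type} (x : S) (f : L2 S) : ⟪ket x, f⟫_ℂ = f x := by
  classical
  rw [ket, lp.inner_single_left]
  simp

lemma hasSum_inner_ket {S : Type} (f g : L2 S) :
    HasSum (fun x => ⟪f, ket x⟫_ℂ * ⟪ket x, g⟫_ℂ) ⟪f, g⟫_ℂ := by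
  refine (lp.hasSum_inner f g).congr_fun fun x => ?_
  rw [← inner_conj_symm, inner_ket_left, inner_ket_left, RCLike.inner_apply, mul_comm]

lemma hasSum_norm_inner_ket_sq {S : Type} (f : L2 S) :
    HasSum (fun x => ‖⟪ket x, f⟫_ℂ‖ ^ 2) (‖f‖ ^ 2) := by
  have h := hasSum_inner_ket f f
  rw [inner_self_eq_norm_sq_to_K] at h
  have h' := h.mapL Complex.reCLM
  have e : Complex.reCLM (((‖f‖ : ℝ) : ℂ) ^ 2) = ‖f‖ ^ 2 := by
    rw [← Complex.ofReal_pow]; rfl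
  refine (e ▸ h').congr_fun fun x => ?_
  rw [← inner_conj_symm f, mul_comm, Complex.mul_conj, Complex.normSq_eq_norm_sq]
  rfl

/-- `ρ = ∑ₖ |vₖ⟩⟨vₖ|`, with `∑ₖ ‖vₖ‖² < ∞`. -/
structure IsEnsemble {S κ : Type} (v : κ → L2 S) (ρ : L2 S →L[ℂ] L2 S) : Prop where
  summable : Summable fun k => ‖v k‖ ^ 2
  hasSum : ∀ φ ψ, HasSum (fun k => ⟪φ, v k⟫_ℂ * ⟪v k, ψ⟫_ℂ) ⟪φ, ρ ψ⟫_ℂ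

/-- The expectation value `∑ₖ ⟨vₖ|B|vₖ⟩`. -/
def ensembleMean {S κ : Type} (v : κ → L2 S) (B : L2 S →L[ℂ] L2 S) : ℂ := ∑' k, ⟪v k, B (v k)⟫_ℂ

lemma norm_inner_clm_le {S : Type} (B : L2 S →L[ℂ] L2 S) (f : L2 S) :
    ‖⟪f, B f⟫_ℂ‖ ≤ ‖B‖ * ‖f‖ ^ 2 := by
  refine (norm_inner_le_norm _ _).trans ?_
  calc ‖f‖ * ‖B f‖ ≤ ‖f‖ * (‖B‖ * ‖f‖) := by gcongr; exact B.le_opNorm f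
    _ = _ := by ring

lemma IsEnsemble.summable_inner {S κ : Type} {v : κ → L2 S} {ρ : L2 S →L[ℂ] L2 S}
    (h : IsEnsemble v ρ) (B : L2 S →L[ℂ] L2 S) : Summable fun k => ⟪v k, B (v k)⟫_ℂ :=
  Summable.of_norm_bounded (h.summable.mul_left ‖B‖) fun _ => norm_inner_clm_le _ _

/-- The double family over k and x is absolutely summable by 2|ab| ≤ |a|² + |b|² and Parseval.
Summing over x first gives ⟨vₖ, C B vₖ⟩, summing over k first gives the diagonal entries of B ρ C;
equating the two is cyclicity of the trace. -/
theorem IsEnsemble.hasTrace {S κ : Type} {v : κ → L2 S} {ρ : L2 S →L[ℂ] L2 S}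
    (h : IsEnsemble v ρ) (B C : L2 S →L[ℂ] L2 S) :
    HasTrace (B ∘L ρ ∘L C) (ensembleMean v (C ∘L B)) := by
  let F : κ × S → ℂ := fun p => ⟪ContinuousLinearMap.adjoint C (v p.1), ket p.2⟫_ℂ *
    ⟪ket p.2, B (v p.1)⟫_ℂ
  have hF : ∀ k, HasSum (fun x => F (k, x)) ⟪v k, C (B (v k))⟫_ℂ := fun k => by
    have := hasSum_inner_ket (ContinuousLinearMap.adjoint C (v k)) (B (v k))
    rwa [ContinuousLinearMap.adjoint_inner_left] at this
  have hG : ∀ k, HasSum (fun x => (‖⟪ket x, ContinuousLinearMap.adjoint C (v k)⟫_ℂ‖ ^ 2 +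
      ‖⟪ket x, B (v k)⟫_ℂ‖ ^ 2) / 2)
      ((‖ContinuousLinearMap.adjoint C (v k)‖ ^ 2 + ‖B (v k)‖ ^ 2) / 2) := fun k =>
    ((hasSum_norm_inner_ket_sq _).add (hasSum_norm_inner_ket_sq _)).div_const 2
  have hle : ∀ k x, ‖F (k, x)‖ ≤ (‖⟪ket x, ContinuousLinearMap.adjoint C (v k)⟫_ℂ‖ ^ 2 +
      ‖⟪ket x, B (v k)⟫_ℂ‖ ^ 2) / 2 := fun k x => by
    simp only [F]
    rw [norm_mul, norm_inner_symm]
    nlinarith [sq_nonneg (‖⟪ket x, ContinuousLinearMap.adjoint C (v k)⟫_ℂ‖ -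
      ‖⟪ket x, B (v k)⟫_ℂ‖)]
  have hnorm : Summable fun p => ‖F p‖ := by
    rw [summable_prod_of_nonneg fun _ => norm_nonneg _]
    have h1 : ∀ k, Summable fun x => ‖F (k, x)‖ := fun k =>
      (hG k).summable.of_nonneg_of_le (fun _ => norm_nonneg _) (hle k)
    refine ⟨h1, ?_⟩
    refine (h.summable.mul_left ((‖ContinuousLinearMap.adjoint C‖ ^ 2 + ‖B‖ ^ 2) / 2)).of_nonneg_of_le
      (fun k => tsum_nonneg fun _ => norm_nonneg _) fun k => ?_
    refine ((h1 k).tsum_le_tsum (hle k) (hG k).summable).trans ?_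
    rw [(hG k).tsum_eq]
    have h2 : ‖ContinuousLinearMap.adjoint C (v k)‖ ^ 2 ≤
        (‖ContinuousLinearMap.adjoint C‖ * ‖v k‖) ^ 2 := by
      gcongr; exact ContinuousLinearMap.le_opNorm _ _
    have h3 : ‖B (v k)‖ ^ 2 ≤ (‖B‖ * ‖v k‖) ^ 2 := by
      gcongr; exact ContinuousLinearMap.le_opNorm _ _
    nlinarith
  have hsum := hnorm.of_norm.hasSum
  have h4 := hsum.prod_fiberwise hF
  rw [← h4.tsum_eq] at hsum
  have h5 := (Equiv.prodComm S κ).hasSum_iff.mpr hsum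
  refine h5.prod_fiberwise fun x => ?_
  have h6 := h.hasSum (ContinuousLinearMap.adjoint B (ket x)) (C (ket x))
  rw [ContinuousLinearMap.adjoint_inner_left] at h6
  refine h6.congr_fun fun k => ?_
  simp only [Function.comp_apply, F, Equiv.prodComm_apply, Prod.swap_prod_mk]
  rw [ContinuousLinearMap.adjoint_inner_left, ContinuousLinearMap.adjoint_inner_left, mul_comm]

lemma IsEnsemble.hasTrace_comp {S κ : Type} {v : κ → L2 S} {ρ : L2 S →L[ℂ] L2 S}
    (h : IsEnsemble v ρ) (B : L2 S →L[ℂ] L2 S) : HasTrace (ρ ∘L B) (ensembleMean v B) :=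
  h.hasTrace 1 B

lemma exists_sqrt {H : Type*} [NormedAddCommGroup H] [InnerProductSpace ℂ H] [CompleteSpace H]
    {ρ : H →L[ℂ] H} (hρ : ρ.IsPositive) :
    ∃ s : H →L[ℂ] H, s.IsPositive ∧ ∀ f, s (s f) = ρ f := by
  have h0 : 0 ≤ ρ := (ContinuousLinearMap.nonneg_iff_isPositive ρ).mpr hρ
  exact ⟨CFC.sqrt ρ, (ContinuousLinearMap.nonneg_iff_isPositive _).mp (CFC.sqrt_nonneg ρ),
    fun f => congrArg (fun T : H →L[ℂ] H => T f) (CFC.sqrt_mul_sqrt_self ρ h0)⟩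

/-- Take vₓ = √ρ |x⟩: the squared norms are the diagonal entries of ρ, and the resolution of ρ is
Parseval for √ρ φ and √ρ ψ. No eigenbasis of ρ is needed. -/
lemma exists_isEnsemble {S : Type} {ρ : L2 S →L[ℂ] L2 S} (hρ : ρ.IsPositive) {c : ℂ}
    (hc : HasTrace ρ c) : ∃ v : S → L2 S, IsEnsemble v ρ := by
  obtain ⟨s, hs, hss⟩ := exists_sqrt hρ
  have hsq : ∀ φ ψ, ⟪φ, ρ ψ⟫_ℂ = ⟪s φ, s ψ⟫_ℂ := fun φ ψ => by
    rw [hs.inner_left_eq_inner_right, hss]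
  refine ⟨fun x => s (ket x), ?_, fun φ ψ => ?_⟩
  · have := hc.summable.mapL Complex.reCLM
    refine this.congr fun x => ?_
    rw [hsq, inner_self_eq_norm_sq_to_K]
    norm_cast
  · rw [hsq]
    refine (hasSum_inner_ket _ _).congr_fun fun x => ?_
    rw [hs.inner_left_eq_inner_right φ, hs.inner_left_eq_inner_right (ket x)]

/-- Cauchy–Schwarz on each |vₖ⟩⟨vₖ| bounds ⟨φ, ρ ψ⟩ by ∑ ‖vₖ‖², the trace, for unit vectors φ and ψ.
This makes the series of the partial trace converge in operator norm. -/
lemma norm_le_of_hasTrace {S : Type} {ρ : L2 S →L[ℂ] L2 S} (hρ : ρ.IsPositive) {c : ℂ}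
    (hc : HasTrace ρ c) : ‖ρ‖ ≤ c.re := by
  obtain ⟨v, hv⟩ := exists_isEnsemble hρ hc
  have h1 : HasTrace ρ (ensembleMean v 1) := hv.hasTrace_comp 1
  have h2 : c.re = ∑' k, ‖v k‖ ^ 2 := by
    rw [HasSum.unique hc h1, ensembleMean, Complex.re_tsum (hv.summable_inner 1)]
    refine tsum_congr fun k => ?_
    rw [one_apply_eq_self, inner_self_eq_norm_sq_to_K]
    norm_cast
  rw [h2]
  refine ContinuousLinearMap.opNorm_le_of_re_inner_le (tsum_nonneg fun _ => sq_nonneg _)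
    fun φ ψ hφ hψ => ?_
  rw [hρ.inner_left_eq_inner_right, ← (hv.hasSum φ ψ).tsum_eq]
  refine (Complex.re_le_norm _).trans (tsum_of_norm_bounded hv.summable.hasSum fun k => ?_)
  rw [norm_mul, sq]
  refine mul_le_mul ((norm_inner_le_norm _ _).trans ?_) ((norm_inner_le_norm _ _).trans ?_)
    (norm_nonneg _) (norm_nonneg _)
  · rw [hφ, one_mul]
  · rw [hψ, mul_one]

lemma tendsto_apply_of_tendsto_ket {S : Type} {B : ℕ → L2 S →L[ℂ] L2 S} {D : L2 S →L[ℂ] L2 S}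
    {C : ℝ} (hC : ∀ m, ‖B m‖ ≤ C)
    (hB : ∀ x, Filter.Tendsto (fun m => B m (ket x)) Filter.atTop (nhds (D (ket x)))) (f : L2 S) :
    Filter.Tendsto (fun m => B m f) Filter.atTop (nhds (D f)) := by
  have hcore : ∀ φ, Filter.Tendsto (fun m => B m (toL2 φ)) Filter.atTop (nhds (D (toL2 φ))) := by
    intro φ
    simp only [toL2, Finsupp.linearCombination_apply, Finsupp.sum, map_sum, map_smul]
    exact tendsto_finsetSum _ fun x _ => (hB x).const_smul _
  rw [Metric.tendsto_atTop]
  intro ε hε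
  have hC0 : 0 ≤ C := (norm_nonneg _).trans (hC 0)
  -- Approximating f within ε / (2 (C + ‖D‖ + 1)) keeps the two errors under `B m` and `D` below ε/2
  -- together; the 1 only ensures a nonzero denominator.
  have hK : 0 < C + ‖D‖ + 1 := by positivity
  obtain ⟨φ, hφ⟩ := denseRange_toL2.exists_dist_lt f (div_pos (half_pos hε) hK)
  obtain ⟨N, hN⟩ := Metric.tendsto_atTop.mp (hcore φ) (ε / 2) (half_pos hε)
  refine ⟨N, fun m hm => ?_⟩
  have h1 := hN m hm
  rw [dist_eq_norm] at h1 hφ ⊢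
  have e : B m f - D f = B m (f - toL2 φ) + (B m (toL2 φ) - D (toL2 φ)) - D (f - toL2 φ) := by
    simp only [map_sub]; abel
  have h2 : ‖B m (f - toL2 φ)‖ ≤ C * ‖f - toL2 φ‖ :=
    ((B m).le_opNorm _).trans (by gcongr; exact hC m)
  have h3 := D.le_opNorm (f - toL2 φ)
  have h4 : (C + ‖D‖ + 1) * ‖f - toL2 φ‖ < ε / 2 := by
    rw [mul_comm]; exact (lt_div_iff₀ hK).mp hφ
  rw [e]
  refine (norm_sub_le _ _).trans_lt ?_
  have h5 := norm_add_le (B m (f - toL2 φ)) (B m (toL2 φ) - D (toL2 φ))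
  nlinarith [norm_nonneg (f - toL2 φ)]

/-- Expectation values are continuous under bounded strong convergence. -/
lemma IsEnsemble.tendsto_ensembleMean {S κ : Type} {v : κ → L2 S} {ρ : L2 S →L[ℂ] L2 S}
    (h : IsEnsemble v ρ) {B : ℕ → L2 S →L[ℂ] L2 S} {D : L2 S →L[ℂ] L2 S} {C : ℝ}
    (hC : ∀ m, ‖B m‖ ≤ C)
    (hB : ∀ f, Filter.Tendsto (fun m => B m f) Filter.atTop (nhds (D f))) :
    Filter.Tendsto (fun m => ensembleMean v (B m)) Filter.atTop (nhds (ensembleMean v D)) := by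
  refine tendsto_tsum_of_dominated_convergence (h.summable.mul_left C)
    (fun k => Filter.Tendsto.inner tendsto_const_nhds (hB (v k)))
    (Filter.Eventually.of_forall fun m k => (norm_inner_clm_le _ _).trans ?_)
  gcongr
  exact hC m

lemma IsEnsemble.ensembleMean_rankOne {S κ : Type} {v : κ → L2 S} {ρ : L2 S →L[ℂ] L2 S}
    (h : IsEnsemble v ρ) (φ ψ : L2 S) :
    ensembleMean v (InnerProductSpace.rankOne ℂ φ ψ) = ⟪ψ, ρ φ⟫_ℂ := by
  refine ((h.hasSum ψ φ).congr_fun fun k => ?_).tsum_eq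
  rw [InnerProductSpace.rankOne_apply, inner_smul_right]

lemma IsEnsemble.ensembleMean_add {S κ : Type} {v : κ → L2 S} {ρ : L2 S →L[ℂ] L2 S}
    (h : IsEnsemble v ρ) (B C : L2 S →L[ℂ] L2 S) :
    ensembleMean v (B + C) = ensembleMean v B + ensembleMean v C := by
  rw [ensembleMean, ensembleMean, ensembleMean,
    ← (h.summable_inner B).tsum_add (h.summable_inner C)]
  simp only [_root_.add_apply, inner_add_right]

lemma ensembleMean_smul {S κ : Type} (v : κ → L2 S) (c : ℂ) (B : L2 S →L[ℂ] L2 S) :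
    ensembleMean v (c • B) = c * ensembleMean v B := by
  simp only [ensembleMean, _root_.smul_apply, inner_smul_right, tsum_mul_left]

/-! ### Canonical commutation relations -/

section Ladder

variable {ι : Type} [DecidableEq ι]

lemma annihilation_single_mul (j : ι) (x : ι → ℕ) (c : ℂ) :
    annihilation j (Finsupp.single x c) =
      Finsupp.single (Function.update x j (x j - 1)) (c * ((√(x j : ℝ) : ℝ) : ℂ)) := by
  simp [annihilation]

lemma creation_single_mul (j : ι) (x : ι → ℕ) (c : ℂ) :
    creation j (Finsupp.single x c) =
      Finsupp.single (Function.update x j (x j + 1)) (c * ((√((x j : ℝ) + 1) : ℝ) : ℂ)) := by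
  simp [creation]

lemma core_end_ext {S : Type} {E : Type*} [AddCommMonoid E] [Module ℂ E] {A B : Core S →ₗ[ℂ] E}
    (h : ∀ x, A (Finsupp.single x 1) = B (Finsupp.single x 1)) : A = B := by
  refine Finsupp.lhom_ext' fun x => LinearMap.ext_ring ?_
  simpa using h x

/-- The commutator of `A` and `B` is a scalar. -/
def ScalarComm {S : Type} (A B : Module.End ℂ (Core S)) : Prop :=
  ∃ c : ℂ, ∀ φ, A (B φ) - B (A φ) = c • φ

lemma ScalarComm.exists_commutator_eq {S : Type} {A B : Module.End ℂ (Core S)}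
    (h : ScalarComm A B) : ∃ c : ℂ, A * B - B * A = c • 1 := by
  obtain ⟨c, hc⟩ := h
  exact ⟨c, LinearMap.ext hc⟩

lemma ScalarComm.symm {S : Type} {A B : Module.End ℂ (Core S)} (h : ScalarComm A B) :
    ScalarComm B A := by
  obtain ⟨c, hc⟩ := h
  exact ⟨-c, fun φ => by rw [neg_smul, ← hc, neg_sub]⟩

lemma ScalarComm.smul_left {S : Type} {A B : Module.End ℂ (Core S)} (h : ScalarComm A B) (z : ℂ) :
    ScalarComm (z • A) B := by
  obtain ⟨c, hc⟩ := h
  exact ⟨z * c, fun φ => by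
    rw [mul_smul, ← hc, smul_sub, LinearMap.smul_apply, LinearMap.smul_apply, map_smul]⟩

lemma ScalarComm.add_left {S : Type} {A A' B : Module.End ℂ (Core S)} (h : ScalarComm A B)
    (h' : ScalarComm A' B) : ScalarComm (A + A') B := by
  obtain ⟨c, hc⟩ := h
  obtain ⟨d, hd⟩ := h'
  refine ⟨c + d, fun φ => ?_⟩
  rw [add_smul, ← hc, ← hd, LinearMap.add_apply, LinearMap.add_apply, map_add]
  abel

lemma ScalarComm.sum_left {S κ : Type} {A : κ → Module.End ℂ (Core S)} {B : Module.End ℂ (Core S)}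
    (s : Finset κ) (h : ∀ k, ScalarComm (A k) B) : ScalarComm (∑ k ∈ s, A k) B := by
  classical
  induction s using Finset.induction_on with
  | empty => exact ⟨0, fun φ => by simp⟩
  | insert a s ha ih => rw [Finset.sum_insert ha]; exact (h a).add_left ih

lemma scalarComm_of_commute {S : Type} {A B : Module.End ℂ (Core S)} (h : Commute A B) :
    ScalarComm A B := ⟨0, fun φ => by
  rw [← Module.End.mul_apply, h.eq, Module.End.mul_apply, sub_self, zero_smul]⟩

lemma commute_annihilation (i j : ι) : Commute (annihilation i) (annihilation (ι := ι) j) := by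
  by_cases hij : i = j
  · rw [hij]
  · refine core_end_ext fun x => ?_
    simp only [Module.End.mul_apply, annihilation_single_mul,
      Function.update_of_ne hij, Function.update_of_ne (Ne.symm hij), one_mul]
    rw [Function.update_comm hij, mul_comm]

lemma commute_creation (i j : ι) : Commute (creation i) (creation (ι := ι) j) := by
  by_cases hij : i = j
  · rw [hij]
  · refine core_end_ext fun x => ?_
    simp only [Module.End.mul_apply, creation_single_mul,
      Function.update_of_ne hij, Function.update_of_ne (Ne.symm hij), one_mul]
    rw [Function.update_comm hij, mul_comm]

lemma commute_annihilation_creation {i j : ι} (hij : i ≠ j) :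
    Commute (annihilation i) (creation (ι := ι) j) := by
  refine core_end_ext fun x => ?_
  simp only [Module.End.mul_apply, creation_single_mul, annihilation_single_mul,
    Function.update_of_ne hij, Function.update_of_ne (Ne.symm hij), one_mul]
  rw [Function.update_comm hij, mul_comm]

lemma annihilation_creation_single (j : ι) (x : ι → ℕ) :
    annihilation j (creation j (Finsupp.single x 1)) = ((x j : ℂ) + 1) • Finsupp.single x 1 := by
  rw [creation_single_mul, annihilation_single_mul, Function.update_self, Function.update_idem,
    Nat.add_sub_cancel, Function.update_eq_self, Nat.cast_add, Nat.cast_one, one_mul,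
    ← Complex.ofReal_mul, Real.mul_self_sqrt (by positivity)]
  simp

lemma creation_annihilation_single (j : ι) (x : ι → ℕ) :
    creation j (annihilation j (Finsupp.single x 1)) = (x j : ℂ) • Finsupp.single x 1 := by
  rw [annihilation_single_mul, creation_single_mul, Function.update_self, Function.update_idem,
    one_mul]
  -- At `x j = 0` the truncated subtraction is harmless because the coefficient √0 vanishes.
  rcases Nat.eq_zero_or_pos (x j) with h | h
  · simp [h]
  · have h1 : x j - 1 + 1 = x j := Nat.sub_add_cancel h
    have h2 : ((x j - 1 : ℕ) : ℝ) + 1 = x j := by exact_mod_cast h1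
    rw [h1, h2, Function.update_eq_self, ← Complex.ofReal_mul, Real.mul_self_sqrt (by positivity)]
    simp

lemma scalarComm_annihilation_creation (i j : ι) :
    ScalarComm (annihilation i) (creation (ι := ι) j) := by
  by_cases hij : i = j
  · subst hij
    have h : annihilation i * creation i = creation (ι := ι) i * annihilation i + 1 := by
      refine core_end_ext fun x => ?_
      rw [LinearMap.add_apply, Module.End.mul_apply, Module.End.mul_apply,
        annihilation_creation_single, creation_annihilation_single, add_smul, one_smul,
        Module.End.one_apply]
    refine ⟨1, fun φ => ?_⟩
    rw [← Module.End.mul_apply, h, LinearMap.add_apply, Module.End.mul_apply, Module.End.one_apply,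
      add_sub_cancel_left, one_smul]
  · exact scalarComm_of_commute (commute_annihilation_creation hij)

/-- The value of the scalar is left unspecified: it only produces a factor in the product of two
Weyl operators, which their linear span absorbs. -/
lemma scalarComm_quadrature (k l : ι × Fin 2) :
    ScalarComm (quadrature k) (quadrature (ι := ι) l) := by
  have hq : ∀ (k : ι × Fin 2) (B : Module.End ℂ (Core (ι → ℕ))),
      ScalarComm (annihilation k.1) B → ScalarComm (creation k.1) B →
        ScalarComm (quadrature k) B := by
    intro k B ha hc
    unfold quadrature
    split_ifs
    · exact (ha.add_left hc).smul_left _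
    · have e : annihilation k.1 - creation k.1 = annihilation k.1 + (-1 : ℂ) • creation k.1 := by
        module
      rw [e]
      exact (ha.add_left (hc.smul_left _)).smul_left _
  refine hq k _ (hq l _ ?_ ?_).symm (hq l _ ?_ ?_).symm
  · exact scalarComm_of_commute (commute_annihilation _ _)
  · exact (scalarComm_annihilation_creation _ _).symm
  · exact scalarComm_annihilation_creation _ _
  · exact scalarComm_of_commute (commute_creation _ _)

lemma quadrature_zero (j : ι) :
    quadrature (j, 0) = ((1 / √2 : ℝ) : ℂ) • (annihilation j + creation j) := rfl

lemma quadrature_one (j : ι) :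
    quadrature (j, 1) = (-Complex.I * ((1 / √2 : ℝ) : ℂ)) • (annihilation j - creation j) := rfl

lemma one_div_sqrt_two_mul_self : ((1 / √2 : ℝ) : ℂ) * ((1 / √2 : ℝ) : ℂ) = 1 / 2 := by
  rw [← Complex.ofReal_mul, div_mul_div_comm, Real.mul_self_sqrt (by norm_num)]
  norm_num

/-- Recovers the ladder operators from the quadratures, so that a subspace stable under the latter
can be climbed from the vacuum. -/
lemma creation_eq (j : ι) : creation j =
    ((1 / √2 : ℝ) : ℂ) • (quadrature (j, 0) - Complex.I • quadrature (j, 1)) := by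
  refine LinearMap.ext fun φ => ?_
  rw [quadrature_zero, quadrature_one, smul_smul, ← mul_assoc, mul_neg, Complex.I_mul_I, neg_neg,
    one_mul]
  simp only [LinearMap.smul_apply, LinearMap.sub_apply, LinearMap.add_apply]
  rw [← smul_sub, smul_smul, one_div_sqrt_two_mul_self]
  module

lemma quadrature_sq_add_quadrature_sq (j : ι) :
    quadrature (j, 0) * quadrature (j, 0) + quadrature (j, 1) * quadrature (j, 1) =
      annihilation j * creation j + creation (ι := ι) j * annihilation j := by
  rw [quadrature_zero, quadrature_one, smul_mul_smul_comm, smul_mul_smul_comm, mul_mul_mul_comm,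
    neg_mul_neg, Complex.I_mul_I, one_div_sqrt_two_mul_self]
  refine LinearMap.ext fun φ => ?_
  simp only [LinearMap.smul_apply, LinearMap.sub_apply, LinearMap.add_apply, Module.End.mul_apply,
    map_add, map_sub]
  module

/-- Each mode contributes Q² + P² = a a† + a† a, whose eigenvalue is 2 xⱼ + 1. -/
lemma sum_quadrature_sq_single [Fintype ι] (x : ι → ℕ) :
    (∑ k, quadrature k * quadrature k) (Finsupp.single x 1) =
      ((2 * photonNumber x + Fintype.card ι : ℝ) : ℂ) • Finsupp.single x (1 : ℂ) := by
  rw [Fintype.sum_prod_type]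
  simp only [Fin.sum_univ_two, quadrature_sq_add_quadrature_sq]
  rw [LinearMap.sum_apply]
  simp only [LinearMap.add_apply, Module.End.mul_apply, annihilation_creation_single,
    creation_annihilation_single, ← add_smul]
  rw [← Finset.sum_smul]
  congr 1
  simp only [Finset.sum_add_distrib, photonNumber, Finset.sum_const, Finset.card_univ,
    nsmul_eq_mul]
  push_cast
  ring

end Ladder

/-! ### Weyl operators -/

section Weyl

variable {ι : Type} [Fintype ι] [DecidableEq ι]

/-- The generator `i ξ·R` of a Weyl operator. -/
def weylGen (ξ : ι × Fin 2 → ℝ) : Module.End ℂ (Core (ι → ℕ)) :=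
  Complex.I • ∑ k, (ξ k : ℂ) • quadrature k

lemma isExpOf_weyl (ξ : ι × Fin 2 → ℝ) : IsExpOf (weylGen ξ) (weyl ξ) := (exists_weyl ξ).choose_spec

lemma skew_weylGen (ξ : ι × Fin 2 → ℝ) : Skew (weylGen ξ) := by
  have hA : Adj (∑ k, (ξ k : ℂ) • quadrature (ι := ι) k) (∑ k, (ξ k : ℂ) • quadrature k) :=
    Adj.sum (fun k => by simpa using (adj_quadrature k).smul (ξ k : ℂ)) _
  have hs := hA.skew 1
  rwa [Complex.ofReal_one, mul_one] at hs

lemma entire_weylGen (ξ : ι × Fin 2 → ℝ) : Entire (weylGen ξ) :=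
  ((LinearGrowth.sum _ fun k => (linearGrowth_quadrature k).smul _).smul _).entire

lemma weylGen_add (ξ η : ι × Fin 2 → ℝ) : weylGen (ξ + η) = weylGen ξ + weylGen η := by
  simp only [weylGen, Pi.add_apply, Complex.ofReal_add, add_smul, Finset.sum_add_distrib, smul_add]

lemma weylGen_smul (s : ℝ) (ξ : ι × Fin 2 → ℝ) : weylGen (s • ξ) = (s : ℂ) • weylGen ξ := by
  simp only [weylGen, Pi.smul_apply, smul_eq_mul, Complex.ofReal_mul, mul_smul, ← Finset.smul_sum]
  rw [smul_comm]

lemma weylGen_neg (ξ : ι × Fin 2 → ℝ) : weylGen (-ξ) = -weylGen ξ := by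
  rw [← neg_one_smul ℝ, weylGen_smul]
  refine LinearMap.ext fun φ => ?_
  simp

lemma weylGen_single (k : ι × Fin 2) : weylGen (Pi.single k 1) = Complex.I • quadrature k := by
  rw [weylGen, Finset.sum_eq_single k]
  · simp
  · intro l _ hl; simp [hl]
  · simp

lemma weyl_comp_weyl (ξ η : ι × Fin 2 → ℝ) :
    ∃ z : ℂ, weyl ξ * weyl η = z • weyl (ξ + η) := by
  have h : ∀ (B : Module.End ℂ (Core (ι → ℕ))) (ζ : ι × Fin 2 → ℝ),
      (∀ k, ScalarComm (quadrature k) B) → ScalarComm (weylGen ζ) B := fun B ζ hB =>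
    (ScalarComm.sum_left _ fun k => (hB k).smul_left _).smul_left _
  obtain ⟨c, hc⟩ := (h _ ξ fun k =>
    (h _ η fun l => scalarComm_quadrature l k).symm).exists_commutator_eq
  exact ⟨_, (isExpOf_weyl ξ).comp_eq_smul (skew_weylGen ξ) (entire_weylGen ξ) (entire_weylGen η)
    (isExpOf_weyl η) (weylGen_add ξ η ▸ isExpOf_weyl (ξ + η)) hc⟩

lemma norm_weyl_apply (ξ : ι × Fin 2 → ℝ) (f : L2 (ι → ℕ)) : ‖weyl ξ f‖ = ‖f‖ :=
  (isExpOf_weyl ξ).norm_apply (skew_weylGen ξ) (entire_weylGen ξ) f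

lemma norm_weyl_le (ξ : ι × Fin 2 → ℝ) : ‖weyl ξ‖ ≤ 1 :=
  ContinuousLinearMap.opNorm_le_bound _ zero_le_one fun f => by rw [norm_weyl_apply, one_mul]

lemma adjoint_weyl (ξ : ι × Fin 2 → ℝ) : ContinuousLinearMap.adjoint (weyl ξ) = weyl (-ξ) :=
  (isExpOf_weyl ξ).adjoint_eq (skew_weylGen ξ) (weylGen_neg ξ ▸ isExpOf_weyl (-ξ))

/-- C is the tail of ∑ ‖A^k ψ‖ / k! from k = m on; for |s| ≤ 1 a factor |s|^m comes out of the
remainder, so C is independent of s. -/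
lemma IsExpOf.norm_sub_taylor_le {S : Type} {A : Module.End ℂ (Core S)} (hA : Entire A)
    (ψ : Core S) (m : ℕ) : ∃ C : ℝ, 0 ≤ C ∧ ∀ (s : ℝ) (U : L2 S →L[ℂ] L2 S), |s| ≤ 1 →
      IsExpOf ((s : ℂ) • A) U →
      ‖U (toL2 ψ) - ∑ k ∈ Finset.range m,
        (s : ℂ) ^ k • ((k.factorial : ℂ)⁻¹ • toL2 ((A ^ k) ψ))‖ ≤ |s| ^ m * C := by
  refine ⟨∑' k, ‖((k + m).factorial : ℂ)⁻¹ • toL2 ((A ^ (k + m)) ψ)‖,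
    tsum_nonneg fun _ => norm_nonneg _, fun s U hs hU => ?_⟩
  have h1 := hU ψ
  simp only [smul_pow, LinearMap.smul_apply, map_smul] at h1
  have h2 : HasSum (fun k => (s : ℂ) ^ k • ((k.factorial : ℂ)⁻¹ • toL2 ((A ^ k) ψ)))
      (U (toL2 ψ)) := h1.congr_fun fun k => smul_comm _ _ _
  have h3 := (hasSum_nat_add_iff' m).mpr h2
  have h4 := ((summable_nat_add_iff m).mpr (hA ψ)).mul_left (|s| ^ m)
  rw [← h3.tsum_eq, ← tsum_mul_left]
  refine tsum_of_norm_bounded h4.hasSum fun k => ?_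
  rw [norm_smul, norm_pow, Complex.norm_real, Real.norm_eq_abs]
  refine mul_le_mul_of_nonneg_right ?_ (norm_nonneg _)
  exact pow_le_pow_of_le_one (abs_nonneg _) hs (Nat.le_add_left _ _)

end Weyl

/-! ### A state is determined by its characteristic function -/

/-- Telescoping B^m - r^m into m terms B^i (B - r) r^{m-1-i}, whose outer factors are contractions.
-/
lemma norm_pow_apply_sub_le {E : Type*} [NormedAddCommGroup E] [NormedSpace ℂ E] {B : E →L[ℂ] E}
    (hB : ‖B‖ ≤ 1) {r : ℝ} (hr0 : 0 ≤ r) (hr : r ≤ 1) (ψ : E) (m : ℕ) :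
    ‖(B ^ m) ψ - ((r ^ m : ℝ) : ℂ) • ψ‖ ≤ m * ‖B ψ - (r : ℂ) • ψ‖ := by
  induction m with
  | zero => simp
  | succ m ih =>
    have e : (B ^ (m + 1)) ψ - ((r ^ (m + 1) : ℝ) : ℂ) • ψ =
        (B ^ m) (B ψ - (r : ℂ) • ψ) + (r : ℂ) • ((B ^ m) ψ - ((r ^ m : ℝ) : ℂ) • ψ) := by
      rw [pow_succ, mul_apply_eq_comp, map_sub, map_smul, smul_sub, smul_smul,
        ← Complex.ofReal_mul, ← pow_succ']
      abel
    have hBm : ‖B ^ m‖ ≤ 1 := by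
      rcases Nat.eq_zero_or_pos m with h | h
      · subst h; rw [pow_zero]; exact ContinuousLinearMap.norm_id_le
      · exact (norm_pow_le' B h).trans (pow_le_one₀ (norm_nonneg _) hB)
    rw [e]
    refine (norm_add_le _ _).trans ?_
    have h1 : ‖(B ^ m) (B ψ - (r : ℂ) • ψ)‖ ≤ ‖B ψ - (r : ℂ) • ψ‖ :=
      ((B ^ m).le_opNorm _).trans (mul_le_of_le_one_left (norm_nonneg _) hBm)
    have h2 : ‖(r : ℂ) • ((B ^ m) ψ - ((r ^ m : ℝ) : ℂ) • ψ)‖ ≤ m * ‖B ψ - (r : ℂ) • ψ‖ := by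
      rw [norm_smul, Complex.norm_real, Real.norm_of_nonneg hr0]
      exact (mul_le_of_le_one_left (norm_nonneg _) hr).trans ih
    rw [Nat.cast_succ]
    linarith

lemma exists_diagonal {S : Type} (r : S → ℝ) (h0 : ∀ x, 0 ≤ r x) (h1 : ∀ x, r x ≤ 1) :
    ∃ D : L2 S →L[ℂ] L2 S, ‖D‖ ≤ 1 ∧ ∀ x, D (ket x) = (r x : ℂ) • ket x := by
  have hle : ∀ (f : L2 S) x, ‖(r x : ℂ) * f x‖ ≤ ‖f x‖ := fun f x => by
    rw [norm_mul, Complex.norm_real, Real.norm_of_nonneg (h0 x)]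
    exact mul_le_of_le_one_left (norm_nonneg _) (h1 x)
  have hmem : ∀ f : L2 S, Memℓp (fun x => (r x : ℂ) * f x) 2 := fun f => by
    have hf := (lp.memℓp f)
    rw [memℓp_gen_iff (by norm_num)] at hf ⊢
    refine hf.of_nonneg_of_le (fun _ => by positivity) fun x => ?_
    exact Real.rpow_le_rpow (norm_nonneg _) (hle f x) (by norm_num)
  let T : L2 S →ₗ[ℂ] L2 S :=
    { toFun := fun f => ⟨fun x => (r x : ℂ) * f x, hmem f⟩
      map_add' := fun f g => by ext x; exact mul_add _ _ _
      map_smul' := fun c f => by ext x; simp [mul_left_comm] }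
  have hT : ∀ f, ‖T f‖ ≤ 1 * ‖f‖ := fun f => by
    rw [one_mul]
    have hp : 0 < (2 : ENNReal).toReal := by norm_num
    rw [lp.norm_eq_tsum_rpow hp, lp.norm_eq_tsum_rpow hp]
    refine Real.rpow_le_rpow (tsum_nonneg fun _ => by positivity) ?_ (by norm_num)
    refine Summable.tsum_le_tsum (fun x => Real.rpow_le_rpow (norm_nonneg _) (hle f x) (by norm_num))
      ((memℓp_gen_iff hp).mp (hmem f)) ((memℓp_gen_iff hp).mp (lp.memℓp f))
  refine ⟨T.mkContinuous 1 hT, LinearMap.mkContinuous_norm_le _ zero_le_one _, fun x => ?_⟩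
  ext y
  change (r y : ℂ) * (ket x : L2 S) y = (r x : ℂ) * (ket x : L2 S) y
  by_cases h : y = x
  · rw [h]
  · simp [ket, lp.single_apply, h]

/-! ### Averages of small displacements and the oscillator semigroup. -/

section

variable {ι : Type} [Fintype ι] [DecidableEq ι]

/-- The linear combinations of Weyl operators. -/
def weylSpan (ι : Type) [Fintype ι] [DecidableEq ι] :
    Submodule ℂ (L2 (ι → ℕ) →L[ℂ] L2 (ι → ℕ)) := Submodule.span ℂ (Set.range weyl)

lemma weyl_mem (ξ : ι × Fin 2 → ℝ) : weyl ξ ∈ weylSpan ι := Submodule.subset_span ⟨ξ, rfl⟩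

lemma weyl_zero : weyl (0 : ι × Fin 2 → ℝ) = 1 := by
  have h := isExpOf_weyl (0 : ι × Fin 2 → ℝ)
  have h0 : weylGen (0 : ι × Fin 2 → ℝ) = 0 := by simp [weylGen]
  rw [h0] at h
  have := h.comp_eq isExpOf_zero (L := LinearMap.id) (T := ContinuousLinearMap.id ℂ _)
    (fun _ => rfl) rfl
  exact this

lemma mul_mem_weylSpan {B C : L2 (ι → ℕ) →L[ℂ] L2 (ι → ℕ)} (hB : B ∈ weylSpan ι)
    (hC : C ∈ weylSpan ι) : B * C ∈ weylSpan ι := by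
  refine Submodule.span_induction ?_ ?_ ?_ ?_ hB
  · rintro _ ⟨ξ, rfl⟩
    refine Submodule.span_induction ?_ ?_ ?_ ?_ hC
    · rintro _ ⟨η, rfl⟩
      obtain ⟨z, hz⟩ := weyl_comp_weyl ξ η
      rw [hz]
      exact (weylSpan ι).smul_mem _ (weyl_mem _)
    · rw [mul_zero]; exact (weylSpan ι).zero_mem
    · intro x y _ _ hx hy
      rw [mul_add]; exact (weylSpan ι).add_mem hx hy
    · intro a x _ hx
      rw [mul_smul_comm]; exact (weylSpan ι).smul_mem _ hx
  · rw [zero_mul]; exact (weylSpan ι).zero_mem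
  · intro x y _ _ hx hy
    rw [add_mul]; exact (weylSpan ι).add_mem hx hy
  · intro a x _ hx
    rw [smul_mul_assoc]; exact (weylSpan ι).smul_mem _ hx

lemma pow_mem_weylSpan {B : L2 (ι → ℕ) →L[ℂ] L2 (ι → ℕ)} (hB : B ∈ weylSpan ι) (m : ℕ) :
    B ^ m ∈ weylSpan ι := by
  induction m with
  | zero => rw [pow_zero, ← weyl_zero]; exact weyl_mem _
  | succ m ih => rw [pow_succ]; exact mul_mem_weylSpan ih hB

variable (ι) in
/-- The average of the displacements by `±ε` along the coordinate axes of phase space. -/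
def weylAverage (ε : ℝ) : L2 (ι → ℕ) →L[ℂ] L2 (ι → ℕ) :=
  (((2 * Fintype.card (ι × Fin 2) : ℝ)⁻¹ : ℝ) : ℂ) •
    ∑ k : ι × Fin 2, (weyl (ε • Pi.single k 1) + weyl (-ε • Pi.single k 1))

lemma weylAverage_mem (ε : ℝ) : weylAverage ι ε ∈ weylSpan ι :=
  (weylSpan ι).smul_mem _ ((weylSpan ι).sum_mem fun _ _ =>
    (weylSpan ι).add_mem (weyl_mem _) (weyl_mem _))

lemma norm_weylAverage_le [Nonempty ι] (ε : ℝ) : ‖weylAverage ι ε‖ ≤ 1 := by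
  have hc : (0 : ℝ) < 2 * Fintype.card (ι × Fin 2) := by
    have : 0 < Fintype.card (ι × Fin 2) := Fintype.card_pos
    positivity
  rw [weylAverage, norm_smul, Complex.norm_real, Real.norm_of_nonneg (by positivity),
    inv_mul_le_iff₀ hc, mul_one]
  refine (norm_sum_le _ _).trans ?_
  refine (Finset.sum_le_card_nsmul _ _ 2 fun k _ => ?_).trans ?_
  · refine (norm_add_le _ _).trans ?_
    have := norm_weyl_le (ε • Pi.single k (1 : ℝ))
    have := norm_weyl_le (-ε • Pi.single k (1 : ℝ))
    linarith
  · rw [Finset.card_univ, nsmul_eq_mul, mul_comm]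

/-- The eigenvalues of `∑ₖ Rₖ²`. -/
def oscillatorEnergy (x : ι → ℕ) : ℝ := 2 * photonNumber x + Fintype.card ι

/-- The displacements by ε and -ε cancel at first order, and their second-order terms sum to -ε² ∑
R², for which |x⟩ is an eigenvector. A cubic remainder suffices, since m powers will be taken with m
ε² fixed. -/
lemma norm_weylAverage_sub_le [Nonempty ι] (x : ι → ℕ) : ∃ C : ℝ, 0 ≤ C ∧ ∀ ε : ℝ, |ε| ≤ 1 →
    ‖weylAverage ι ε (ket x) - ((1 - ε ^ 2 / (2 * Fintype.card (ι × Fin 2)) *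
      oscillatorEnergy x : ℝ) : ℂ) • ket x‖ ≤ C * |ε| ^ 3 := by
  choose C hC0 hC using fun k : ι × Fin 2 => IsExpOf.norm_sub_taylor_le
    (entire_weylGen (Pi.single k (1 : ℝ))) (Finsupp.single x 1) 3
  have hcard : (0 : ℝ) < Fintype.card (ι × Fin 2) := by exact_mod_cast Fintype.card_pos
  set K : ℝ := ((Fintype.card (ι × Fin 2) : ℕ) : ℝ) with hK
  refine ⟨∑ k, C k, Finset.sum_nonneg fun k _ => hC0 k, fun ε hε => ?_⟩
  let A : ι × Fin 2 → Module.End ℂ (Core (ι → ℕ)) := fun k => weylGen (Pi.single k 1)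
  let R : ℝ → ι × Fin 2 → L2 (ι → ℕ) := fun s k =>
    weyl (s • Pi.single k (1 : ℝ)) (toL2 (Finsupp.single x 1)) - ∑ m ∈ Finset.range 3,
        (s : ℂ) ^ m • ((m.factorial : ℂ)⁻¹ • toL2 ((A k ^ m) (Finsupp.single x 1)))
  have hR : ∀ s k, |s| = |ε| → ‖R s k‖ ≤ |ε| ^ 3 * C k := fun s k hs => by
    rw [← hs] at hε ⊢
    exact hC k s _ hε (weylGen_smul s (Pi.single k 1) ▸ isExpOf_weyl _)
  have hsq : ∑ k, toL2 ((A k ^ 2) (Finsupp.single x 1)) = -((oscillatorEnergy x : ℂ) • ket x) := by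
    have h := sum_quadrature_sq_single x
    rw [LinearMap.sum_apply] at h
    rw [← toL2_single_one, oscillatorEnergy, ← map_smul, ← h, map_sum, ← Finset.sum_neg_distrib]
    refine Finset.sum_congr rfl fun k _ => ?_
    simp only [A]
    rw [weylGen_single, smul_pow, Complex.I_sq, pow_two, LinearMap.smul_apply, map_smul,
      neg_one_smul]
  have e : weylAverage ι ε (ket x) - ((1 - ε ^ 2 / (2 * K) * oscillatorEnergy x : ℝ) : ℂ) • ket x =
      (((2 * K)⁻¹ : ℝ) : ℂ) • ∑ k, (R ε k + R (-ε) k) := by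
    have e1 : ∀ k, R ε k + R (-ε) k = (weyl (ε • Pi.single k (1 : ℝ)) (ket x) +
        weyl (-ε • Pi.single k (1 : ℝ)) (ket x)) -
        ((2 : ℂ) • ket x + ((ε : ℂ) ^ 2) • toL2 ((A k ^ 2) (Finsupp.single x 1))) := by
      intro k
      simp only [R, toL2_single_one, Finset.sum_range_succ, Finset.sum_range_zero]
      simp [toL2_single_one]
      module
    simp only [e1]
    have e2 : ∑ k, ((2 : ℂ) • ket x + ((ε : ℂ) ^ 2) • toL2 ((A k ^ 2) (Finsupp.single x 1))) =
        Fintype.card (ι × Fin 2) • ((2 : ℂ) • ket x) +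
          ((ε : ℂ) ^ 2) • -((oscillatorEnergy x : ℂ) • ket x) := by
      rw [← hsq, Finset.smul_sum, Finset.sum_add_distrib, Finset.sum_const, Finset.card_univ]
    rw [Finset.sum_sub_distrib, e2, weylAverage, _root_.smul_apply, _root_.sum_apply]
    simp only [_root_.add_apply, ← hK]
    rw [smul_sub]
    congr 1
    rw [← Nat.cast_smul_eq_nsmul ℂ, smul_smul, smul_add, smul_smul, smul_neg, smul_neg, smul_smul,
      smul_smul, ← sub_eq_add_neg, ← sub_smul]
    congr 1
    have hK0 : (K : ℂ) ≠ 0 := by exact_mod_cast hcard.ne'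
    have hKc : ((Fintype.card (ι × Fin 2) : ℕ) : ℂ) = (K : ℂ) := by rw [hK]; norm_cast
    rw [hKc]
    push_cast
    field_simp
  rw [e, norm_smul, Complex.norm_real, Real.norm_of_nonneg (by positivity),
    inv_mul_le_iff₀ (by positivity)]
  have hK1 : 1 ≤ K := by
    rw [hK]; exact_mod_cast Fintype.card_pos
  have hs : ‖∑ k, (R ε k + R (-ε) k)‖ ≤ 2 * ((∑ k, C k) * |ε| ^ 3) := by
    rw [Finset.sum_mul, Finset.mul_sum]
    refine (norm_sum_le _ _).trans (Finset.sum_le_sum fun k _ => (norm_add_le _ _).trans ?_)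
    have := hR ε k rfl
    have := hR (-ε) k (abs_neg ε)
    linarith
  refine hs.trans ?_
  have : 0 ≤ (∑ k, C k) * |ε| ^ 3 :=
    mul_nonneg (Finset.sum_nonneg fun k _ => hC0 k) (by positivity)
  nlinarith

lemma abs_exp_neg_sub_le {u : ℝ} (h0 : 0 ≤ u) (h1 : u ≤ 1) : |Real.exp (-u) - (1 - u)| ≤ u ^ 2 := by
  have := Real.abs_exp_sub_one_sub_id_le (x := -u) (by rwa [abs_neg, abs_of_nonneg h0])
  rw [neg_sq] at this
  convert this using 2
  ring

/-- A Chernoff product formula. The step size solves ε² E / (2K) = τ E / m, where K is the number of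
quadratures, so one average agrees on |x⟩ with the scalar e^{-τE/m} up to O(ε³) + O(1/m²). By
`norm_pow_apply_sub_le` the m-th power multiplies this error by at most m. -/
lemma tendsto_weylAverage_pow [Nonempty ι] {τ : ℝ} (hτ : 0 < τ) (x : ι → ℕ) :
    Filter.Tendsto (fun m : ℕ => (weylAverage ι √(2 * Fintype.card (ι × Fin 2) * τ / m) ^ m) (ket x))
      Filter.atTop (nhds ((Real.exp (-(τ * oscillatorEnergy x)) : ℂ) • ket x)) := by
  obtain ⟨C, hC0, hC⟩ := norm_weylAverage_sub_le x
  have hcard : (0 : ℝ) < Fintype.card (ι × Fin 2) := by exact_mod_cast Fintype.card_pos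
  set K : ℝ := ((Fintype.card (ι × Fin 2) : ℕ) : ℝ) with hK
  set E := oscillatorEnergy x with hE
  have hE0 : 0 ≤ E := by rw [hE, oscillatorEnergy]; positivity
  set ε : ℕ → ℝ := fun m => √(2 * K * τ / m) with hε
  have hε0 : Filter.Tendsto ε Filter.atTop (nhds 0) := by
    rw [← Real.sqrt_zero]
    exact (tendsto_const_div_atTop_nhds_zero_nat (2 * K * τ)).sqrt
  have hu0 : Filter.Tendsto (fun m : ℕ => τ * E / m) Filter.atTop (nhds 0) :=
    tendsto_const_div_atTop_nhds_zero_nat (τ * E)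
  rw [tendsto_iff_norm_sub_tendsto_zero]
  have hlim : Filter.Tendsto (fun m : ℕ => C * (2 * K * τ) * ε m + (τ * E) * (τ * E / m))
      Filter.atTop (nhds 0) := by
    have := (hε0.const_mul (C * (2 * K * τ))).add (hu0.const_mul (τ * E))
    simpa using this
  refine squeeze_zero' (Filter.Eventually.of_forall fun _ => norm_nonneg _) ?_ hlim
  filter_upwards [hε0.eventually_lt_const one_pos, hu0.eventually_lt_const one_pos,
    Filter.eventually_gt_atTop 0] with m h1 h2 hm
  have hm0 : (0 : ℝ) < m := by exact_mod_cast hm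
  have hεn : 0 ≤ ε m := Real.sqrt_nonneg _
  have hsq : ε m ^ 2 = 2 * K * τ / m := Real.sq_sqrt (by positivity)
  have hu : 0 ≤ τ * E / m := by positivity
  have hpow : Real.exp (-(τ * E)) = Real.exp (-(τ * E / m)) ^ m := by
    rw [← Real.exp_nat_mul]
    congr 1
    field_simp
  rw [hpow]
  refine (norm_pow_apply_sub_le (norm_weylAverage_le _) (Real.exp_pos _).le
    (Real.exp_le_one_iff.mpr (by linarith)) _ m).trans ?_
  have h3 := hC (ε m) (by rw [abs_of_nonneg hεn]; exact h1.le)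
  have h4 := abs_exp_neg_sub_le hu h2.le
  have e1 : ε m ^ 2 / (2 * K) * E = τ * E / m := by
    rw [hsq]; field_simp
  rw [e1, abs_of_nonneg hεn] at h3
  have h5 : ‖weylAverage ι (ε m) (ket x) - (Real.exp (-(τ * E / m)) : ℂ) • ket x‖ ≤
      C * ε m ^ 3 + (τ * E / m) ^ 2 := by
    have e2 : weylAverage ι (ε m) (ket x) - (Real.exp (-(τ * E / m)) : ℂ) • ket x =
        (weylAverage ι (ε m) (ket x) - ((1 - τ * E / m : ℝ) : ℂ) • ket x) -
        ((Real.exp (-(τ * E / m)) - (1 - τ * E / m) : ℝ) : ℂ) • ket x := by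
      rw [Complex.ofReal_sub (Real.exp _), sub_smul]
      abel
    rw [e2]
    refine (norm_sub_le _ _).trans (add_le_add h3 ?_)
    rw [norm_smul, norm_ket, mul_one, Complex.norm_real]
    exact h4
  -- Since m ε² = 2Kτ is constant, each contribution keeps a factor tending to zero: ε in the first
  -- and τE/m in the second.
  calc (m : ℝ) * _ ≤ m * (C * ε m ^ 3 + (τ * E / m) ^ 2) := by gcongr
    _ = C * (m * ε m ^ 2) * ε m + (τ * E) * (τ * E / m) := by field_simp
    _ = _ := by rw [hsq]; field_simp

end

/-- Equality of expectations survives bounded strong limits in the middle factor. It is applied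
twice: from averages of Weyl operators to the semigroup, then from the semigroup to the vacuum
projection. -/
lemma ensembleMean_eq_of_tendsto_ket {S κ κ' : Type} {ρ σ : L2 S →L[ℂ] L2 S}
    {v : κ → L2 S} {w : κ' → L2 S} (hv : IsEnsemble v ρ) (hw : IsEnsemble w σ)
    {B C : L2 S →L[ℂ] L2 S} {D : L2 S →L[ℂ] L2 S}
    {A : ℕ → L2 S →L[ℂ] L2 S} (hA : ∀ m, ‖A m‖ ≤ 1)
    (hD : ∀ x, Filter.Tendsto (fun m => A m (ket x)) Filter.atTop (nhds (D (ket x))))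
    (h : ∀ m, ensembleMean v (B * A m * C) = ensembleMean w (B * A m * C)) :
    ensembleMean v (B * D * C) = ensembleMean w (B * D * C) := by
  have hC : ∀ m, ‖B * A m * C‖ ≤ ‖B‖ * ‖C‖ := fun m => by
    refine (norm_mul_le _ _).trans (mul_le_mul_of_nonneg_right ?_ (norm_nonneg _))
    exact (norm_mul_le _ _).trans (mul_le_of_le_one_right (norm_nonneg _) (hA m))
  have hlim : ∀ f, Filter.Tendsto (fun m => (B * A m * C) f) Filter.atTop
      (nhds ((B * D * C) f)) := fun f =>
    (B.continuous.tendsto _).comp (tendsto_apply_of_tendsto_ket hA hD (C f))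
  have h1 := hv.tendsto_ensembleMean hC hlim
  simp only [h] at h1
  exact tendsto_nhds_unique h1 (hw.tendsto_ensembleMean hC hlim)

lemma oscillatorEnergy_nonneg {ι : Type} [Fintype ι] (x : ι → ℕ) : 0 ≤ oscillatorEnergy x := by
  unfold oscillatorEnergy; positivity

/-! ### Cyclicity of the vacuum and reconstruction of a state. -/

section

variable {ι : Type} [Fintype ι] [DecidableEq ι]

/-- The difference quotients (W(sξ) - 1)/s map M into itself and converge to the generator on the
dense domain, by the Taylor estimate of order 2; M is closed. -/
lemma toL2_weylGen_mem {M : Submodule ℂ (L2 (ι → ℕ))} (hM : IsClosed (M : Set (L2 (ι → ℕ))))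
    (hW : ∀ ξ : ι × Fin 2 → ℝ, ∀ f ∈ M, weyl ξ f ∈ M) (ξ : ι × Fin 2 → ℝ) {φ : Core (ι → ℕ)}
    (hφ : toL2 φ ∈ M) : toL2 (weylGen ξ φ) ∈ M := by
  obtain ⟨C, hC0, hC⟩ := IsExpOf.norm_sub_taylor_le (entire_weylGen ξ) φ 2
  let s : ℕ → ℝ := fun m => 1 / ((m : ℝ) + 1)
  have hs : Filter.Tendsto s Filter.atTop (nhds 0) := tendsto_one_div_add_atTop_nhds_zero_nat
  let F : ℕ → L2 (ι → ℕ) := fun m => ((s m : ℂ)⁻¹) • (weyl (s m • ξ) (toL2 φ) - toL2 φ)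
  have hF : ∀ m, F m ∈ M := fun m => M.smul_mem _ (M.sub_mem (hW _ _ hφ) hφ)
  refine hM.mem_of_tendsto (f := F) (b := Filter.atTop) ?_ (Filter.Eventually.of_forall hF)
  rw [tendsto_iff_norm_sub_tendsto_zero]
  refine squeeze_zero (fun _ => norm_nonneg _) (fun m => ?_)
    (by simpa using hs.mul_const C : Filter.Tendsto (fun m => s m * C) Filter.atTop (nhds 0))
  have hsm : 0 < s m := by simp only [s]; positivity
  have hs1 : s m ≤ 1 := by
    simp only [s]
    rw [div_le_one (by positivity)]
    have : (0 : ℝ) ≤ m := by positivity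
    linarith
  have h := hC (s m) (weyl (s m • ξ)) (by rwa [abs_of_pos hsm])
    (weylGen_smul (s m) ξ ▸ isExpOf_weyl (s m • ξ))
  have hsc : (s m : ℂ) ≠ 0 := by exact_mod_cast hsm.ne'
  have e : F m - toL2 (weylGen ξ φ) = ((s m : ℂ)⁻¹) • (weyl (s m • ξ) (toL2 φ) -
      ∑ k ∈ Finset.range 2,
        (s m : ℂ) ^ k • ((k.factorial : ℂ)⁻¹ • toL2 ((weylGen ξ ^ k) φ))) := by
    simp only [F, Finset.sum_range_succ, Finset.sum_range_zero, zero_add, pow_zero, pow_one,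
      Nat.factorial_zero, Nat.factorial_one, Nat.cast_one, inv_one, one_smul,
      Module.End.one_apply]
    rw [← sub_sub, smul_sub _ (_ - _), smul_smul, inv_mul_cancel₀ hsc, one_smul]
  rw [e, norm_smul, norm_inv, Complex.norm_real, Real.norm_of_nonneg hsm.le,
    inv_mul_le_iff₀ hsm]
  refine h.trans_eq ?_
  rw [abs_of_pos hsm]
  ring

/-- The vacuum is cyclic for the Weyl operators. -/
theorem eq_top_of_weyl_invariant {M : Submodule ℂ (L2 (ι → ℕ))}
    (hM : IsClosed (M : Set (L2 (ι → ℕ)))) (h0 : ket 0 ∈ M)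
    (hW : ∀ ξ : ι × Fin 2 → ℝ, ∀ f ∈ M, weyl ξ f ∈ M) : M = ⊤ := by
  have hq : ∀ (k : ι × Fin 2) (φ : Core (ι → ℕ)), toL2 φ ∈ M → toL2 (quadrature k φ) ∈ M := by
    intro k φ hφ
    have h := M.smul_mem (-Complex.I) (toL2_weylGen_mem hM hW (Pi.single k 1) hφ)
    rw [weylGen_single, LinearMap.smul_apply, map_smul, smul_smul, neg_mul, Complex.I_mul_I,
      neg_neg, one_smul] at h
    exact h
  have hc : ∀ (j : ι) (φ : Core (ι → ℕ)), toL2 φ ∈ M → toL2 (creation j φ) ∈ M := by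
    intro j φ hφ
    rw [creation_eq, LinearMap.smul_apply, LinearMap.sub_apply, LinearMap.smul_apply, map_smul,
      map_sub, map_smul]
    exact M.smul_mem _ (M.sub_mem (hq _ _ hφ) (M.smul_mem _ (hq _ _ hφ)))
  -- Induction on the photon number: a basis vector other than the vacuum is, up to the nonzero
  -- factor √(xⱼ), a creation operator applied to a basis vector with one photon less.
  have hket : ∀ (N : ℕ) (x : ι → ℕ), photonNumber x = N → ket x ∈ M := by
    intro N
    induction N with
    | zero =>
      intro x hx
      have : x = 0 := by
        ext i
        have := le_photonNumber x i
        simp only [Pi.zero_apply]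
        omega
      rwa [this]
    | succ N ih =>
      intro x hx
      obtain ⟨j, hj⟩ : ∃ j, 0 < x j := by
        by_contra h
        push Not at h
        have : photonNumber x = 0 := Finset.sum_eq_zero fun i _ => Nat.le_zero.mp (h i)
        omega
      have hy : photonNumber (Function.update x j (x j - 1)) = N := by
        rw [photonNumber, ← Finset.add_sum_erase _ x (Finset.mem_univ j)] at hx
        rw [photonNumber, Finset.sum_update_of_mem (Finset.mem_univ j),
          Finset.sdiff_singleton_eq_erase]
        omega
      have h := hc j (Finsupp.single (Function.update x j (x j - 1)) 1)
        (by rw [toL2_single_one]; exact ih _ hy)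
      rw [creation_single, Function.update_self, Function.update_idem, Nat.sub_add_cancel hj,
        Function.update_eq_self, toL2_single] at h
      refine (M.smul_mem_iff ?_).mp h
      have : √(((x j - 1 : ℕ) : ℝ) + 1) ≠ 0 := (Real.sqrt_pos.mpr (by positivity)).ne'
      exact_mod_cast this
  rw [eq_top_iff]
  intro f _
  have hd : Dense (M : Set (L2 (ι → ℕ))) := by
    refine denseRange_toL2.mono ?_
    rintro _ ⟨φ, rfl⟩
    rw [toL2, Finsupp.linearCombination_apply]
    exact M.sum_mem fun x _ => M.smul_mem _ (hket _ x rfl)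
  have := hd.closure_eq
  rw [hM.closure_eq] at this
  rw [← SetLike.mem_coe, this]
  trivial

lemma span_weyl_vacuum_topologicalClosure :
    (Submodule.span ℂ (Set.range fun ξ : ι × Fin 2 → ℝ => weyl ξ (ket 0))).topologicalClosure =
      ⊤ := by
  refine eq_top_of_weyl_invariant (Submodule.isClosed_topologicalClosure _) ?_ fun ξ f hf => ?_
  · refine Submodule.le_topologicalClosure _ (Submodule.subset_span ⟨0, ?_⟩)
    simp only [weyl_zero, one_apply_eq_self]
  · refine map_mem_closure (weyl ξ).continuous hf fun g hg => ?_
    refine Submodule.span_induction ?_ ?_ ?_ ?_ hg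
    · rintro _ ⟨η, rfl⟩
      obtain ⟨z, hz⟩ := weyl_comp_weyl ξ η
      have : weyl ξ (weyl η (ket 0)) = z • weyl (ξ + η) (ket 0) :=
        congrArg (fun T : L2 (ι → ℕ) →L[ℂ] L2 (ι → ℕ) => T (ket 0)) hz
      simp only [this]
      exact Submodule.smul_mem _ _ (Submodule.subset_span ⟨_, rfl⟩)
    · rw [map_zero]; exact Submodule.zero_mem _
    · intro x y _ _ hx hy
      rw [map_add]; exact Submodule.add_mem _ hx hy
    · intro a x _ hx
      rw [map_smul]; exact Submodule.smul_mem _ _ hx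

lemma clm_ext_coherent {E : Type*} [NormedAddCommGroup E] [NormedSpace ℂ E]
    {A B : L2 (ι → ℕ) →L[ℂ] E} (h : ∀ ξ, A (weyl ξ (ket 0)) = B (weyl ξ (ket 0))) : A = B := by
  refine ContinuousLinearMap.ext_on (s := Set.range fun ξ : ι × Fin 2 → ℝ => weyl ξ (ket 0)) ?_ ?_
  · rw [Submodule.dense_iff_topologicalClosure_eq_top]
    exact span_weyl_vacuum_topologicalClosure
  · rintro _ ⟨ξ, rfl⟩
    exact h ξ

variable {κ κ' : Type} {ρ σ : L2 (ι → ℕ) →L[ℂ] L2 (ι → ℕ)} {v : κ → L2 (ι → ℕ)}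
  {w : κ' → L2 (ι → ℕ)}

lemma ensembleMean_eq_of_mem_weylSpan (hv : IsEnsemble v ρ) (hw : IsEnsemble w σ)
    (h : ∀ ξ, ensembleMean v (weyl ξ) = ensembleMean w (weyl ξ))
    {B : L2 (ι → ℕ) →L[ℂ] L2 (ι → ℕ)} (hB : B ∈ weylSpan ι) :
    ensembleMean v B = ensembleMean w B := by
  refine Submodule.span_induction ?_ ?_ ?_ ?_ hB
  · rintro _ ⟨ξ, rfl⟩
    exact h ξ
  · simp [ensembleMean]
  · intro x y _ _ hx hy
    rw [hv.ensembleMean_add, hw.ensembleMean_add, hx, hy]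
  · intro a x _ hx
    rw [ensembleMean_smul, ensembleMean_smul, hx]

/-- The characteristic function `ξ ↦ tr(ρ e^{i ξ·R})` determines `ρ`. -/
theorem IsEnsemble.ext_weyl [Nonempty ι] (hv : IsEnsemble v ρ) (hw : IsEnsemble w σ)
    (h : ∀ ξ, ensembleMean v (weyl ξ) = ensembleMean w (weyl ξ)) : ρ = σ := by
  have hvac : ∀ x : ι → ℕ, x ≠ 0 → 0 < photonNumber x := by
    intro x hx
    obtain ⟨i, hi⟩ := Function.ne_iff.mp hx
    exact (Nat.pos_of_ne_zero hi).trans_le (le_photonNumber x i)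
  -- `D m` is the semigroup exp(-τ ∑ R²) at τ = m + 1; the shift keeps τ positive, as the product
  -- formula requires.
  choose D hD1 hD using fun m : ℕ => exists_diagonal
    (fun x : ι → ℕ => Real.exp (-(((m : ℝ) + 1) * oscillatorEnergy x))) (fun _ => (Real.exp_pos _).le)
    (fun x => Real.exp_le_one_iff.mpr (by have := oscillatorEnergy_nonneg x; nlinarith))
  have hDmean : ∀ (m : ℕ) (ξ η : ι × Fin 2 → ℝ),
      ensembleMean v (weyl ξ * D m * weyl η) = ensembleMean w (weyl ξ * D m * weyl η) := by
    intro m ξ η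
    refine ensembleMean_eq_of_tendsto_ket hv hw
      (A := fun n : ℕ => weylAverage ι √(2 * Fintype.card (ι × Fin 2) * (m + 1 : ℝ) / n) ^ n)
      (fun n => ?_) (fun x => ?_) fun n => ?_
    · rcases Nat.eq_zero_or_pos n with h | h
      · subst h; rw [pow_zero]; exact ContinuousLinearMap.norm_id_le
      · exact (norm_pow_le' _ h).trans (pow_le_one₀ (norm_nonneg _) (norm_weylAverage_le _))
    · rw [hD]
      exact tendsto_weylAverage_pow (by positivity) x
    · exact ensembleMean_eq_of_mem_weylSpan hv hw h (mul_mem_weylSpan (mul_mem_weylSpan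
        (weyl_mem _) (pow_mem_weylSpan (weylAverage_mem _) _)) (weyl_mem _))
  -- Removing the zero-point energy rescales `D m` so that the vacuum eigenvalue is 1 and every
  -- other eigenvalue tends to 0. The norms stay at most 1, so the strong limit is the vacuum
  -- projection.
  choose D' hD1' hD' using fun m : ℕ => exists_diagonal
    (fun x : ι → ℕ => Real.exp (-(((m : ℝ) + 1) * (2 * photonNumber x))))
    (fun _ => (Real.exp_pos _).le)
    (fun x => Real.exp_le_one_iff.mpr (neg_nonpos.mpr (by positivity)))
  have hDD' : ∀ m, D' m = ((Real.exp ((m + 1 : ℝ) * Fintype.card ι) : ℝ) : ℂ) • D m := by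
    intro m
    refine clm_ext_ket fun x => ?_
    rw [hD', _root_.smul_apply, hD, smul_smul, ← Complex.ofReal_mul, ← Real.exp_add,
      oscillatorEnergy]
    congr 4
    ring
  have hmean : ∀ ξ η : ι × Fin 2 → ℝ,
      ensembleMean v (weyl ξ * InnerProductSpace.rankOne ℂ (ket 0) (ket 0) * weyl η) =
        ensembleMean w (weyl ξ * InnerProductSpace.rankOne ℂ (ket 0) (ket 0) * weyl η) := by
    intro ξ η
    refine ensembleMean_eq_of_tendsto_ket hv hw hD1' (fun x => ?_) fun m => ?_
    · rw [InnerProductSpace.rankOne_apply]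
      simp only [hD']
      by_cases hx : x = 0
      · subst hx
        have : photonNumber (0 : ι → ℕ) = 0 := by simp [photonNumber]
        simp [this, inner_self_eq_norm_sq_to_K, norm_ket]
      · rw [orthonormal_ket.2 (Ne.symm hx), zero_smul]
        have hpos : (0 : ℝ) < 2 * photonNumber x := by
          have := hvac x hx
          positivity
        have h1 : Filter.Tendsto (fun m : ℕ => ((m : ℝ) + 1) * (2 * photonNumber x)) Filter.atTop
            Filter.atTop :=
          (Filter.tendsto_atTop_add_const_right _ 1 tendsto_natCast_atTop_atTop).atTop_mul_const hpos
        have h2 := (Complex.continuous_ofReal.tendsto 0).comp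
          (Real.tendsto_exp_neg_atTop_nhds_zero.comp h1)
        have h3 := h2.smul_const (ket x : L2 (ι → ℕ))
        rw [Complex.ofReal_zero, zero_smul] at h3
        exact h3
    · rw [hDD', mul_smul_comm, smul_mul_assoc, ensembleMean_smul, ensembleMean_smul, hDmean]
  -- Expectations of these rank-one operators are the matrix elements of the state between coherent
  -- vectors.
  have hrank : ∀ ξ η : ι × Fin 2 → ℝ,
      weyl ξ * InnerProductSpace.rankOne ℂ (ket 0) (ket 0) * weyl (-η) =
        InnerProductSpace.rankOne ℂ (weyl ξ (ket 0)) (weyl η (ket 0)) := by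
    intro ξ η
    ext1 f
    rw [mul_apply_eq_comp, mul_apply_eq_comp, InnerProductSpace.rankOne_apply,
      InnerProductSpace.rankOne_apply, ← adjoint_weyl, ContinuousLinearMap.adjoint_inner_right,
      map_smul]
  refine clm_ext_coherent fun ξ => ?_
  rw [← innerSL_inj (𝕜 := ℂ)]
  have hinner : ∀ η : ι × Fin 2 → ℝ, ⟪weyl η (ket 0), ρ (weyl ξ (ket 0))⟫_ℂ =
      ⟪weyl η (ket 0), σ (weyl ξ (ket 0))⟫_ℂ := fun η => by
    have := hmean ξ (-η)
    rwa [hrank, hv.ensembleMean_rankOne, hw.ensembleMean_rankOne] at this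
  refine clm_ext_coherent fun η => ?_
  rw [innerSL_apply_apply, innerSL_apply_apply, ← inner_conj_symm, hinner, inner_conj_symm]

/-- Gaussian states are determined by their mean vector and covariance matrix. -/
theorem IsGaussianState.ext [Nonempty ι] {μ : ι × Fin 2 → ℝ}
    {Γ : Matrix (ι × Fin 2) (ι × Fin 2) ℝ} (hρ : IsGaussianState ρ μ Γ)
    (hσ : IsGaussianState σ μ Γ) : ρ = σ := by
  obtain ⟨v, hv⟩ := exists_isEnsemble hρ.state.1 hρ.state.2
  obtain ⟨w, hw⟩ := exists_isEnsemble hσ.state.1 hσ.state.2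
  refine hv.ext_weyl hw fun ξ => ?_
  rw [HasSum.unique (hv.hasTrace_comp (weyl ξ)) (hρ.charFun ξ),
    HasSum.unique (hw.hasTrace_comp (weyl ξ)) (hσ.charFun ξ)]

end

/-! ### Partial traces -/

lemma relabel_ket {S S' : Type} (f : S ↪ S') (x : S) : relabel f (ket x) = ket (f x) := by
  classical
  have h := OrthogonalFamily.linearIsometry_apply_single (𝕜 := ℂ)
    (orthonormal_ket.comp f f.injective).orthogonalFamily (i := x) (1 : ℂ)
  rw [LinearIsometry.toSpanSingleton_apply, one_smul] at h
  convert h using 2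
  · simp only [ket]
    congr!
  · rfl

lemma inner_relabel_relabel {S S' : Type} (f : S ↪ S') (φ ψ : L2 S) :
    ⟪relabel f φ, relabel f ψ⟫_ℂ = ⟪φ, ψ⟫_ℂ := LinearIsometry.inner_map_map _ _ _

lemma relabel_apply {S S' : Type} (f : S ↪ S') (φ : L2 S) (x : S) : relabel f φ (f x) = φ x := by
  rw [← inner_ket_left, ← relabel_ket, inner_relabel_relabel, inner_ket_left]

lemma relabel_apply_of_notMem {S S' : Type} (f : S ↪ S') (φ : L2 S) {y : S'}
    (hy : y ∉ Set.range f) : relabel f φ y = 0 := by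
  have : innerSL ℂ (ket y) ∘L relabel f = 0 := clm_ext_ket fun x => by
    rw [ContinuousLinearMap.comp_apply, relabel_ket, innerSL_apply_apply,
      orthonormal_ket.2 (fun h => hy ⟨x, h.symm⟩)]
    rfl
  rw [← inner_ket_left]
  exact congrArg (fun T : L2 S →L[ℂ] ℂ => T φ) this

lemma adjoint_relabel_apply {S S' : Type} (f : S ↪ S') (φ : L2 S') (x : S) :
    ContinuousLinearMap.adjoint (relabel f) φ x = φ (f x) := by
  rw [← inner_ket_left, ContinuousLinearMap.adjoint_inner_right, relabel_ket, inner_ket_left]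

lemma relabel_toL2 {S S' : Type} (f : S ↪ S') (φ : Core S) :
    relabel f (toL2 φ) = toL2 (Finsupp.lmapDomain ℂ ℂ f φ) := by
  induction φ using Finsupp.induction_linear with
  | zero => simp
  | add f g hf hg => simp only [map_add, hf, hg]
  | single x a =>
    rw [toL2_single, map_smul, relabel_ket, Finsupp.lmapDomain_apply, Finsupp.mapDomain_single,
      toL2_single]

/-- The embedding of a slice of a product decomposition. -/
def slice {S Z S' : Type} (e : S × Z ≃ S') (z : Z) : S ↪ S' :=
  ⟨fun s => e (s, z), fun s s' h => by simpa using h⟩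

/-- `ρ'` is the partial trace `∑_z (1 ⊗ ⟨z|) ρ (1 ⊗ |z⟩)`, in the weak sense. -/
def IsPartialTrace {S Z S' : Type} (e : S × Z ≃ S') (ρ : L2 S' →L[ℂ] L2 S')
    (ρ' : L2 S →L[ℂ] L2 S) : Prop :=
  ∀ φ ψ, HasSum (fun z => ⟪relabel (slice e z) φ, ρ (relabel (slice e z) ψ)⟫_ℂ) ⟪φ, ρ' ψ⟫_ℂ

section PartialTrace

variable {S Z S' : Type} {e : S × Z ≃ S'} {ρ : L2 S' →L[ℂ] L2 S'} {ρ' : L2 S →L[ℂ] L2 S}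

/-- The sum over S' is regrouped along S × Z, and its inner sums over z are the partial trace
because each vector stays in the slice of its index. Stated for arbitrary vectors so as to cover
traces with bounded operators and moments of unbounded ones. -/
lemma IsPartialTrace.hasSum_inner (h : IsPartialTrace e ρ ρ') {a : S' → L2 S'} {a' : S → L2 S}
    (ha : ∀ z x, a (e (x, z)) = relabel (slice e z) (a' x)) {c : ℂ}
    (hc : HasSum (fun y => ⟪ket y, ρ (a y)⟫_ℂ) c) :
    HasSum (fun x => ⟪ket x, ρ' (a' x)⟫_ℂ) c := by
  refine (e.hasSum_iff.mpr hc).prod_fiberwise fun x => ?_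
  refine (h (ket x) (a' x)).congr_fun fun z => ?_
  rw [Function.comp_apply, ha, relabel_ket]
  rfl

lemma IsPartialTrace.hasTrace_comp (h : IsPartialTrace e ρ ρ') {B : L2 S' →L[ℂ] L2 S'}
    {B' : L2 S →L[ℂ] L2 S} (hB : ∀ z, B ∘L relabel (slice e z) = relabel (slice e z) ∘L B') {c : ℂ}
    (hc : HasTrace (ρ ∘L B) c) : HasTrace (ρ' ∘L B') c := by
  refine h.hasSum_inner (a := fun y => B (ket y)) (a' := fun x => B' (ket x)) (fun z x => ?_) hc
  have := congrArg (fun T : L2 S →L[ℂ] L2 S' => T (ket x)) (hB z)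
  simp only [ContinuousLinearMap.comp_apply, relabel_ket] at this
  exact this

lemma IsPartialTrace.hasMoment (h : IsPartialTrace e ρ ρ') {A : Module.End ℂ (Core S')}
    {A' : Module.End ℂ (Core S)} (hA : ∀ z, A ∘ₗ Finsupp.lmapDomain ℂ ℂ (slice e z) =
      Finsupp.lmapDomain ℂ ℂ (slice e z) ∘ₗ A') {c : ℂ} (hc : HasMoment ρ A c) :
    HasMoment ρ' A' c := by
  refine h.hasSum_inner (a := fun y => toL2 (A (Finsupp.single y 1)))
    (a' := fun x => toL2 (A' (Finsupp.single x 1))) (fun z x => ?_) hc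
  have := LinearMap.congr_fun (hA z) (Finsupp.single x 1)
  rw [LinearMap.comp_apply, LinearMap.comp_apply, Finsupp.lmapDomain_apply,
    Finsupp.mapDomain_single] at this
  rw [relabel_toL2, ← this]
  rfl

lemma isPositive_of_inner {S : Type} {T : L2 S →L[ℂ] L2 S}
    (h : ∀ f, 0 ≤ ⟪f, T f⟫_ℂ) : T.IsPositive := by
  rw [ContinuousLinearMap.isPositive_iff_complex]
  intro f
  have h1 := Complex.nonneg_iff.mp (h f)
  have e : ⟪T f, f⟫_ℂ = ⟪f, T f⟫_ℂ := by
    rw [← inner_conj_symm, Complex.conj_eq_iff_im, ← h1.2]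
  rw [e]
  exact ⟨Complex.ext rfl h1.2, h1.1⟩

lemma IsPartialTrace.isPositive (h : IsPartialTrace e ρ ρ') (hρ : ρ.IsPositive) :
    ρ'.IsPositive := by
  refine isPositive_of_inner fun f => ?_
  have h1 := fun z => Complex.nonneg_iff.mp (hρ.inner_nonneg_right (relabel (slice e z) f))
  refine Complex.nonneg_iff.mpr ⟨?_, ?_⟩
  · exact HasSum.nonneg (fun z => (h1 z).1) ((h f f).mapL Complex.reCLM)
  · refine (((h f f).mapL Complex.imCLM).unique ?_).symm
    exact hasSum_zero.congr_fun fun z => (h1 z).2.symm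

lemma IsPartialTrace.isDensityOperator (h : IsPartialTrace e ρ ρ') (hρ : IsDensityOperator ρ) :
    IsDensityOperator ρ' :=
  ⟨h.isPositive hρ.1, h.hasTrace_comp (B := 1) (B' := 1) (fun _ => rfl) hρ.2⟩

/-- Each compression to a slice is positive, so its norm is at most its trace, and these traces add
up to tr ρ. Hence the `tsum` in `reducedModes` has its intended value rather than the default 0. -/
theorem summable_partialTrace (hρ : ρ.IsPositive) {c : ℂ} (hc : HasTrace ρ c) :
    Summable fun z => ContinuousLinearMap.adjoint (relabel (slice e z)) ∘L ρ ∘L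
      relabel (slice e z) := by
  have h1 : Summable fun p : Z × S => ⟪ket (e (p.2, p.1)), ρ (ket (e (p.2, p.1)))⟫_ℂ :=
    (((Equiv.prodComm Z S).trans e).hasSum_iff.mpr hc).summable
  have h2 : ∀ z, HasTrace (ContinuousLinearMap.adjoint (relabel (slice e z)) ∘L ρ ∘L
      relabel (slice e z)) (∑' x, ⟪ket (e (x, z)), ρ (ket (e (x, z)))⟫_ℂ) := fun z => by
    refine (h1.prod_factor z).hasSum.congr_fun fun x => ?_
    rw [ContinuousLinearMap.comp_apply, ContinuousLinearMap.adjoint_inner_right,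
      ContinuousLinearMap.comp_apply, relabel_ket]
    rfl
  refine Summable.of_norm_bounded (h1.prod.mapL Complex.reCLM) fun z => ?_
  exact norm_le_of_hasTrace (hρ.adjoint_conj _) (h2 z)

lemma isPartialTrace_tsum (hρ : ρ.IsPositive) {c : ℂ} (hc : HasTrace ρ c) :
    IsPartialTrace e ρ (∑' z, ContinuousLinearMap.adjoint (relabel (slice e z)) ∘L ρ ∘L
      relabel (slice e z)) := by
  intro φ ψ
  have h := (summable_partialTrace (e := e) hρ hc).hasSum
  have h1 := (h.mapL (ContinuousLinearMap.apply ℂ (L2 S) ψ)).mapL (innerSL ℂ φ)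
  refine h1.congr_fun fun z => ?_
  simp only [ContinuousLinearMap.apply_apply, innerSL_apply_apply, ContinuousLinearMap.comp_apply,
    ContinuousLinearMap.adjoint_inner_right]

end PartialTrace

/-! ### Reduction of Gaussian states -/

section Merge

variable {n : ℕ} {j k : Fin n}

lemma injective_pair (hjk : j ≠ k) : Function.Injective ![j, k] := by
  intro a b h
  fin_cases a <;> fin_cases b <;> simp_all

lemma merge_pair {β : Type} (hjk : j ≠ k) (x : Fin 2 → β) (z : {i : Fin n // i ≠ j ∧ i ≠ k} → β)
    (a : Fin 2) : merge j k x z (![j, k] a) = x a := by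
  fin_cases a <;> simp [merge, hjk.symm]

lemma merge_rest {β : Type} (x : Fin 2 → β) (z : {i : Fin n // i ≠ j ∧ i ≠ k} → β)
    (i : {i : Fin n // i ≠ j ∧ i ≠ k}) : merge j k x z i = z i := by
  simp [merge, i.2.1, i.2.2]

lemma exists_pair_eq {i : Fin n} (h : ¬(i ≠ j ∧ i ≠ k)) : ∃ a, ![j, k] a = i := by
  by_cases hj : i = j
  · exact ⟨0, by simp [hj]⟩
  · exact ⟨1, by simpa [hj, eq_comm] using h⟩

/-- Splitting a configuration into its entries at `j`, `k` and the rest. -/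
def mergeEquiv {β : Type} (hjk : j ≠ k) :
    (Fin 2 → β) × ({i : Fin n // i ≠ j ∧ i ≠ k} → β) ≃ (Fin n → β) where
  toFun p := merge j k p.1 p.2
  invFun y := (fun a => y (![j, k] a), fun i => y i)
  left_inv p := Prod.ext (funext fun a => merge_pair hjk _ _ a) (funext fun i => merge_rest _ _ i)
  right_inv y := by
    ext i
    by_cases h : i ≠ j ∧ i ≠ k
    · exact merge_rest _ _ ⟨i, h⟩
    · obtain ⟨a, rfl⟩ := exists_pair_eq h
      exact merge_pair hjk _ _ a

lemma merge_update {β : Type} (hjk : j ≠ k) (x : Fin 2 → β)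
    (z : {i : Fin n // i ≠ j ∧ i ≠ k} → β) (a : Fin 2) (b : β) :
    merge j k (Function.update x a b) z = Function.update (merge j k x z) (![j, k] a) b := by
  ext i
  by_cases h : i ≠ j ∧ i ≠ k
  · have : i ≠ ![j, k] a := by
      rintro rfl
      fin_cases a <;> simp at h
    rw [Function.update_of_ne this]
    exact (merge_rest _ _ ⟨i, h⟩).trans (merge_rest x z ⟨i, h⟩).symm
  · obtain ⟨c, rfl⟩ := exists_pair_eq h
    rw [merge_pair hjk]
    by_cases hc : c = a
    · rw [hc, Function.update_self, Function.update_self]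
    · rw [Function.update_of_ne hc, Function.update_of_ne ((injective_pair hjk).ne hc),
        merge_pair hjk]

/-- The slices of `mergeEquiv` are by definition the embeddings used in `reducedModes`. -/
lemma isPartialTrace_reducedModes (hjk : j ≠ k) {ρ : L2 (Fin n → ℕ) →L[ℂ] L2 (Fin n → ℕ)}
    (hρ : IsDensityOperator ρ) : IsPartialTrace (mergeEquiv hjk) ρ (reducedModes hjk ρ) :=
  isPartialTrace_tsum hρ.1 hρ.2

lemma annihilation_comp_slice (hjk : j ≠ k) (z : {i : Fin n // i ≠ j ∧ i ≠ k} → ℕ) (a : Fin 2) :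
    annihilation (![j, k] a) ∘ₗ Finsupp.lmapDomain ℂ ℂ (slice (mergeEquiv hjk) z) =
      Finsupp.lmapDomain ℂ ℂ (slice (mergeEquiv hjk) z) ∘ₗ annihilation a := by
  refine core_end_ext fun x => ?_
  rw [LinearMap.comp_apply, LinearMap.comp_apply, annihilation_single, Finsupp.lmapDomain_apply,
    Finsupp.lmapDomain_apply, Finsupp.mapDomain_single, Finsupp.mapDomain_single,
    annihilation_single]
  change Finsupp.single (Function.update (merge j k x z) _ (merge j k x z (![j, k] a) - 1))
    ((√((merge j k x z (![j, k] a) : ℕ) : ℝ) : ℝ) : ℂ) =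
    Finsupp.single (merge j k (Function.update x a (x a - 1)) z) _
  rw [merge_update hjk, merge_pair hjk]

lemma creation_comp_slice (hjk : j ≠ k) (z : {i : Fin n // i ≠ j ∧ i ≠ k} → ℕ) (a : Fin 2) :
    creation (![j, k] a) ∘ₗ Finsupp.lmapDomain ℂ ℂ (slice (mergeEquiv hjk) z) =
      Finsupp.lmapDomain ℂ ℂ (slice (mergeEquiv hjk) z) ∘ₗ creation a := by
  refine core_end_ext fun x => ?_
  rw [LinearMap.comp_apply, LinearMap.comp_apply, creation_single, Finsupp.lmapDomain_apply,
    Finsupp.lmapDomain_apply, Finsupp.mapDomain_single, Finsupp.mapDomain_single,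
    creation_single]
  change Finsupp.single (Function.update (merge j k x z) _ (merge j k x z (![j, k] a) + 1))
    ((√(((merge j k x z (![j, k] a) : ℕ) : ℝ) + 1) : ℝ) : ℂ) =
    Finsupp.single (merge j k (Function.update x a (x a + 1)) z) _
  rw [merge_update hjk, merge_pair hjk]

lemma quadrature_comp_slice (hjk : j ≠ k) (z : {i : Fin n // i ≠ j ∧ i ≠ k} → ℕ)
    (a : Fin 2 × Fin 2) :
    quadrature (![j, k] a.1, a.2) ∘ₗ Finsupp.lmapDomain ℂ ℂ (slice (mergeEquiv hjk) z) =
      Finsupp.lmapDomain ℂ ℂ (slice (mergeEquiv hjk) z) ∘ₗ quadrature a := by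
  simp only [quadrature]
  split_ifs
  · rw [LinearMap.smul_comp, LinearMap.add_comp, annihilation_comp_slice, creation_comp_slice,
      LinearMap.comp_smul, LinearMap.comp_add]
  · rw [LinearMap.smul_comp, LinearMap.sub_comp, annihilation_comp_slice, creation_comp_slice,
      LinearMap.comp_smul, LinearMap.comp_sub]

/-- The index of a quadrature of the modes `j`, `k` among those of all modes. -/
def pairIndex (j k : Fin n) (a : Fin 2 × Fin 2) : Fin n × Fin 2 := (![j, k] a.1, a.2)

lemma injective_pairIndex (hjk : j ≠ k) : Function.Injective (pairIndex j k) := by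
  rintro ⟨a, b⟩ ⟨c, d⟩ h
  simp only [pairIndex, Prod.mk.injEq] at h
  rw [injective_pair hjk h.1, h.2]

/-- Indices outside the range contribute `F 0 b = 0`. The general `F` serves Weyl generators, the
quadratic and linear forms of the characteristic function, and Hamiltonians with truncated
couplings. -/
lemma sum_extend {α β R M : Type*} [Fintype α] [Fintype β] [Zero R] [AddCommMonoid M]
    {f : α → β} (hf : Function.Injective f) (ξ : α → R) {F : R → β → M} (hF : ∀ b, F 0 b = 0) :
    ∑ b, F (Function.extend f ξ 0 b) b = ∑ a, F (ξ a) (f a) := by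
  classical
  rw [← Finset.sum_subset (Finset.subset_univ (Finset.univ.image f)),
    Finset.sum_image fun a _ b _ hab => hf hab]
  · simp only [hf.extend_apply]
  · intro b _ hb
    rw [Function.extend_apply' _ _ _ fun ⟨a, ha⟩ => hb (by simp [← ha]), Pi.zero_apply, hF]

lemma weyl_comp_slice (hjk : j ≠ k) (z : {i : Fin n // i ≠ j ∧ i ≠ k} → ℕ)
    (ξ : Fin 2 × Fin 2 → ℝ) :
    weyl (Function.extend (pairIndex j k) ξ 0) ∘L relabel (slice (mergeEquiv hjk) z) =
      relabel (slice (mergeEquiv hjk) z) ∘L weyl ξ := by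
  refine ((isExpOf_weyl ξ).comp_eq (isExpOf_weyl _) (relabel_toL2 _) ?_).symm
  have h : weylGen (Function.extend (pairIndex j k) ξ 0) =
      Complex.I • ∑ a, (ξ a : ℂ) • quadrature (pairIndex j k a) := by
    rw [weylGen, sum_extend (injective_pairIndex hjk) ξ (F := fun r a => (r : ℂ) • quadrature a)
      fun a => by rw [Complex.ofReal_zero, zero_smul]]
  rw [h, weylGen]
  refine LinearMap.ext fun φ => ?_
  simp only [LinearMap.comp_apply, LinearMap.smul_apply, LinearMap.sum_apply, map_smul, map_sum]
  congr 1
  refine Finset.sum_congr rfl fun a _ => ?_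
  congr 1
  exact (LinearMap.congr_fun (quadrature_comp_slice hjk z a) φ).symm

/-- Every clause transfers because quadratures and Weyl operators of the modes j, k respect slices.
The characteristic function at ξ is that of the full state at ξ extended by zero, where the Gaussian
only sees the entries for j and k. -/
theorem IsGaussianState.reducedModes (hjk : j ≠ k) {ρ : L2 (Fin n → ℕ) →L[ℂ] L2 (Fin n → ℕ)}
    {μ : Fin n × Fin 2 → ℝ} {Γ : Matrix (Fin n × Fin 2) (Fin n × Fin 2) ℝ}
    (h : IsGaussianState ρ μ Γ) :
    IsGaussianState (reducedModes hjk ρ) (pairMean j k μ) (pairCovariance j k Γ) := by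
  have hpt := isPartialTrace_reducedModes hjk h.state
  refine ⟨hpt.isDensityOperator h.state, fun a => ?_, fun a b => ?_, fun ξ => ?_⟩
  · exact hpt.hasMoment (fun z => quadrature_comp_slice hjk z a) (h.mean _)
  · refine hpt.hasMoment (fun z => ?_) (h.covariance (pairIndex j k a) (pairIndex j k b))
    have hq : ∀ (a : Fin 2 × Fin 2) (φ : Core (Fin 2 → ℕ)),
        (quadrature (pairIndex j k a) - (μ (pairIndex j k a) : ℂ) • 1)
          (Finsupp.lmapDomain ℂ ℂ (slice (mergeEquiv hjk) z) φ) =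
        Finsupp.lmapDomain ℂ ℂ (slice (mergeEquiv hjk) z)
          ((quadrature a - (pairMean j k μ a : ℂ) • 1) φ) := fun a φ => by
      have := LinearMap.congr_fun (quadrature_comp_slice hjk z a) φ
      rw [LinearMap.comp_apply, LinearMap.comp_apply] at this
      simp only [LinearMap.sub_apply, LinearMap.smul_apply, Module.End.one_apply, map_sub, map_smul,
        ← this]
      rfl
    refine LinearMap.ext fun φ => ?_
    simp only [LinearMap.comp_apply, LinearMap.smul_apply, LinearMap.add_apply,
      Module.End.mul_apply, map_smul, map_add, hq]
  · have h1 := hpt.hasTrace_comp (fun z => weyl_comp_slice hjk z ξ) (h.charFun _)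
    convert h1 using 1
    have e1 : Function.extend (pairIndex j k) ξ 0 ⬝ᵥ μ = ξ ⬝ᵥ pairMean j k μ :=
      sum_extend (injective_pairIndex hjk) ξ (F := fun r a => r * μ a) fun _ => zero_mul _
    have e2 : Function.extend (pairIndex j k) ξ 0 ⬝ᵥ
        (Γ *ᵥ Function.extend (pairIndex j k) ξ 0) = ξ ⬝ᵥ (pairCovariance j k Γ *ᵥ ξ) := by
      refine (sum_extend (injective_pairIndex hjk) ξ (F := fun r a => r *
        (Γ *ᵥ Function.extend (pairIndex j k) ξ 0) a) fun _ => zero_mul _).trans ?_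
      refine Finset.sum_congr rfl fun a _ => congrArg (ξ a * ·) ?_
      exact sum_extend (injective_pairIndex hjk) ξ (F := fun r b => Γ (pairIndex j k a) b * r)
        fun _ => mul_zero _
    rw [e1, e2]

end Merge

/-! ### Tensor products of operators on the modes and matrices on the qubits -/

lemma hasSum_mul_complex {α β : Type*} {f : α → ℂ} {g : β → ℂ} {s t : ℂ} (hf : HasSum f s)
    (hg : HasSum g t) : HasSum (fun p : α × β => f p.1 * g p.2) (s * t) :=
  hf.mul hg (summable_mul_of_summable_norm hf.summable.norm hg.summable.norm)

section TensorOp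

variable {S T : Type}

/-- The component `(1 ⊗ ⟨b|) f`. -/
def component (b : T) : L2 (S × T) →L[ℂ] L2 S :=
  ContinuousLinearMap.adjoint (relabel (Function.Embedding.sectL S b))

lemma component_apply (b : T) (f : L2 (S × T)) (x : S) : component b f x = f (x, b) :=
  adjoint_relabel_apply _ _ _

lemma inner_tensorOp [Fintype T] (A : L2 S →L[ℂ] L2 S) (M : Matrix T T ℂ) (φ ψ : L2 (S × T)) :
    ⟪φ, tensorOp A M ψ⟫_ℂ = ∑ a, ∑ b, M a b * ⟪component a φ, A (component b ψ)⟫_ℂ := by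
  simp only [tensorOp, _root_.sum_apply, _root_.smul_apply, inner_sum, inner_smul_right,
    ContinuousLinearMap.comp_apply, component, ContinuousLinearMap.adjoint_inner_left]

lemma component_ket [DecidableEq T] (b : T) (p : S × T) :
    component b (ket p) = if p.2 = b then ket p.1 else 0 := by
  classical
  ext x
  rw [component_apply]
  obtain ⟨y, c⟩ := p
  by_cases h : c = b
  · subst h
    simp [ket, lp.single_apply, Pi.single_apply]
  · simp [ket, lp.single_apply, h, Ne.symm h]

/-- The product of two decompositions. -/
def prodDecomposition {S Z S' T W T' : Type} (e : S × Z ≃ S') (e' : T × W ≃ T') :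
    (S × T) × (Z × W) ≃ S' × T' := (Equiv.prodProdProdComm S T Z W).trans (e.prodCongr e')

/-- A component of a slice vector vanishes unless the traced-out part of its qubit configuration
matches the slice; this makes the block sum of `tensorOp` diagonal in that part. -/
lemma component_slice {Z S' W T' : Type} [DecidableEq W]
    (e : S × Z ≃ S')
    (e' : T × W ≃ T') (p : Z × W) (q : T × W) (φ : L2 (S × T)) :
    component (e' q) (relabel (slice (prodDecomposition e e') p) φ) =
      if q.2 = p.2 then relabel (slice e p.1) (component q.1 φ) else 0 := by
  classical
  ext y
  obtain ⟨⟨x, z⟩, rfl⟩ := e.surjective y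
  obtain ⟨a, c⟩ := q
  rw [component_apply]
  by_cases h : c = p.2 ∧ z = p.1
  · obtain ⟨rfl, rfl⟩ := h
    rw [if_pos rfl]
    exact (relabel_apply (slice (prodDecomposition e e') p) φ (x, a)).trans
      ((component_apply a φ x).symm.trans (relabel_apply (slice e p.1) _ x).symm)
  · rw [relabel_apply_of_notMem]
    · split_ifs with hc
      · rw [relabel_apply_of_notMem]
        rintro ⟨x', hx'⟩
        have := e.injective hx'
        simp only [Prod.mk.injEq] at this
        exact h ⟨hc, this.2.symm⟩
      · rfl
    · rintro ⟨⟨x', a'⟩, hx'⟩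
      have h1 := (prodDecomposition e e').injective
        (a₁ := ((x', a'), p)) (a₂ := ((x, a), (z, c))) hx'
      simp only [Prod.mk.injEq] at h1
      obtain ⟨_, rfl⟩ := h1
      exact h ⟨rfl, rfl⟩

variable [Fintype T]

lemma tensorOp_ket (A : L2 S →L[ℂ] L2 S) (M : Matrix T T ℂ) (p : S × T) :
    tensorOp A M (ket p) =
      ∑ a, M a p.2 • relabel (Function.Embedding.sectL S a) (A (ket p.1)) := by
  classical
  simp only [tensorOp, _root_.sum_apply, _root_.smul_apply, ContinuousLinearMap.comp_apply]
  refine Finset.sum_congr rfl fun a _ => ?_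
  rw [Finset.sum_eq_single p.2]
  · rw [← component, component_ket, if_pos rfl]
  · intro b _ hb
    rw [← component, component_ket, if_neg hb.symm, map_zero, map_zero, smul_zero]
  · simp

open scoped MatrixOrder in
lemma exists_eq_star_mul_self {M : Matrix T T ℂ} (hM : M.PosSemidef) :
    ∃ K : Matrix T T ℂ, M = star K * K := by
  classical
  exact CStarAlgebra.nonneg_iff_eq_star_mul_self.mp hM.nonneg

/-- With ρ = s² and M = K* K, the quadratic form is ∑_c ‖∑_a K_{ca} s f_a‖², where f_a are the
components of f. -/
lemma isPositive_tensorOp {ρ : L2 S →L[ℂ] L2 S} {M : Matrix T T ℂ} (hρ : ρ.IsPositive)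
    (hM : M.PosSemidef) : (tensorOp ρ M).IsPositive := by
  obtain ⟨s, hs, hss⟩ := exists_sqrt hρ
  obtain ⟨K, rfl⟩ := exists_eq_star_mul_self hM
  refine isPositive_of_inner fun f => ?_
  have e : ⟪f, tensorOp ρ (star K * K) f⟫_ℂ =
      ∑ c, ⟪∑ a, K c a • s (component a f), ∑ a, K c a • s (component a f)⟫_ℂ := by
    simp only [inner_tensorOp, Matrix.mul_apply, Finset.sum_mul]
    rw [Finset.sum_comm_cycle]
    refine Finset.sum_congr rfl fun c _ => ?_
    rw [sum_inner]
    refine Finset.sum_congr rfl fun a _ => ?_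
    rw [inner_sum]
    refine Finset.sum_congr rfl fun b _ => ?_
    rw [inner_smul_left, inner_smul_right, hs.inner_left_eq_inner_right, hss, star_apply,
      RCLike.star_def, mul_assoc]
  rw [e]
  exact Finset.sum_nonneg fun c _ =>
    Complex.nonneg_iff.mpr ⟨inner_self_nonneg (𝕜 := ℂ), (inner_self_im (𝕜 := ℂ) _).symm⟩

lemma hasTrace_tensorOp {ρ : L2 S →L[ℂ] L2 S} {c : ℂ} (hρ : HasTrace ρ c) (M : Matrix T T ℂ) :
    HasTrace (tensorOp ρ M) (c * M.trace) := by
  classical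
  have h1 : HasSum (fun a => M a a) M.trace := hasSum_fintype _
  have h2 : HasSum (fun x => ⟪ket x, ρ (ket x)⟫_ℂ) c := hρ
  have h3 := hasSum_mul_complex h2 h1
  refine HasSum.congr_fun (g := fun p => ⟪ket p, tensorOp ρ M (ket p)⟫_ℂ) h3 fun p => ?_
  rw [tensorOp_ket, inner_sum, Finset.sum_eq_single p.2]
  · rw [inner_smul_right, mul_comm]
    congr 1
    have : (ket p : L2 (S × T)) = relabel (Function.Embedding.sectL S p.2) (ket p.1) := by
      rw [relabel_ket]; rfl
    rw [this, inner_relabel_relabel]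
  · intro a _ ha
    rw [inner_smul_right, inner_ket_left, relabel_apply_of_notMem, mul_zero]
    rintro ⟨x, hx⟩
    exact ha (congrArg Prod.snd hx)
  · simp

/-- Links the bounded observable to its action on the dense domain, so that `IsExpOf.comp_eq`
applies to it. -/
lemma tensorOp_one_toL2 (M : Matrix T T ℂ) (φ : Core (S × T)) :
    tensorOp 1 M (toL2 φ) = toL2 (coreTensor 1 (matrixOp M) φ) := by
  have h : (tensorOp 1 M).toLinearMap ∘ₗ toL2 =
      toL2 ∘ₗ coreTensor (1 : Module.End ℂ (Core S)) (matrixOp M) := by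
    refine core_end_ext fun p => ?_
    rw [LinearMap.comp_apply, LinearMap.comp_apply, toL2_single_one, coreTensor_single,
      Module.End.one_apply]
    have : matrixOp M (Finsupp.single p.2 1) = ∑ x, Finsupp.single x (M x p.2) := by
      simp [matrixOp]
    rw [this, TensorProduct.tmul_sum, map_sum, map_sum]
    refine (tensorOp_ket _ _ _).trans (Finset.sum_congr rfl fun a _ => ?_)
    rw [one_apply_eq_self, relabel_ket, finsuppTensorFinsupp'_single_tmul_single, one_mul,
      toL2_single]
    rfl
  exact LinearMap.congr_fun h φ

/-- In the block expansion only equal traced-out qubit configurations survive, and each term factors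
into one depending on the modes and one on the qubits; the qubit sum is finite. -/
lemma IsPartialTrace.tensorOp {Z S' W T' : Type} [Fintype T'] [Fintype W] {e : S × Z ≃ S'}
    {ρ : L2 S' →L[ℂ] L2 S'} {ρ' : L2 S →L[ℂ] L2 S} (h : IsPartialTrace e ρ ρ') (e' : T × W ≃ T')
    (M : Matrix T' T' ℂ) : IsPartialTrace (prodDecomposition e e') (tensorOp ρ M)
      (tensorOp ρ' (Matrix.of fun a b => ∑ c, M (e' (a, c)) (e' (b, c)))) := by
  classical
  intro φ ψ
  have hterm : ∀ p : Z × W, ⟪relabel (slice (prodDecomposition e e') p) φ,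
      JCGauss.tensorOp ρ M (relabel (slice (prodDecomposition e e') p) ψ)⟫_ℂ =
      ∑ a, ∑ b, M (e' (a, p.2)) (e' (b, p.2)) *
        ⟪relabel (slice e p.1) (component a φ), ρ (relabel (slice e p.1) (component b ψ))⟫_ℂ := by
    intro p
    rw [inner_tensorOp, ← e'.sum_comp, Fintype.sum_prod_type]
    refine Finset.sum_congr rfl fun a _ => ?_
    rw [Finset.sum_eq_single p.2]
    · rw [← e'.sum_comp, Fintype.sum_prod_type]
      refine Finset.sum_congr rfl fun b _ => ?_
      rw [Finset.sum_eq_single p.2]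
      · rw [component_slice, component_slice, if_pos rfl, if_pos rfl]
      · intro c _ hc
        rw [component_slice e e' p (b, c), if_neg hc, map_zero, inner_zero_right, mul_zero]
      · simp
    · intro c _ hc
      refine Finset.sum_eq_zero fun b _ => ?_
      rw [component_slice e e' p (a, c), if_neg hc, inner_zero_left, mul_zero]
    · simp
  refine HasSum.congr_fun ?_ hterm
  rw [inner_tensorOp]
  refine hasSum_sum fun a _ => hasSum_sum fun b _ => ?_
  rw [of_apply, mul_comm]
  have h1 := h (component a φ) (component b ψ)
  have h2 : HasSum (fun c => M (e' (a, c)) (e' (b, c))) (∑ c, M (e' (a, c)) (e' (b, c))) :=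
    hasSum_fintype _
  exact (hasSum_mul_complex h1 h2).congr_fun fun p => mul_comm _ _

end TensorOp

/-! ### Local operators on the qubits and the Jaynes-Cummings evolution -/

lemma matrixOp_single_eq {T : Type} [Fintype T] (M : Matrix T T ℂ) (y : T) :
    matrixOp M (Finsupp.single y 1) = ∑ x, Finsupp.single x (M x y) := by
  simp [matrixOp]

lemma matrixOp_mul {T : Type} [Fintype T] (M N : Matrix T T ℂ) :
    matrixOp (M * N) = matrixOp M * matrixOp N := by
  refine core_end_ext fun y => ?_
  ext x
  rw [matrixOp_single, Module.End.mul_apply, matrixOp_single_eq N, map_sum,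
    Finsupp.finsetSum_apply, Matrix.mul_apply]
  refine Finset.sum_congr rfl fun z _ => ?_
  rw [← mul_one (N z y), ← smul_eq_mul (N z y) 1, ← Finsupp.smul_single, map_smul,
    Finsupp.smul_apply, matrixOp_single, smul_eq_mul, smul_eq_mul, mul_one, mul_comm]

lemma commute_matrixOp {T : Type} [Fintype T] {M N : Matrix T T ℂ} (h : Commute M N) :
    Commute (matrixOp M) (matrixOp N) := by
  rw [commute_iff_eq, ← matrixOp_mul, h.eq, matrixOp_mul]

lemma commute_coreTensor {S T : Type} {A A' : Module.End ℂ (Core S)}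
    {B B' : Module.End ℂ (Core T)} (hA : Commute A A') (hB : Commute B B') :
    Commute (coreTensor A B) (coreTensor A' B') := by
  have hA' : A ∘ₗ A' = A' ∘ₗ A := hA.eq
  have hB' : B ∘ₗ B' = B' ∘ₗ B := hB.eq
  change coreTensor A B ∘ₗ coreTensor A' B' =
    coreTensor A' B' ∘ₗ coreTensor A B
  simp only [coreTensor]
  rw [← LinearEquiv.conj_comp, ← LinearEquiv.conj_comp, ← TensorProduct.map_comp,
    ← TensorProduct.map_comp, hA', hB']

section Qubits

variable {ι : Type} [Fintype ι] [DecidableEq ι]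

lemma matrixOp_atQubit_single (i : ι) (m : Matrix (Fin 2) (Fin 2) ℂ) (y : ι → Fin 2) :
    matrixOp (atQubit i m) (Finsupp.single y 1) =
      ∑ b, Finsupp.single (Function.update y i b) (m b (y i)) := by
  rw [matrixOp_single_eq]
  have hinj : Function.Injective fun b => Function.update y i b := Function.update_injective y i
  rw [← Finset.sum_subset (Finset.subset_univ (Finset.univ.image fun b => Function.update y i b)),
    Finset.sum_image fun a _ b _ hab => hinj hab]
  · refine Finset.sum_congr rfl fun b _ => ?_
    rw [atQubit, of_apply, if_pos fun l hl => Function.update_of_ne hl _ _, Function.update_self]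
  · intro x _ hx
    rw [atQubit, of_apply, if_neg, Finsupp.single_zero]
    intro h
    refine hx (Finset.mem_image.mpr ⟨x i, Finset.mem_univ _, ?_⟩)
    ext l
    by_cases hl : l = i
    · subst hl; simp
    · simp [hl, h l hl]

lemma commute_matrixOp_atQubit {i l : ι} (hil : i ≠ l) (m m' : Matrix (Fin 2) (Fin 2) ℂ) :
    Commute (matrixOp (atQubit i m)) (matrixOp (atQubit l m')) := by
  have hs : ∀ (i : ι) (m : Matrix (Fin 2) (Fin 2) ℂ) (y : ι → Fin 2) (c : ℂ),
      matrixOp (atQubit i m) (Finsupp.single y c) =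
        ∑ b, Finsupp.single (Function.update y i b) (c * m b (y i)) := fun i m y c => by
    rw [← mul_one c, ← smul_eq_mul c 1, ← Finsupp.smul_single, map_smul, matrixOp_atQubit_single,
      Finset.smul_sum]
    simp only [Finsupp.smul_single, smul_eq_mul, mul_one]
  refine core_end_ext fun y => ?_
  simp only [Module.End.mul_apply, hs, map_sum, one_mul, Function.update_of_ne hil,
    Function.update_of_ne hil.symm]
  rw [Finset.sum_comm]
  refine Finset.sum_congr rfl fun b _ => Finset.sum_congr rfl fun c _ => ?_
  rw [Function.update_comm hil, mul_comm]

/-- The identity factor at i splits off, and both products have entries m(xᵢ, yᵢ) times the Pauli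
entries at the other sites. In each matrix product one intermediate configuration survives: y with
its i-th entry taken from x, or x with its i-th entry taken from y. -/
lemma commute_pauliString_atQubit {P : ι → Pauli} {i : ι} (hP : P i = Pauli.I)
    (m : Matrix (Fin 2) (Fin 2) ℂ) : Commute (pauliString P) (atQubit i m) := by
  have hsplit : ∀ x y : ι → Fin 2, pauliString P x y =
      (1 : Matrix (Fin 2) (Fin 2) ℂ) (x i) (y i) *
        ∏ l ∈ Finset.univ.erase i, (P l).matrix (x l) (y l) := fun x y => by
    rw [pauliString, of_apply, ← Finset.mul_prod_erase _ _ (Finset.mem_univ i), hP]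
    rfl
  have h1 : pauliString P * atQubit i m = Matrix.of fun x y => m (x i) (y i) *
      ∏ l ∈ Finset.univ.erase i, (P l).matrix (x l) (y l) := by
    ext x y
    rw [Matrix.mul_apply, of_apply, Finset.sum_eq_single (Function.update y i (x i))]
    · rw [hsplit, Function.update_self, one_apply_eq, one_mul, atQubit, of_apply,
        if_pos fun l hl => Function.update_of_ne hl _ _, Function.update_self, mul_comm]
      congr 1
      refine Finset.prod_congr rfl fun l hl => ?_
      rw [Function.update_of_ne (Finset.ne_of_mem_erase hl)]
    · intro z _ hz
      rw [hsplit, atQubit, of_apply]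
      split_ifs with h
      · rw [one_apply_ne, zero_mul, zero_mul]
        intro hxz
        refine hz (funext fun l => ?_)
        by_cases hl : l = i
        · subst hl; simp [hxz]
        · rw [Function.update_of_ne hl, h l hl]
      · rw [mul_zero]
    · simp
  have h2 : atQubit i m * pauliString P = Matrix.of fun x y => m (x i) (y i) *
      ∏ l ∈ Finset.univ.erase i, (P l).matrix (x l) (y l) := by
    ext x y
    rw [Matrix.mul_apply, of_apply, Finset.sum_eq_single (Function.update x i (y i))]
    · rw [hsplit, Function.update_self, one_apply_eq, one_mul, atQubit, of_apply,
        if_pos fun l hl => (Function.update_of_ne hl _ _).symm, Function.update_self]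
      congr 1
      refine Finset.prod_congr rfl fun l hl => ?_
      rw [Function.update_of_ne (Finset.ne_of_mem_erase hl)]
    · intro z _ hz
      rw [hsplit, atQubit, of_apply]
      split_ifs with h
      · rw [one_apply_ne, zero_mul, mul_zero]
        intro hzy
        refine hz (funext fun l => ?_)
        by_cases hl : l = i
        · subst hl; simp [hzy]
        · rw [Function.update_of_ne hl, h l hl]
      · rw [zero_mul]
    · simp
  rw [commute_iff_eq, h1, h2]

/-- The coupling of mode `i` to qubit `i`. -/
def jcTerm (i : ι) : Module.End ℂ (Core ((ι → ℕ) × (ι → Fin 2))) :=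
  coreTensor (annihilation i) (matrixOp (atQubit i !![0, 1; 0, 0])) +
    coreTensor (creation i) (matrixOp (atQubit i !![0, 0; 1, 0]))

lemma jcHamiltonian_eq (g : ι → ℝ) : jcHamiltonian g = ∑ i, (g i : ℂ) • jcTerm i := rfl

lemma commute_jcTerm {i l : ι} (hil : i ≠ l) : Commute (jcTerm i) (jcTerm l) := by
  refine Commute.add_left (Commute.add_right ?_ ?_) (Commute.add_right ?_ ?_)
  · exact commute_coreTensor (commute_annihilation _ _) (commute_matrixOp_atQubit hil _ _)
  · exact commute_coreTensor (commute_annihilation_creation hil) (commute_matrixOp_atQubit hil _ _)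
  · exact commute_coreTensor (commute_annihilation_creation hil.symm).symm
      (commute_matrixOp_atQubit hil _ _)
  · exact commute_coreTensor (commute_creation _ _) (commute_matrixOp_atQubit hil _ _)

lemma commute_jcHamiltonian {g h : ι → ℝ} (hgh : ∀ i, g i = 0 ∨ h i = 0) :
    Commute (jcHamiltonian g) (jcHamiltonian h) := by
  rw [jcHamiltonian_eq, jcHamiltonian_eq]
  refine Commute.sum_left _ _ _ fun i _ => Commute.sum_right _ _ _ fun l _ => ?_
  by_cases hil : i = l
  · subst hil
    rcases hgh i with h0 | h0
    · rw [h0, Complex.ofReal_zero, zero_smul]; exact Commute.zero_left _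
    · rw [h0, Complex.ofReal_zero, zero_smul]; exact Commute.zero_right _
  · exact ((commute_jcTerm hil).smul_left _).smul_right _

lemma commute_jcHamiltonian_pauliString {g : ι → ℝ} {P : ι → Pauli}
    (h : ∀ i, g i = 0 ∨ P i = Pauli.I) :
    Commute (jcHamiltonian g) (coreTensor 1 (matrixOp (pauliString P))) := by
  rw [jcHamiltonian_eq]
  refine Commute.sum_left _ _ _ fun i _ => ?_
  rcases h i with h0 | h0
  · rw [h0, Complex.ofReal_zero, zero_smul]; exact Commute.zero_left _
  · refine Commute.smul_left (Commute.add_left ?_ ?_) _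
    · exact commute_coreTensor (Commute.one_right _) (commute_matrixOp (commute_pauliString_atQubit h0 _).symm)
    · exact commute_coreTensor (Commute.one_right _) (commute_matrixOp (commute_pauliString_atQubit h0 _).symm)

/-- The generator `-i t H_JC` of the evolution. -/
def jcGen (g : ι → ℝ) (t : ℝ) : Module.End ℂ (Core ((ι → ℕ) × (ι → Fin 2))) :=
  (-Complex.I * t) • jcHamiltonian g

lemma isExpOf_jcUnitary (g : ι → ℝ) (t : ℝ) : IsExpOf (jcGen g t) (jcUnitary g t) :=
  (exists_jcUnitary g t).choose_spec

lemma skew_jcGen (g : ι → ℝ) (t : ℝ) : Skew (jcGen g t) := by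
  have hA : Adj (jcHamiltonian g) (jcHamiltonian g) := by
    refine Adj.sum (fun j => ?_) _
    have h1 := adj_coreTensor (adj_annihilation j) (adj_matrixOp (atQubit j !![0, 1; 0, 0]))
    rw [atQubit_conjTranspose] at h1
    have h2 := (h1.add h1.symm).smul (g j : ℂ)
    rw [Complex.conj_ofReal] at h2
    rw [add_comm (coreTensor (creation j) _)] at h2
    exact h2
  have hs := hA.skew (-t)
  rwa [Complex.ofReal_neg, mul_neg, ← neg_mul] at hs

lemma entire_jcGen (g : ι → ℝ) (t : ℝ) : Entire (jcGen g t) := by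
  refine LinearGrowth.entire (N := fun p => photonNumber p.1) ?_
  exact (LinearGrowth.sum _ fun j => ((linearGrowth_tensor _ _ (bdd_annihilation j)).add
    (linearGrowth_tensor _ _ (bdd_creation j))).smul _).smul _

lemma jcGen_neg (g : ι → ℝ) (t : ℝ) : jcGen g (-t) = -jcGen g t := by
  refine LinearMap.ext fun φ => ?_
  simp [jcGen]

lemma adjoint_jcUnitary (g : ι → ℝ) (t : ℝ) :
    ContinuousLinearMap.adjoint (jcUnitary g t) = jcUnitary g (-t) :=
  (isExpOf_jcUnitary g t).adjoint_eq (skew_jcGen g t) (jcGen_neg g t ▸ isExpOf_jcUnitary g (-t))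

lemma adjoint_jcUnitary_comp_self (g : ι → ℝ) (t : ℝ) :
    ContinuousLinearMap.adjoint (jcUnitary g t) ∘L jcUnitary g t = 1 :=
  (isExpOf_jcUnitary g t).adjoint_comp_self (skew_jcGen g t) (entire_jcGen g t)

/-- The Baker–Campbell–Hausdorff formula with vanishing commutator. -/
lemma jcUnitary_add {g h : ι → ℝ} (hgh : ∀ i, g i = 0 ∨ h i = 0) (t : ℝ) :
    jcUnitary (g + h) t = jcUnitary g t ∘L jcUnitary h t := by
  have hadd : jcGen (g + h) t = jcGen g t + jcGen h t := by
    simp only [jcGen, jcHamiltonian_eq, Pi.add_apply, Complex.ofReal_add, add_smul,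
      Finset.sum_add_distrib, smul_add]
  have hcomm : Commute (jcGen g t) (jcGen h t) :=
    ((commute_jcHamiltonian hgh).smul_left _).smul_right _
  obtain ⟨c, hc⟩ : ∃ c : ℂ, c = 0 := ⟨0, rfl⟩
  have h0 : jcGen g t * jcGen h t - jcGen h t * jcGen g t = c • 1 := by
    refine LinearMap.ext fun φ => ?_
    rw [LinearMap.sub_apply, hcomm.eq, sub_self, hc, zero_smul, LinearMap.zero_apply]
  have := (isExpOf_jcUnitary g t).comp_eq_smul (skew_jcGen g t) (entire_jcGen g t)
    (entire_jcGen h t) (isExpOf_jcUnitary h t) (hadd ▸ isExpOf_jcUnitary (g + h) t) h0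
  rw [this, hc, zero_div, Complex.exp_zero, one_smul]

/-- Modes that carry no observable do not contribute to its Heisenberg evolution. -/
lemma heisenberg_pauliString {g h : ι → ℝ} {P : ι → Pauli} (hgh : ∀ i, g i = 0 ∨ h i = 0)
    (hg : ∀ i, g i = 0 ∨ P i = Pauli.I) (t : ℝ) :
    ContinuousLinearMap.adjoint (jcUnitary (g + h) t) ∘L tensorOp 1 (pauliString P) ∘L
        jcUnitary (g + h) t =
      ContinuousLinearMap.adjoint (jcUnitary h t) ∘L tensorOp 1 (pauliString P) ∘L
        jcUnitary h t := by
  -- The observable is moved past U_g, after which U_g† U_g = 1 cancels between U_h† and U_h.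
  have hc : tensorOp 1 (pauliString P) ∘L jcUnitary g t =
      jcUnitary g t ∘L tensorOp 1 (pauliString P) :=
    (isExpOf_jcUnitary g t).comp_eq (isExpOf_jcUnitary g t) (tensorOp_one_toL2 _)
      ((commute_jcHamiltonian_pauliString hg).symm.smul_right (-Complex.I * t)).eq
  have hU := adjoint_jcUnitary_comp_self g t
  ext1 f
  have h1 : ∀ f, tensorOp 1 (pauliString P) (jcUnitary g t f) =
      jcUnitary g t (tensorOp 1 (pauliString P) f) := fun f =>
    congrArg (fun T : L2 ((ι → ℕ) × (ι → Fin 2)) →L[ℂ] L2 ((ι → ℕ) × (ι → Fin 2)) => T f) hc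
  have h2 : ∀ f, ContinuousLinearMap.adjoint (jcUnitary g t) (jcUnitary g t f) = f := fun f =>
    congrArg (fun T : L2 ((ι → ℕ) × (ι → Fin 2)) →L[ℂ] L2 ((ι → ℕ) × (ι → Fin 2)) => T f) hU
  rw [jcUnitary_add hgh, ContinuousLinearMap.adjoint_comp]
  simp only [ContinuousLinearMap.comp_apply, h1, h2]

end Qubits

/-! ### Reduction of the dynamics to a pair of modes and qubits -/

lemma lmapDomain_tensor {S T S' T' : Type} (f : S → S') (f' : T → T') (φ : Core S) (ψ : Core T) :
    Finsupp.lmapDomain ℂ ℂ (Prod.map f f') (finsuppTensorFinsupp' ℂ S T (φ ⊗ₜ ψ)) =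
      finsuppTensorFinsupp' ℂ S' T' (Finsupp.lmapDomain ℂ ℂ f φ ⊗ₜ Finsupp.lmapDomain ℂ ℂ f' ψ) := by
  induction φ using Finsupp.induction_linear with
  | zero => simp
  | add φ₁ φ₂ h₁ h₂ => simp only [TensorProduct.add_tmul, map_add, h₁, h₂]
  | single x a =>
  induction ψ using Finsupp.induction_linear with
  | zero => simp
  | add ψ₁ ψ₂ h₁ h₂ => simp only [TensorProduct.tmul_add, map_add, h₁, h₂]
  | single y b =>
    simp only [finsuppTensorFinsupp'_single_tmul_single, Finsupp.lmapDomain_apply,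
      Finsupp.mapDomain_single, Prod.map_apply]

lemma coreTensor_comp_lmapDomain {S T S' T' : Type} {f : S → S'} {f' : T → T'}
    {A : Module.End ℂ (Core S)} {A' : Module.End ℂ (Core S')} {B : Module.End ℂ (Core T)}
    {B' : Module.End ℂ (Core T')}
    (hA : A' ∘ₗ Finsupp.lmapDomain ℂ ℂ f = Finsupp.lmapDomain ℂ ℂ f ∘ₗ A)
    (hB : B' ∘ₗ Finsupp.lmapDomain ℂ ℂ f' = Finsupp.lmapDomain ℂ ℂ f' ∘ₗ B) :
    coreTensor A' B' ∘ₗ Finsupp.lmapDomain ℂ ℂ (Prod.map f f') =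
      Finsupp.lmapDomain ℂ ℂ (Prod.map f f') ∘ₗ coreTensor A B := by
  refine core_end_ext fun p => ?_
  have hA' := LinearMap.congr_fun hA (Finsupp.single p.1 1)
  have hB' := LinearMap.congr_fun hB (Finsupp.single p.2 1)
  rw [LinearMap.comp_apply, LinearMap.comp_apply, Finsupp.lmapDomain_apply,
    Finsupp.mapDomain_single] at hA' hB'
  rw [LinearMap.comp_apply, LinearMap.comp_apply, Finsupp.lmapDomain_apply,
    Finsupp.mapDomain_single, coreTensor_single, coreTensor_single, lmapDomain_tensor,
    Prod.map_fst, Prod.map_snd, hA', hB']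

section Pair

variable {n : ℕ} {j k : Fin n}

lemma atQubit_comp_slice (hjk : j ≠ k) (z : {i : Fin n // i ≠ j ∧ i ≠ k} → Fin 2) (a : Fin 2)
    (m : Matrix (Fin 2) (Fin 2) ℂ) :
    matrixOp (atQubit (![j, k] a) m) ∘ₗ Finsupp.lmapDomain ℂ ℂ (slice (mergeEquiv hjk) z) =
      Finsupp.lmapDomain ℂ ℂ (slice (mergeEquiv hjk) z) ∘ₗ matrixOp (atQubit a m) := by
  refine core_end_ext fun x => ?_
  rw [LinearMap.comp_apply, LinearMap.comp_apply, matrixOp_atQubit_single, map_sum,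
    Finsupp.lmapDomain_apply, Finsupp.mapDomain_single, matrixOp_atQubit_single]
  refine Finset.sum_congr rfl fun b _ => ?_
  rw [Finsupp.lmapDomain_apply, Finsupp.mapDomain_single]
  change Finsupp.single (Function.update (merge j k x z) (![j, k] a) b)
    (m b (merge j k x z (![j, k] a))) = Finsupp.single (merge j k (Function.update x a b) z) _
  rw [merge_update hjk, merge_pair hjk]

lemma prod_eq_pair_mul {M : Type*} [CommMonoid M] (hjk : j ≠ k) (f : Fin n → M) :
    ∏ i, f i = (∏ a, f (![j, k] a)) * ∏ i : {i : Fin n // i ≠ j ∧ i ≠ k}, f i := by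
  rw [Fin.prod_univ_two, ← Finset.mul_prod_erase _ _ (Finset.mem_univ j),
    ← Finset.mul_prod_erase _ _ (Finset.mem_erase.mpr ⟨hjk.symm, Finset.mem_univ k⟩), mul_assoc]
  congr 2
  refine Finset.prod_subtype _ (fun i => ?_) f
  simp [and_comm]

lemma pauliString_merge (hjk : j ≠ k) {P : Fin n → Pauli}
    (hP : ∀ i, i ≠ j → i ≠ k → P i = Pauli.I) (x y : Fin 2 → Fin 2)
    (c d : {i : Fin n // i ≠ j ∧ i ≠ k} → Fin 2) :
    pauliString P (merge j k x c) (merge j k y d) =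
      if c = d then pauliString ![P j, P k] x y else 0 := by
  rw [pauliString, of_apply, prod_eq_pair_mul hjk]
  simp only [merge_pair hjk, merge_rest]
  have h1 : ∏ i : {i : Fin n // i ≠ j ∧ i ≠ k}, (P i).matrix (c i) (d i) =
      if c = d then 1 else 0 := by
    have : ∀ i : {i : Fin n // i ≠ j ∧ i ≠ k}, (P i).matrix (c i) (d i) =
        (1 : Matrix (Fin 2) (Fin 2) ℂ) (c i) (d i) := fun i => by
      rw [hP i i.2.1 i.2.2]; rfl
    simp only [this]
    split_ifs with h
    · subst h
      simp
    · obtain ⟨i, hi⟩ := Function.ne_iff.mp h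
      exact Finset.prod_eq_zero (Finset.mem_univ i) (one_apply_ne hi)
  rw [h1, mul_ite, mul_one, mul_zero]
  have h2 : ∏ a, (P (![j, k] a)).matrix (x a) (y a) = pauliString ![P j, P k] x y := by
    rw [pauliString, of_apply]
    refine Finset.prod_congr rfl fun a _ => ?_
    fin_cases a <;> rfl
  rw [h2]

lemma pauliString_comp_slice (hjk : j ≠ k) {P : Fin n → Pauli}
    (hP : ∀ i, i ≠ j → i ≠ k → P i = Pauli.I) (z : {i : Fin n // i ≠ j ∧ i ≠ k} → Fin 2) :
    matrixOp (pauliString P) ∘ₗ Finsupp.lmapDomain ℂ ℂ (slice (mergeEquiv hjk) z) =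
      Finsupp.lmapDomain ℂ ℂ (slice (mergeEquiv hjk) z) ∘ₗ
        matrixOp (pauliString ![P j, P k]) := by
  refine core_end_ext fun x => ?_
  rw [LinearMap.comp_apply, LinearMap.comp_apply, matrixOp_single_eq, map_sum,
    Finsupp.lmapDomain_apply, Finsupp.mapDomain_single, matrixOp_single_eq,
    ← (mergeEquiv (β := Fin 2) hjk).sum_comp, Fintype.sum_prod_type]
  refine Finset.sum_congr rfl fun y _ => ?_
  rw [Finsupp.lmapDomain_apply, Finsupp.mapDomain_single, Finset.sum_eq_single z]
  · congr 1
    exact (pauliString_merge hjk hP _ _ _ _).trans (if_pos rfl)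
  · intro c _ hc
    rw [show pauliString P (mergeEquiv hjk (y, c)) (slice (mergeEquiv hjk) z x) = 0 from
      (pauliString_merge hjk hP _ _ _ _).trans (if_neg hc), Finsupp.single_zero]
  · simp

/-- The decomposition of `n` modes and qubits into those with index `j`, `k` and the rest. -/
def pairDecomposition (hjk : j ≠ k) :
    ((Fin 2 → ℕ) × (Fin 2 → Fin 2)) × (({i : Fin n // i ≠ j ∧ i ≠ k} → ℕ) ×
      ({i : Fin n // i ≠ j ∧ i ≠ k} → Fin 2)) ≃ (Fin n → ℕ) × (Fin n → Fin 2) :=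
  prodDecomposition (mergeEquiv hjk) (mergeEquiv hjk)

lemma slice_pairDecomposition (hjk : j ≠ k) (p : ({i : Fin n // i ≠ j ∧ i ≠ k} → ℕ) ×
      ({i : Fin n // i ≠ j ∧ i ≠ k} → Fin 2)) : (slice (pairDecomposition hjk) p : _ → _) =
    Prod.map (slice (mergeEquiv hjk) p.1) (slice (mergeEquiv hjk) p.2) := rfl

lemma tensorOp_pauliString_comp_slice (hjk : j ≠ k) {P : Fin n → Pauli}
    (hP : ∀ i, i ≠ j → i ≠ k → P i = Pauli.I) (p : ({i : Fin n // i ≠ j ∧ i ≠ k} → ℕ) ×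
      ({i : Fin n // i ≠ j ∧ i ≠ k} → Fin 2)) :
    tensorOp 1 (pauliString P) ∘L relabel (slice (pairDecomposition hjk) p) =
      relabel (slice (pairDecomposition hjk) p) ∘L tensorOp 1 (pauliString ![P j, P k]) := by
  refine clm_ext_toL2 fun φ => ?_
  rw [ContinuousLinearMap.comp_apply, ContinuousLinearMap.comp_apply, relabel_toL2,
    tensorOp_one_toL2, tensorOp_one_toL2, relabel_toL2, slice_pairDecomposition]
  have h1 : (1 : Module.End ℂ (Core (Fin n → ℕ))) ∘ₗ
      Finsupp.lmapDomain ℂ ℂ (slice (mergeEquiv hjk) p.1) =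
      Finsupp.lmapDomain ℂ ℂ (slice (mergeEquiv hjk) p.1) ∘ₗ 1 := LinearMap.ext fun _ => rfl
  have h2 := LinearMap.congr_fun
    (coreTensor_comp_lmapDomain h1 (pauliString_comp_slice hjk hP p.2)) φ
  rw [LinearMap.comp_apply, LinearMap.comp_apply] at h2
  rw [h2]

/-- With couplings extended by zero, only the terms of the sites j and k remain in the Hamiltonian,
and each respects slices. -/
lemma jcUnitary_comp_slice (hjk : j ≠ k) (g : Fin n → ℝ) (t : ℝ)
    (p : ({i : Fin n // i ≠ j ∧ i ≠ k} → ℕ) × ({i : Fin n // i ≠ j ∧ i ≠ k} → Fin 2)) :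
    jcUnitary (Function.extend ![j, k] ![g j, g k] 0) t ∘L relabel (slice (pairDecomposition hjk) p) =
      relabel (slice (pairDecomposition hjk) p) ∘L jcUnitary ![g j, g k] t := by
  refine ((isExpOf_jcUnitary _ t).comp_eq (isExpOf_jcUnitary _ t) (relabel_toL2 _) ?_).symm
  have h : jcHamiltonian (Function.extend ![j, k] ![g j, g k] 0) =
      ∑ a, ((![g j, g k] a : ℝ) : ℂ) • jcTerm (![j, k] a) := by
    rw [jcHamiltonian_eq]
    exact sum_extend (injective_pair hjk) _ (F := fun (r : ℝ) i => (r : ℂ) • jcTerm i)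
      fun i => by rw [Complex.ofReal_zero, zero_smul]
  have hterm : ∀ a, jcTerm (![j, k] a) ∘ₗ
      Finsupp.lmapDomain ℂ ℂ (slice (pairDecomposition hjk) p) =
        Finsupp.lmapDomain ℂ ℂ (slice (pairDecomposition hjk) p) ∘ₗ jcTerm a := fun a => by
    rw [slice_pairDecomposition, jcTerm, jcTerm, LinearMap.add_comp, LinearMap.comp_add,
      coreTensor_comp_lmapDomain (annihilation_comp_slice hjk _ a) (atQubit_comp_slice hjk _ a _),
      coreTensor_comp_lmapDomain (creation_comp_slice hjk _ a) (atQubit_comp_slice hjk _ a _)]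
  rw [jcGen, jcGen, h, jcHamiltonian_eq]
  refine LinearMap.ext fun φ => ?_
  simp only [LinearMap.comp_apply, LinearMap.smul_apply, LinearMap.sum_apply, map_smul, map_sum]
  congr 1
  refine Finset.sum_congr rfl fun a _ => ?_
  congr 1
  exact (LinearMap.congr_fun (hterm a) φ).symm

/-- The reduced matrix is a sum of submatrices of M with the same row and column selection, each
positive semidefinite. -/
theorem isDensityMatrix_reducedQubits (hjk : j ≠ k) {M : Matrix (Fin n → Fin 2) (Fin n → Fin 2) ℂ}
    (hM : IsDensityMatrix M) : IsDensityMatrix (reducedQubits j k M) := by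
  constructor
  · have e : reducedQubits j k M = ∑ z, M.submatrix (merge j k · z) (merge j k · z) := by
      ext x y
      rw [Matrix.sum_apply]
      rfl
    rw [e]
    exact posSemidef_sum _ fun z _ => hM.1.submatrix _
  · rw [← hM.2, trace, trace, ← (mergeEquiv (β := Fin 2) hjk).sum_comp, Fintype.sum_prod_type]
    rfl

lemma HasTrace.unique {S : Type} {T : L2 S →L[ℂ] L2 S} {a b : ℂ} (ha : HasTrace T a)
    (hb : HasTrace T b) : a = b := HasSum.unique ha hb

lemma IsEnsemble.hasPauliExpectation {ι κ : Type} [Fintype ι] [DecidableEq ι]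
    {ρf : L2 (ι → ℕ) →L[ℂ] L2 (ι → ℕ)} {ρq : Matrix (ι → Fin 2) (ι → Fin 2) ℂ}
    {v : κ → L2 ((ι → ℕ) × (ι → Fin 2))} (hv : IsEnsemble v (tensorOp ρf ρq)) (g : ι → ℝ) (t : ℝ)
    (P : ι → Pauli) : HasPauliExpectation g t ρf ρq P
      (ensembleMean v (ContinuousLinearMap.adjoint (jcUnitary g t) ∘L tensorOp 1 (pauliString P) ∘L
        jcUnitary g t)) := by
  have h := hv.hasTrace (tensorOp 1 (pauliString P) ∘L jcUnitary g t)
    (ContinuousLinearMap.adjoint (jcUnitary g t))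
  rw [ContinuousLinearMap.comp_assoc] at h
  exact h

/-- The Heisenberg observable acts on every slice as its two-site counterpart, so its expectation is
computed by the partial trace of ρ_f ⊗ ρ_q, which is the product of the two partial traces.
Convergence on both sides comes from the ensembles. -/
theorem exists_hasPauliExpectation_reduced (hjk : j ≠ k)
    {ρf : L2 (Fin n → ℕ) →L[ℂ] L2 (Fin n → ℕ)} (hρf : IsDensityOperator ρf)
    {ρq : Matrix (Fin n → Fin 2) (Fin n → Fin 2) ℂ} (hρq : IsDensityMatrix ρq)
    (g : Fin n → ℝ) (t : ℝ) {P : Fin n → Pauli} (hP : ∀ i, i ≠ j → i ≠ k → P i = Pauli.I) :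
    ∃ c : ℂ, HasPauliExpectation g t ρf ρq P c ∧
      HasPauliExpectation ![g j, g k] t (reducedModes hjk ρf) (reducedQubits j k ρq)
        ![P j, P k] c := by
  have hpt := isPartialTrace_reducedModes hjk hρf
  have hρf' := hpt.isDensityOperator hρf
  have hρq' := isDensityMatrix_reducedQubits hjk hρq
  obtain ⟨v, hv⟩ := exists_isEnsemble (isPositive_tensorOp hρf.1 hρq.1)
    (hasTrace_tensorOp hρf.2 ρq)
  obtain ⟨w, hw⟩ := exists_isEnsemble (isPositive_tensorOp hρf'.1 hρq'.1)
    (hasTrace_tensorOp hρf'.2 (reducedQubits j k ρq))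
  have hpt2 : IsPartialTrace (pairDecomposition hjk) (tensorOp ρf ρq)
      (tensorOp (reducedModes hjk ρf) (reducedQubits j k ρq)) := hpt.tensorOp (mergeEquiv hjk) ρq
  set h : Fin n → ℝ := Function.extend ![j, k] ![g j, g k] 0 with hh
  have hval : ∀ i, h i = if i = j ∨ i = k then g i else 0 := fun i => by
    by_cases hi : i ≠ j ∧ i ≠ k
    · rw [if_neg (by tauto), hh, Function.extend_apply']
      · rfl
      · rintro ⟨a, rfl⟩
        fin_cases a <;> simp at hi
    · obtain ⟨a, rfl⟩ := exists_pair_eq hi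
      rw [hh, (injective_pair hjk).extend_apply]
      fin_cases a <;> simp
  -- At each site one of the two couplings vanishes, and where g - h does not, the Pauli factor is
  -- the identity.
  have hgh : g = (g - h) + h := by simp
  have hdisj : ∀ i, (g - h) i = 0 ∨ h i = 0 := fun i => by
    rw [Pi.sub_apply, hval]
    split_ifs <;> simp
  have hPi : ∀ i, (g - h) i = 0 ∨ P i = Pauli.I := fun i => by
    by_cases hi : i = j ∨ i = k
    · left; rw [Pi.sub_apply, hval, if_pos hi, sub_self]
    · right; rw [not_or] at hi; exact hP i hi.1 hi.2
  have hheis := heisenberg_pauliString hdisj hPi t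
  rw [← hgh] at hheis
  -- The adjoint is the evolution at time -t, so all three factors pass through the slice embedding
  -- by lemmas already available.
  have hinter : ∀ p, (ContinuousLinearMap.adjoint (jcUnitary h t) ∘L
      tensorOp 1 (pauliString P) ∘L jcUnitary h t) ∘L relabel (slice (pairDecomposition hjk) p) =
      relabel (slice (pairDecomposition hjk) p) ∘L
        (ContinuousLinearMap.adjoint (jcUnitary ![g j, g k] t) ∘L
          tensorOp 1 (pauliString ![P j, P k]) ∘L jcUnitary ![g j, g k] t) := fun p => by
    rw [adjoint_jcUnitary, adjoint_jcUnitary, ContinuousLinearMap.comp_assoc,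
      ContinuousLinearMap.comp_assoc, jcUnitary_comp_slice hjk,
      ← ContinuousLinearMap.comp_assoc (tensorOp 1 _), tensorOp_pauliString_comp_slice hjk hP,
      ContinuousLinearMap.comp_assoc, ← ContinuousLinearMap.comp_assoc (jcUnitary h (-t)),
      jcUnitary_comp_slice hjk, ContinuousLinearMap.comp_assoc]
  have hred := hpt2.hasTrace_comp hinter (hv.hasTrace_comp _)
  have heq := hred.unique (hw.hasTrace_comp _)
  rw [← hheis] at heq
  refine ⟨_, hv.hasPauliExpectation g t P, ?_⟩
  rw [heq]
  exact hw.hasPauliExpectation _ t _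

end Pair

end JCGauss

end

theorem mainTheorem4 (n : ℕ) (j k : Fin n) (hjk : j ≠ k)
    (ρf : L2 (Fin n → ℕ) →L[ℂ] L2 (Fin n → ℕ))
    (μ : Fin n × Fin 2 → ℝ) (Γ : Matrix (Fin n × Fin 2) (Fin n × Fin 2) ℝ)
    (hρf : IsGaussianState ρf μ Γ)
    (ρq : Matrix (Fin n → Fin 2) (Fin n → Fin 2) ℂ) (hρq : IsDensityMatrix ρq) :
    IsGaussianState (reducedModes hjk ρf) (pairMean j k μ) (pairCovariance j k Γ) ∧
    IsDensityMatrix (reducedQubits j k ρq) ∧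
    ∀ (g : Fin n → ℝ) (t : ℝ) (P : Fin n → Pauli), (∀ i, i ≠ j → i ≠ k → P i = Pauli.I) →
      ∀ σ : L2 (Fin 2 → ℕ) →L[ℂ] L2 (Fin 2 → ℕ),
        IsGaussianState σ (pairMean j k μ) (pairCovariance j k Γ) →
        ∃ c : ℂ, HasPauliExpectation g t ρf ρq P c ∧
          HasPauliExpectation ![g j, g k] t σ (reducedQubits j k ρq) ![P j, P k] c := by
  have hn : IsGaussianState (reducedModes hjk ρf) (pairMean j k μ) (pairCovariance j k Γ) :=
    hρf.reducedModes hjk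
  refine ⟨hn, isDensityMatrix_reducedQubits hjk hρq, fun g t P hP σ hσ => ?_⟩
  -- Both σ and the reduced state are Gaussian with the same moments, hence equal; it remains to
  -- treat the reduced state itself.
  rw [hσ.ext hn]
  exact exists_hasPauliExpectation_reduced hjk hρf.state hρq g t hP
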